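/- Let $R$ be a commutative superring, i.e. a $\mathbb Z_2$-graded unital associative ring with $rs=(-1)^{|r||s|}sr$ for homogeneous $r,s$. An $R$-superalgebra is a $\mathbb Z_2$-graded unital associative ring $A$ with an even unital ring morphism $R\to A$ such that $ra=(-1)^{|r||a|}ar$ for homogeneous $r\in R$, $a\in A$; $A$ need not be commutative. For $R$-superalgebras $A,B$, an $A$-$B$-bimodule is a $\mathbb Z_2$-graded abelian group with commuting, grading-compatible left $A$- and right $B$-actions such that $rm=(-1)^{|r||m|}mr$ for homogeneous $r\in R$ and $m$. Tensor products are graded by total parity, and those without subscript are over $R$. For an $A$-$A$-bimodule $M$, let $H_*(A,M)$ be the homology of the complex of $R$-modules $C_n(A,M)=M\otimes A^{\otimes n}$ with differential $d=\sum_{i=0}^{n}(-1)^i\delta_i$, where for homogeneous elements $$\delta_0(m\otimes a_1\otimes\dots\otimes a_n)=ma_1\otimes a_2\otimes\dots\otimes a_n,$$ $$\delta_i(m\otimes a_1\otimes\dots\otimes a_n)=m\otimes a_1\otimes\dots\otimes a_ia_{i+1}\otimes\dots\otimes a_n\quad(0<i<n),$$ $$\delta_n(m\otimes a_1\otimes\dots\otimes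 a_n)=(-1)^{|a_n|(|m|+|a_1|+\dots+|a_{n-1}|)}\,a_nm\otimes a_1\otimes\dots\otimes a_{n-1}$$ (and $d=0$ on $C_0$). Each $H_n(A,M)$ is a $\mathbb Z_2$-graded $R$-module, its part of parity $k$ consisting of the classes of cycles of parity $k$. **Theorem.** For all $R$-superalgebras $A,B$, every $A$-$B$-bimodule $P$ that is projective both as a left $A$-module and as a right $B$-module, every $B$-$A$-bimodule $Q$, and every $n\ge 0$, there is an isomorphism of $\mathbb Z_2$-graded $R$-modules (preserving parity) $$F_n: H_n(A,P\otimes_BQ)\xrightarrow{\ \cong\ }H_n(B,Q\otimes_AP).$$ These isomorphisms can be chosen functorially in $(A,B;P,Q)$: if $f:A\to A'$ and $g:B\to B'$ are even morphisms of unital $R$-superalgebras and $p:P\to P'$, $q:Q\to Q'$ are even additive maps with $p(axb)=f(a)p(x)g(b)$ and $q(bya)=g(b)q(y)f(a)$, where $(A',B';P',Q')$ also satisfies the assumptions, then $F'_n\circ (p\otimes q)_*=(q\otimes p)_*\circ F_n$ for all $n$. -/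

import Mathlib

open CategoryTheory
open scoped TensorProduct

universe u v w s t s' w'

namespace SuperHochschild

/-! ### `ℤ/2`-gradings on abelian groups -/

section Grading

variable {M : Type v} [AddCommGroup M]

/-- The homogeneous component of parity `k`, as an additive map. -/
def comp (gr : ZMod 2 → AddSubgroup M) [DirectSum.Decomposition gr] (k : ZMod 2) : M →+ M where
  toFun x := (DirectSum.decompose gr x k : M)
  map_zero' := by simp
  map_add' x y := by simp

theorem comp_same (gr : ZMod 2 → AddSubgroup M) [DirectSum.Decomposition gr] {k : ZMod 2} {x : M}
    (hx : x ∈ gr k) : comp gr k x = x :=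
  DirectSum.decompose_of_mem_same gr hx

theorem comp_ne (gr : ZMod 2 → AddSubgroup M) [DirectSum.Decomposition gr] {k j : ZMod 2} {x : M}
    (hx : x ∈ gr k) (h : k ≠ j) : comp gr j x = 0 :=
  DirectSum.decompose_of_mem_ne gr hx h

theorem comp_mem (gr : ZMod 2 → AddSubgroup M) [DirectSum.Decomposition gr] (k : ZMod 2) (x : M) :
    comp gr k x ∈ gr k :=
  (DirectSum.decompose gr x k).2

theorem map_units {X : Type w} [AddCommGroup X] (f : M →+ X) (e : ℤˣ) (x : M) :
    f (e • x) = e • f x := by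
  rw [Units.smul_def, Units.smul_def, map_zsmul]

/-- Two additive maps that agree on homogeneous elements are equal. -/
theorem hom_ext_homogeneous {X : Type w} [AddCommGroup X] (gr : ZMod 2 → AddSubgroup M)
    [DirectSum.Decomposition gr] {f g : M →+ X} (h : ∀ k, ∀ x ∈ gr k, f x = g x) : f = g := by
  ext x
  induction x using DirectSum.Decomposition.inductionOn gr with
  | zero => simp
  | homogeneous m => exact h _ _ m.2
  | add a b ha hb => simp [ha, hb]

/-- A family of complementary projections onto the subgroups `gr k` gives a decomposition. -/
@[reducible]
def decompositionOfProj (gr : ZMod 2 → AddSubgroup M) (π : ZMod 2 → M →+ M)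
    (h1 : ∀ k x, π k x ∈ gr k) (h2 : ∀ k, ∀ x ∈ gr k, π k x = x)
    (h3 : ∀ k j, k ≠ j → ∀ x ∈ gr k, π j x = 0) (h4 : ∀ x, ∑ k, π k x = x) :
    DirectSum.Decomposition gr where
  decompose' x := ∑ k, DirectSum.of (fun k => gr k) k ⟨π k x, h1 k x⟩
  left_inv x := by
    rw [map_sum]
    simpa using h4 x
  right_inv y := by
    induction y using DirectSum.induction_on with
    | zero =>
      refine Finset.sum_eq_zero fun k _ => ?_
      have : (⟨π k (DirectSum.coeAddMonoidHom gr 0), h1 k _⟩ : gr k) = 0 := by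
        ext; simp
      rw [this, map_zero]
    | of i x =>
      refine (Finset.sum_eq_single i ?_ ?_).trans ?_
      rotate_right
      · congr 1
        ext
        simpa using h2 i x x.2
      · intro j _ hj
        have : (⟨π j (DirectSum.coeAddMonoidHom gr (DirectSum.of (fun k => gr k) i x)), h1 j _⟩
            : gr j) = 0 := by
          ext
          simpa using h3 i j (Ne.symm hj) x x.2
        rw [this, map_zero]
      · simp
    | add x y hx hy =>
      conv_rhs => rw [← hx, ← hy]
      rw [← Finset.sum_add_distrib]
      refine Finset.sum_congr rfl fun k _ => ?_
      rw [← map_add]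
      congr 1
      ext
      simp

end Grading

/-! ### The tensor product over a noncommutative ring -/

section BalTensor

variable (S : Type s) [Ring S] (M : Type v) (N : Type w) [AddCommGroup M] [AddCommGroup N]
  [Module Sᵐᵒᵖ M] [Module S N]

/-- The subgroup of `M ⊗_ℤ N` generated by the elements `m s ⊗ n - m ⊗ s n`. -/
def balRel : AddSubgroup (M ⊗[ℤ] N) :=
  AddSubgroup.closure
    {x | ∃ (m : M) (a : S) (n : N), x = (MulOpposite.op a • m) ⊗ₜ[ℤ] n - m ⊗ₜ[ℤ] (a • n)}

/-- The tensor product `M ⊗_S N` of a right `S`-module and a left `S`-module. -/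
def BalTensor : Type (max v w) := (M ⊗[ℤ] N) ⧸ balRel S M N

instance : AddCommGroup (BalTensor S M N) :=
  inferInstanceAs (AddCommGroup ((M ⊗[ℤ] N) ⧸ balRel S M N))

namespace BalTensor

variable {M N}

/-- The class of `m ⊗ n` in `M ⊗_S N`, as a biadditive map. -/
def tmul : M →+ N →+ BalTensor S M N where
  toFun m :=
    { toFun := fun n => QuotientAddGroup.mk' (balRel S M N) (m ⊗ₜ[ℤ] n)
      map_zero' := by rw [TensorProduct.tmul_zero, map_zero]; rfl
      map_add' := fun x y => by rw [TensorProduct.tmul_add, map_add]; rfl }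
  map_zero' := by
    ext n
    change QuotientAddGroup.mk' (balRel S M N) ((0 : M) ⊗ₜ[ℤ] n) = 0
    rw [TensorProduct.zero_tmul, map_zero]
  map_add' x y := by
    ext n
    change QuotientAddGroup.mk' (balRel S M N) ((x + y) ⊗ₜ[ℤ] n) = _
    rw [TensorProduct.add_tmul, map_add]
    rfl

theorem op_smul_tmul (m : M) (a : S) (n : N) :
    tmul S (MulOpposite.op a • m) n = tmul S m (a • n) := by
  change QuotientAddGroup.mk' (balRel S M N) _ = QuotientAddGroup.mk' (balRel S M N) _
  rw [← sub_eq_zero, ← map_sub, QuotientAddGroup.mk'_apply, QuotientAddGroup.eq_zero_iff]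
  exact AddSubgroup.subset_closure ⟨m, a, n, rfl⟩

variable {S}

@[elab_as_elim]
theorem induction_on {motive : BalTensor S M N → Prop} (x : BalTensor S M N)
    (zero : motive 0) (tmul : ∀ m n, motive (tmul S m n))
    (add : ∀ x y, motive x → motive y → motive (x + y)) : motive x := by
  obtain ⟨y, rfl⟩ := QuotientAddGroup.mk'_surjective (balRel S M N) x
  induction y using TensorProduct.induction_on with
  | zero => rw [map_zero]; exact zero
  | tmul m n => exact tmul m n
  | add a b ha hb => rw [map_add]; exact add _ _ ha hb

variable {X : Type t} [AddCommGroup X]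

/-- A balanced biadditive map factors through the tensor product. -/
def lift (f : M →+ N →+ X) (h : ∀ m (a : S) n, f (MulOpposite.op a • m) n = f m (a • n)) :
    BalTensor S M N →+ X :=
  QuotientAddGroup.lift (balRel S M N)
    (TensorProduct.liftAddHom f fun z m n => by
      rw [map_zsmul, map_zsmul, AddMonoidHom.smul_apply])
    (by
      rw [balRel, AddSubgroup.closure_le]
      rintro _ ⟨m, a, n, rfl⟩
      simp [AddMonoidHom.mem_ker, h])

@[simp]
theorem lift_tmul (f : M →+ N →+ X)
    (h : ∀ m (a : S) n, f (MulOpposite.op a • m) n = f m (a • n)) (m : M) (n : N) :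
    lift f h (tmul S m n) = f m n := rfl

theorem hom_ext {f g : BalTensor S M N →+ X}
    (h : ∀ m n, f (tmul S m n) = g (tmul S m n)) : f = g := by
  ext x
  induction x using induction_on with
  | zero => simp
  | tmul m n => exact h m n
  | add x y hx hy => simp [hx, hy]

end BalTensor

end BalTensor

/-! ### Superrings, superalgebras, superbimodules -/

/-- A (super)commutative superring: a `ℤ/2`-graded ring with `x y = (-1)^{|x||y|} y x` for
homogeneous `x`, `y`. -/
structure CommSuperring where
  carrier : Type u
  [ring : Ring carrier]
  gr : ZMod 2 → AddSubgroup carrier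
  [graded : GradedRing gr]
  comm : ∀ {i j : ZMod 2} {x y : carrier}, x ∈ gr i → y ∈ gr j →
    x * y = (-1 : ℤˣ) ^ (i * j) • (y * x)

attribute [instance] CommSuperring.ring CommSuperring.graded

/-- A unital associative superalgebra over `R`: a `ℤ/2`-graded ring with an even ring morphism
from `R` whose image is supercentral. -/
structure SuperAlgebra (R : CommSuperring.{u}) where
  carrier : Type v
  [ring : Ring carrier]
  gr : ZMod 2 → AddSubgroup carrier
  [graded : GradedRing gr]
  algMap : R.carrier →+* carrier
  algMap_mem : ∀ {i : ZMod 2} {r : R.carrier}, r ∈ R.gr i → algMap r ∈ gr i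
  comm : ∀ {i j : ZMod 2} {r : R.carrier} {a : carrier}, r ∈ R.gr i → a ∈ gr j →
    algMap r * a = (-1 : ℤˣ) ^ (i * j) • (a * algMap r)

attribute [instance] SuperAlgebra.ring SuperAlgebra.graded

variable {R : CommSuperring.{u}}

/-- A (`ℤ/2`-graded) `A`-`B`-bimodule over `R`. The left and right actions are even and commute,
and the two actions of `R` through `A` and `B` agree up to the Koszul sign. Right `B`-modules are
modules over the opposite ring: `MulOpposite.op b • m` is `m b`. -/
structure SuperBimodule (A : SuperAlgebra.{u, s} R) (B : SuperAlgebra.{u, t} R) where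
  carrier : Type v
  [addCommGroup : AddCommGroup carrier]
  [leftModule : Module A.carrier carrier]
  [rightModule : Module B.carrierᵐᵒᵖ carrier]
  [smulComm : SMulCommClass A.carrier B.carrierᵐᵒᵖ carrier]
  gr : ZMod 2 → AddSubgroup carrier
  [decomposition : DirectSum.Decomposition gr]
  smul_mem : ∀ {i j : ZMod 2} {a : A.carrier} {m : carrier}, a ∈ A.gr i → m ∈ gr j →
    a • m ∈ gr (i + j)
  op_smul_mem : ∀ {i j : ZMod 2} {m : carrier} {b : B.carrier}, m ∈ gr i → b ∈ B.gr j →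
    MulOpposite.op b • m ∈ gr (i + j)
  base_comm : ∀ {i j : ZMod 2} {r : R.carrier} {m : carrier}, r ∈ R.gr i → m ∈ gr j →
    A.algMap r • m = (-1 : ℤˣ) ^ (i * j) • (MulOpposite.op (B.algMap r) • m)

attribute [instance] SuperBimodule.addCommGroup SuperBimodule.leftModule
  SuperBimodule.rightModule SuperBimodule.smulComm SuperBimodule.decomposition

/-- An even morphism of unital `R`-superalgebras. -/
structure SuperAlgebraHom (A : SuperAlgebra.{u, s} R) (A' : SuperAlgebra.{u, t} R) where
  toFun : A.carrier →+* A'.carrier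
  map_mem : ∀ {i : ZMod 2} {a : A.carrier}, a ∈ A.gr i → toFun a ∈ A'.gr i
  map_algMap : ∀ r, toFun (A.algMap r) = A'.algMap r

/-- The identity morphism. -/
def SuperAlgebraHom.id (A : SuperAlgebra.{u, s} R) : SuperAlgebraHom A A where
  toFun := RingHom.id _
  map_mem h := h
  map_algMap _ := rfl

/-- The ground superring as a superalgebra over itself. -/
def base (R : CommSuperring.{u}) : SuperAlgebra.{u, u} R where
  carrier := R.carrier
  gr := R.gr
  algMap := RingHom.id _
  algMap_mem h := h
  comm := R.comm

namespace SuperBimodule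

/-- Projectivity as a left `A`-module and as a right `B`-module. (For a `ℤ/2`-graded module,
this is the same as projectivity in the category of graded modules and even maps.) -/
def IsBiprojective {A : SuperAlgebra.{u, s} R} {B : SuperAlgebra.{u, t} R}
    (P : SuperBimodule.{u, v, s, t} A B) : Prop :=
  Module.Projective A.carrier P.carrier ∧ Module.Projective B.carrierᵐᵒᵖ P.carrier

/-- An even additive map `M → M'` with `u (a m b) = f a • u m • g b`, for morphisms
`f : A → A'` and `g : B → B'`. -/
structure Hom {A : SuperAlgebra.{u, s} R} {A' : SuperAlgebra.{u, s} R}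
    {B : SuperAlgebra.{u, t} R} {B' : SuperAlgebra.{u, t} R}
    (f : SuperAlgebraHom A A') (g : SuperAlgebraHom B B')
    (M : SuperBimodule.{u, v, s, t} A B) (M' : SuperBimodule.{u, v, s, t} A' B') where
  toFun : M.carrier →+ M'.carrier
  map_mem : ∀ {i : ZMod 2} {m : M.carrier}, m ∈ M.gr i → toFun m ∈ M'.gr i
  map_smul : ∀ a m, toFun (a • m) = f.toFun a • toFun m
  map_op_smul : ∀ b m, toFun (MulOpposite.op b • m) = MulOpposite.op (g.toFun b) • toFun m

/-- The identity of a bimodule. -/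
def Hom.id {A : SuperAlgebra.{u, s} R} {B : SuperAlgebra.{u, t} R}
    (M : SuperBimodule.{u, v, s, t} A B) :
    Hom (SuperAlgebraHom.id A) (SuperAlgebraHom.id B) M M where
  toFun := AddMonoidHom.id _
  map_mem h := h
  map_smul _ _ := rfl
  map_op_smul _ _ := rfl

/-- `A` as a bimodule over itself. -/
def regular (A : SuperAlgebra.{u, s} R) : SuperBimodule.{u, s, s, s} A A where
  carrier := A.carrier
  gr := A.gr
  smul_mem ha hm := SetLike.mul_mem_graded ha hm
  op_smul_mem hm hb := SetLike.mul_mem_graded hm hb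
  base_comm hr hm := A.comm hr hm

/-- A morphism of superalgebras as a morphism of bimodules. -/
def regularMap {A A' : SuperAlgebra.{u, s} R} (f : SuperAlgebraHom A A') :
    Hom f f (regular A) (regular A') where
  toFun := f.toFun.toAddMonoidHom
  map_mem h := f.map_mem h
  map_smul a m := f.toFun.map_mul a m
  map_op_smul b m := f.toFun.map_mul m b

/-- Restriction of the left action to the ground superring. -/
def restrictLeft {A : SuperAlgebra.{u, s} R} {B : SuperAlgebra.{u, t} R}
    (M : SuperBimodule.{u, v, s, t} A B) : SuperBimodule.{u, v, u, t} (base R) B :=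
  letI : Module (base R).carrier M.carrier := Module.compHom M.carrier A.algMap
  { carrier := M.carrier
    smulComm := ⟨fun r b m => smul_comm (A.algMap r) b m⟩
    gr := M.gr
    smul_mem := fun ha hm => M.smul_mem (A.algMap_mem ha) hm
    op_smul_mem := M.op_smul_mem
    base_comm := M.base_comm }

/-- Restriction of the right action to the ground superring. -/
def restrictRight {A : SuperAlgebra.{u, s} R} {B : SuperAlgebra.{u, t} R}
    (M : SuperBimodule.{u, v, s, t} A B) : SuperBimodule.{u, v, s, u} A (base R) :=
  letI : Module (base R).carrierᵐᵒᵖ M.carrier := Module.compHom M.carrier B.algMap.op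
  { carrier := M.carrier
    smulComm := ⟨fun a r m => smul_comm a (B.algMap.op r) m⟩
    gr := M.gr
    smul_mem := M.smul_mem
    op_smul_mem := fun hm hb => M.op_smul_mem hm (B.algMap_mem hb)
    base_comm := M.base_comm }

/-- Restriction of the left action, on morphisms. -/
def restrictLeftMap {A A' : SuperAlgebra.{u, s} R} {B B' : SuperAlgebra.{u, t} R}
    {f : SuperAlgebraHom A A'} {g : SuperAlgebraHom B B'}
    {M : SuperBimodule.{u, v, s, t} A B} {M' : SuperBimodule.{u, v, s, t} A' B'}
    (h : Hom f g M M') :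
    Hom (SuperAlgebraHom.id (base R)) g M.restrictLeft M'.restrictLeft where
  toFun := h.toFun
  map_mem := h.map_mem
  map_smul r m := (h.map_smul (A.algMap r) m).trans
    (congrArg (fun x => x • h.toFun m) (f.map_algMap r))
  map_op_smul := h.map_op_smul

/-- Restriction of the right action, on morphisms. -/
def restrictRightMap {A A' : SuperAlgebra.{u, s} R} {B B' : SuperAlgebra.{u, t} R}
    {f : SuperAlgebraHom A A'} {g : SuperAlgebraHom B B'}
    {M : SuperBimodule.{u, v, s, t} A B} {M' : SuperBimodule.{u, v, s, t} A' B'}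
    (h : Hom f g M M') :
    Hom f (SuperAlgebraHom.id (base R)) M.restrictRight M'.restrictRight where
  toFun := h.toFun
  map_mem := h.map_mem
  map_smul := h.map_smul
  map_op_smul r m := (h.map_op_smul (B.algMap r) m).trans
    (congrArg (fun x => MulOpposite.op x • h.toFun m) (g.map_algMap r))

/-! ### Tensor products of superbimodules -/

section Tensor

variable {A : SuperAlgebra.{u, s} R} {B : SuperAlgebra.{u, t} R} {C : SuperAlgebra.{u, s'} R}

/-- The underlying abelian group `P ⊗_B Q`. -/
abbrev TensorCarrier (P : SuperBimodule.{u, v, s, t} A B) (Q : SuperBimodule.{u, w, t, s'} B C) :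
    Type (max v w) :=
  BalTensor B.carrier P.carrier Q.carrier

variable (P : SuperBimodule.{u, v, s, t} A B) (Q : SuperBimodule.{u, w, t, s'} B C)

/-- `a (p ⊗ q) = (a p) ⊗ q`. -/
def tensorLeftAct (a : A.carrier) : TensorCarrier P Q →+ TensorCarrier P Q :=
  BalTensor.lift ((BalTensor.tmul B.carrier).comp (DistribSMul.toAddMonoidHom P.carrier a))
    fun m b n => by
      change BalTensor.tmul B.carrier (a • (MulOpposite.op b • m)) n = _
      rw [smul_comm, BalTensor.op_smul_tmul]
      rfl

/-- `(p ⊗ q) c = p ⊗ (q c)`. -/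
def tensorRightAct (c : C.carrierᵐᵒᵖ) : TensorCarrier P Q →+ TensorCarrier P Q :=
  BalTensor.lift ((BalTensor.tmul B.carrier).compl₂ (DistribSMul.toAddMonoidHom Q.carrier c))
    fun m b n => by
      change BalTensor.tmul B.carrier (MulOpposite.op b • m) (c • n) =
        BalTensor.tmul B.carrier m (c • (b • n))
      rw [BalTensor.op_smul_tmul, smul_comm]

instance tensorLeftModule : Module A.carrier (TensorCarrier P Q) where
  smul a x := tensorLeftAct P Q a x
  one_smul x := DFunLike.congr_fun (f := tensorLeftAct P Q 1) (g := AddMonoidHom.id _)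
    (BalTensor.hom_ext fun m n => congrArg (fun y => BalTensor.tmul B.carrier y n)
      (one_smul A.carrier m)) x
  mul_smul a b x := DFunLike.congr_fun (f := tensorLeftAct P Q (a * b))
    (g := (tensorLeftAct P Q a).comp (tensorLeftAct P Q b))
    (BalTensor.hom_ext fun m n => congrArg (fun y => BalTensor.tmul B.carrier y n)
      (mul_smul a b m)) x
  smul_zero a := map_zero _
  smul_add a x y := map_add _ x y
  add_smul a b x := DFunLike.congr_fun (f := tensorLeftAct P Q (a + b))
    (g := tensorLeftAct P Q a + tensorLeftAct P Q b)
    (BalTensor.hom_ext fun m n => by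
      change BalTensor.tmul B.carrier ((a + b) • m) n =
        BalTensor.tmul B.carrier (a • m) n + BalTensor.tmul B.carrier (b • m) n
      rw [add_smul, map_add]; rfl) x
  zero_smul x := DFunLike.congr_fun (f := tensorLeftAct P Q 0) (g := 0)
    (BalTensor.hom_ext fun m n => by
      change BalTensor.tmul B.carrier ((0 : A.carrier) • m) n = 0
      rw [zero_smul, map_zero]; rfl) x

instance tensorRightModule : Module C.carrierᵐᵒᵖ (TensorCarrier P Q) where
  smul a x := tensorRightAct P Q a x
  one_smul x := DFunLike.congr_fun (f := tensorRightAct P Q 1) (g := AddMonoidHom.id _)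
    (BalTensor.hom_ext fun m n => congrArg (fun y => BalTensor.tmul B.carrier m y)
      (one_smul C.carrierᵐᵒᵖ n)) x
  mul_smul a b x := DFunLike.congr_fun (f := tensorRightAct P Q (a * b))
    (g := (tensorRightAct P Q a).comp (tensorRightAct P Q b))
    (BalTensor.hom_ext fun m n => congrArg (fun y => BalTensor.tmul B.carrier m y)
      (mul_smul a b n)) x
  smul_zero a := map_zero _
  smul_add a x y := map_add _ x y
  add_smul a b x := DFunLike.congr_fun (f := tensorRightAct P Q (a + b))
    (g := tensorRightAct P Q a + tensorRightAct P Q b)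
    (BalTensor.hom_ext fun m n => by
      change BalTensor.tmul B.carrier m ((a + b) • n) =
        BalTensor.tmul B.carrier m (a • n) + BalTensor.tmul B.carrier m (b • n)
      rw [add_smul, map_add]) x
  zero_smul x := DFunLike.congr_fun (f := tensorRightAct P Q 0) (g := 0)
    (BalTensor.hom_ext fun m n => by
      change BalTensor.tmul B.carrier m ((0 : C.carrierᵐᵒᵖ) • n) = 0
      rw [zero_smul, map_zero]) x

theorem smul_tmul (a : A.carrier) (p : P.carrier) (q : Q.carrier) :
    a • (BalTensor.tmul B.carrier p q : TensorCarrier P Q) = BalTensor.tmul B.carrier (a • p) q :=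
  rfl

theorem op_smul_tmul (c : C.carrierᵐᵒᵖ) (p : P.carrier) (q : Q.carrier) :
    c • (BalTensor.tmul B.carrier p q : TensorCarrier P Q) = BalTensor.tmul B.carrier p (c • q) :=
  rfl

/-- `P ⊗_B Q` in parity `k` is spanned by `p ⊗ q` with `p`, `q` homogeneous, `|p| + |q| = k`. -/
def tensorGr (k : ZMod 2) : AddSubgroup (TensorCarrier P Q) :=
  AddSubgroup.closure {x | ∃ i j : ZMod 2, i + j = k ∧ ∃ p ∈ P.gr i, ∃ q ∈ Q.gr j,
    x = BalTensor.tmul B.carrier p q}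

variable {P Q} in
theorem tmul_mem {i j : ZMod 2} {p : P.carrier} {q : Q.carrier} (hp : p ∈ P.gr i)
    (hq : q ∈ Q.gr j) : (BalTensor.tmul B.carrier p q : TensorCarrier P Q) ∈ tensorGr P Q (i + j) :=
  AddSubgroup.subset_closure ⟨i, j, rfl, p, hp, q, hq, rfl⟩

/-- Projection of `P ⊗_ℤ Q` to `P ⊗_B Q` in parity `k`. -/
def tensorProjAux (k : ZMod 2) : P.carrier →+ Q.carrier →+ TensorCarrier P Q :=
  ∑ i, ((BalTensor.tmul B.carrier).comp (comp P.gr i)).compl₂ (comp Q.gr (k - i))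

theorem tensorProjAux_apply (k : ZMod 2) (p : P.carrier) (q : Q.carrier) :
    tensorProjAux P Q k p q =
      ∑ i, BalTensor.tmul B.carrier (comp P.gr i p) (comp Q.gr (k - i) q) := by
  simp [tensorProjAux]

variable {P Q} in
theorem tensorProjAux_homogeneous (k : ZMod 2) {i j : ZMod 2} {p : P.carrier} {q : Q.carrier}
    (hp : p ∈ P.gr i) (hq : q ∈ Q.gr j) :
    tensorProjAux P Q k p q = if i + j = k then BalTensor.tmul B.carrier p q else 0 := by
  rw [tensorProjAux_apply, Finset.sum_eq_single i]
  · rw [comp_same P.gr hp]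
    split_ifs with h
    · rw [← h, add_sub_cancel_left, comp_same Q.gr hq]
    · rw [comp_ne Q.gr hq (fun h' => h (by rw [h']; ring)), map_zero]
  · intro l _ hl
    rw [comp_ne P.gr hp (Ne.symm hl), map_zero]
    rfl
  · simp

theorem tensorProjAux_balanced (k : ZMod 2) (p : P.carrier) (b : B.carrier) (q : Q.carrier) :
    tensorProjAux P Q k (MulOpposite.op b • p) q = tensorProjAux P Q k p (b • q) := by
  induction p using DirectSum.Decomposition.inductionOn P.gr with
  | zero => simp
  | add x y hx hy => simp only [smul_add, map_add, AddMonoidHom.add_apply, hx, hy]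
  | @homogeneous i p =>
  induction q using DirectSum.Decomposition.inductionOn Q.gr with
  | zero => simp
  | add x y hx hy => simp only [smul_add, map_add, hx, hy]
  | @homogeneous j q =>
  induction b using DirectSum.Decomposition.inductionOn B.gr with
  | zero => simp
  | add x y hx hy =>
    simp only [MulOpposite.op_add, add_smul, map_add, AddMonoidHom.add_apply, hx, hy]
  | @homogeneous l b =>
  rw [tensorProjAux_homogeneous k (P.op_smul_mem p.2 b.2) q.2,
    tensorProjAux_homogeneous k p.2 (Q.smul_mem b.2 q.2), BalTensor.op_smul_tmul, add_assoc]

/-- The projection of `P ⊗_B Q` to its part of parity `k`. -/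
def tensorProj (k : ZMod 2) : TensorCarrier P Q →+ TensorCarrier P Q :=
  BalTensor.lift (tensorProjAux P Q k) (tensorProjAux_balanced P Q k)

theorem tensorProj_of_mem {k : ZMod 2} {x : TensorCarrier P Q} (hx : x ∈ tensorGr P Q k)
    (j : ZMod 2) : tensorProj P Q j x = if k = j then x else 0 := by
  induction hx using AddSubgroup.closure_induction with
  | mem x h =>
    obtain ⟨i, l, rfl, p, hp, q, hq, rfl⟩ := h
    exact tensorProjAux_homogeneous j hp hq
  | zero => simp
  | add x y _ _ hx hy => rw [map_add, hx, hy]; split_ifs <;> simp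
  | neg x _ hx => rw [map_neg, hx]; split_ifs <;> simp

instance tensorDecomposition : DirectSum.Decomposition (tensorGr P Q) :=
  decompositionOfProj (tensorGr P Q) (tensorProj P Q)
    (fun k x => by
      induction x using BalTensor.induction_on with
      | zero => rw [map_zero]; exact zero_mem _
      | add x y hx hy => rw [map_add]; exact add_mem hx hy
      | tmul p q =>
        change tensorProjAux P Q k p q ∈ _
        rw [tensorProjAux_apply]
        refine sum_mem fun i _ => ?_
        have := tmul_mem (P := P) (Q := Q) (comp_mem P.gr i p) (comp_mem Q.gr (k - i) q)
        rwa [add_sub_cancel] at this)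
    (fun k x hx => by rw [tensorProj_of_mem P Q hx, if_pos rfl])
    (fun k j h x hx => by rw [tensorProj_of_mem P Q hx, if_neg h])
    (fun x => by
      induction x using BalTensor.induction_on with
      | zero => simp
      | add x y hx hy => simp only [map_add, Finset.sum_add_distrib, hx, hy]
      | tmul p q =>
      change ∑ k, tensorProjAux P Q k p q = _
      induction p using DirectSum.Decomposition.inductionOn P.gr with
      | zero => simp
      | add x y hx hy =>
        simp only [map_add, AddMonoidHom.add_apply, Finset.sum_add_distrib, hx, hy]
      | @homogeneous i p =>
      induction q using DirectSum.Decomposition.inductionOn Q.gr with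
      | zero => simp
      | add x y hx hy => simp only [map_add, Finset.sum_add_distrib, hx, hy]
      | @homogeneous j q =>
      simp [tensorProjAux_homogeneous _ p.2 q.2])

/-- The tensor product `P ⊗_B Q`, an `A`-`C`-superbimodule. -/
def tensor : SuperBimodule.{u, max v w, s, s'} A C where
  carrier := TensorCarrier P Q
  smulComm := ⟨fun a c x => by
    induction x using BalTensor.induction_on with
    | zero => simp
    | add x y hx hy => simp only [smul_add, hx, hy]
    | tmul p q => rfl⟩
  gr := tensorGr P Q
  smul_mem {i j a x} ha hx := by
    induction hx using AddSubgroup.closure_induction with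
    | mem x h =>
      obtain ⟨k, l, rfl, p, hp, q, hq, rfl⟩ := h
      rw [smul_tmul, ← add_assoc]
      exact tmul_mem (P.smul_mem ha hp) hq
    | zero => rw [smul_zero]; exact zero_mem _
    | add x y _ _ hx hy => rw [smul_add]; exact add_mem hx hy
    | neg x _ hx => rw [smul_neg]; exact neg_mem hx
  op_smul_mem {i j x c} hx hc := by
    induction hx using AddSubgroup.closure_induction with
    | mem x h =>
      obtain ⟨k, l, rfl, p, hp, q, hq, rfl⟩ := h
      rw [op_smul_tmul, add_assoc]
      exact tmul_mem hp (Q.op_smul_mem hq hc)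
    | zero => rw [smul_zero]; exact zero_mem _
    | add x y _ _ hx hy => rw [smul_add]; exact add_mem hx hy
    | neg x _ hx => rw [smul_neg]; exact neg_mem hx
  base_comm {i j r x} hr hx := by
    induction hx using AddSubgroup.closure_induction with
    | mem x h =>
      obtain ⟨k, l, rfl, p, hp, q, hq, rfl⟩ := h
      rw [smul_tmul, op_smul_tmul, P.base_comm hr hp, map_units]
      change ((-1 : ℤˣ) ^ (i * k)) • BalTensor.tmul B.carrier (MulOpposite.op (B.algMap r) • p) q =
        _
      rw [BalTensor.op_smul_tmul, Q.base_comm hr hq, map_units, smul_smul, mul_add, uzpow_add]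
    | zero => simp
    | add x y _ _ hx hy => rw [smul_add, smul_add, smul_add, hx, hy]
    | neg x _ hx => rw [smul_neg, smul_neg, smul_neg, hx]

/-- The element `p ⊗ q` of `P ⊗_B Q`. -/
def tmulB : P.carrier →+ Q.carrier →+ (tensor P Q).carrier := BalTensor.tmul B.carrier

/-- Balanced biadditive maps factor through `P ⊗_B Q`. -/
def liftB {X : Type w'} [AddCommGroup X] (f : P.carrier →+ Q.carrier →+ X)
    (h : ∀ m (b : B.carrier) n, f (MulOpposite.op b • m) n = f m (b • n)) :
    (tensor P Q).carrier →+ X :=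
  BalTensor.lift f h

@[simp]
theorem liftB_tmulB {X : Type w'} [AddCommGroup X] (f : P.carrier →+ Q.carrier →+ X)
    (h : ∀ m (b : B.carrier) n, f (MulOpposite.op b • m) n = f m (b • n))
    (p : P.carrier) (q : Q.carrier) : liftB P Q f h (tmulB P Q p q) = f p q := rfl

theorem tmulB_balanced (p : P.carrier) (b : B.carrier) (q : Q.carrier) :
    tmulB P Q (MulOpposite.op b • p) q = tmulB P Q p (b • q) :=
  BalTensor.op_smul_tmul B.carrier p b q

theorem smul_tmulB (a : A.carrier) (p : P.carrier) (q : Q.carrier) :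
    a • tmulB P Q p q = tmulB P Q (a • p) q := rfl

theorem op_smul_tmulB (c : C.carrier) (p : P.carrier) (q : Q.carrier) :
    MulOpposite.op c • tmulB P Q p q = tmulB P Q p (MulOpposite.op c • q) := rfl

variable {P Q} in
theorem tmulB_mem {i j : ZMod 2} {p : P.carrier} {q : Q.carrier} (hp : p ∈ P.gr i)
    (hq : q ∈ Q.gr j) : tmulB P Q p q ∈ (tensor P Q).gr (i + j) := tmul_mem hp hq

variable {P Q} in
@[elab_as_elim]
theorem tensor_induction {motive : (tensor P Q).carrier → Prop} (x : (tensor P Q).carrier)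
    (zero : motive 0) (tmul : ∀ p q, motive (tmulB P Q p q))
    (add : ∀ x y, motive x → motive y → motive (x + y)) : motive x :=
  BalTensor.induction_on x zero tmul add

variable {P Q} in
/-- An additive map on `P ⊗_B Q` is a morphism of bimodules if it behaves so on the `p ⊗ q`. -/
def homOfTensor {A' : SuperAlgebra.{u, s} R} {C' : SuperAlgebra.{u, s'} R}
    {f : SuperAlgebraHom A A'} {h : SuperAlgebraHom C C'}
    {N : SuperBimodule.{u, max v w, s, s'} A' C'} (φ : (tensor P Q).carrier →+ N.carrier)
    (hgr : ∀ {i j : ZMod 2} {p : P.carrier} {q : Q.carrier}, p ∈ P.gr i → q ∈ Q.gr j →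
      φ (tmulB P Q p q) ∈ N.gr (i + j))
    (hl : ∀ a p q, φ (tmulB P Q (a • p) q) = f.toFun a • φ (tmulB P Q p q))
    (hr : ∀ c p q, φ (tmulB P Q p (MulOpposite.op c • q)) =
      MulOpposite.op (h.toFun c) • φ (tmulB P Q p q)) :
    Hom f h (tensor P Q) N where
  toFun := φ
  map_mem {i x} hx := by
    have h' : (tensor P Q).gr i ≤ (N.gr i).comap φ := by
      refine (AddSubgroup.closure_le _).2 ?_
      rintro _ ⟨k, l, rfl, p, hp, q, hq, rfl⟩
      exact hgr hp hq
    exact h' hx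
  map_smul a x := by
    induction x using tensor_induction with
    | zero => rw [smul_zero, map_zero, smul_zero]
    | add x y hx hy => rw [smul_add, map_add, map_add, smul_add, hx, hy]
    | tmul p q => rw [smul_tmulB, hl]
  map_op_smul a x := by
    induction x using tensor_induction with
    | zero => rw [smul_zero, map_zero, smul_zero]
    | add x y hx hy => rw [smul_add, map_add, map_add, smul_add, hx, hy]
    | tmul p q => rw [op_smul_tmulB, hr]

/-- `(a ⊗ b)(p ⊗ q) = a p ⊗ b q`. -/
def tensorMap {A A' : SuperAlgebra.{u, s} R} {B B' : SuperAlgebra.{u, t} R}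
    {C C' : SuperAlgebra.{u, s'} R}
    {f : SuperAlgebraHom A A'} {g : SuperAlgebraHom B B'} {h : SuperAlgebraHom C C'}
    {P : SuperBimodule.{u, v, s, t} A B} {P' : SuperBimodule.{u, v, s, t} A' B'}
    {Q : SuperBimodule.{u, w, t, s'} B C} {Q' : SuperBimodule.{u, w, t, s'} B' C'}
    (a : Hom f g P P') (b : Hom g h Q Q') : Hom f h (tensor P Q) (tensor P' Q') :=
  homOfTensor (liftB P Q (((tmulB P' Q').comp a.toFun).compl₂ b.toFun) fun m c n => by
      change tmulB P' Q' (a.toFun _) (b.toFun _) = tmulB P' Q' (a.toFun _) (b.toFun _)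
      rw [a.map_op_smul, b.map_smul, tmulB_balanced])
    (fun hp hq => tmulB_mem (a.map_mem hp) (b.map_mem hq))
    (fun c p q => congrArg (fun y => tmulB P' Q' y (b.toFun q)) (a.map_smul c p))
    (fun c p q => congrArg (fun y => tmulB P' Q' (a.toFun p) y) (b.map_op_smul c q))

theorem tensorMap_tmulB {A A' : SuperAlgebra.{u, s} R} {B B' : SuperAlgebra.{u, t} R}
    {C C' : SuperAlgebra.{u, s'} R}
    {f : SuperAlgebraHom A A'} {g : SuperAlgebraHom B B'} {h : SuperAlgebraHom C C'}
    {P : SuperBimodule.{u, v, s, t} A B} {P' : SuperBimodule.{u, v, s, t} A' B'}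
    {Q : SuperBimodule.{u, w, t, s'} B C} {Q' : SuperBimodule.{u, w, t, s'} B' C'}
    (a : Hom f g P P') (b : Hom g h Q Q') (p : P.carrier) (q : Q.carrier) :
    (tensorMap a b).toFun (tmulB P Q p q) = tmulB P' Q' (a.toFun p) (b.toFun q) := rfl

end Tensor

/-! ### Hochschild chains -/

section Chains

variable {S : SuperAlgebra.{u, s} R} {A : SuperAlgebra.{u, v} R}

/-- `M ⊗_R A`, where `M` is a right `A`-module. -/
def tensorAlg (M : SuperBimodule.{u, v, s, v} S A) : SuperBimodule.{u, v, s, v} S A :=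
  tensor M.restrictRight (regular A).restrictLeft

/-- The element `x ⊗ a` of `M ⊗_R A`. -/
def tmulAlg (M : SuperBimodule.{u, v, s, v} S A) :
    M.carrier →+ A.carrier →+ (tensorAlg M).carrier :=
  BalTensor.tmul (base R).carrier (M := M.restrictRight.carrier)
    (N := (regular A).restrictLeft.carrier)

/-- Balanced biadditive maps on `M × A` factor through `M ⊗_R A`. -/
def liftAlg {X : Type w} [AddCommGroup X] (M : SuperBimodule.{u, v, s, v} S A)
    (f : M.carrier →+ A.carrier →+ X)
    (h : ∀ m r a, f (MulOpposite.op (A.algMap r) • m) a = f m (A.algMap r * a)) :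
    (tensorAlg M).carrier →+ X :=
  BalTensor.lift (S := (base R).carrier) (M := M.restrictRight.carrier)
    (N := (regular A).restrictLeft.carrier) f h

@[simp]
theorem liftAlg_tmulAlg {X : Type w} [AddCommGroup X] (M : SuperBimodule.{u, v, s, v} S A)
    (f : M.carrier →+ A.carrier →+ X)
    (h : ∀ m r a, f (MulOpposite.op (A.algMap r) • m) a = f m (A.algMap r * a))
    (m : M.carrier) (a : A.carrier) : liftAlg M f h (tmulAlg M m a) = f m a := rfl

theorem tensorAlg_hom_ext {X : Type w} [AddCommGroup X] (M : SuperBimodule.{u, v, s, v} S A)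
    {f g : (tensorAlg M).carrier →+ X}
    (h : ∀ i j, ∀ m ∈ M.gr i, ∀ a ∈ A.gr j, f (tmulAlg M m a) = g (tmulAlg M m a)) : f = g :=
  BalTensor.hom_ext fun m a => by
    have : f.comp ((tmulAlg M).flip a) = g.comp ((tmulAlg M).flip a) := by
      refine hom_ext_homogeneous M.gr fun i x hx => ?_
      exact DFunLike.congr_fun (hom_ext_homogeneous (f := f.comp (tmulAlg M x))
        (g := g.comp (tmulAlg M x)) A.gr fun j b hb => h i j x hx b hb) a
    exact DFunLike.congr_fun this m

theorem tmulAlg_mem (M : SuperBimodule.{u, v, s, v} S A) {i j : ZMod 2} {m : M.carrier}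
    {a : A.carrier} (hm : m ∈ M.gr i) (ha : a ∈ A.gr j) :
    tmulAlg M m a ∈ (tensorAlg M).gr (i + j) :=
  tmul_mem (P := M.restrictRight) (Q := (regular A).restrictLeft) hm ha

theorem smul_tmulAlg (M : SuperBimodule.{u, v, s, v} S A) (c : S.carrier) (m : M.carrier)
    (a : A.carrier) : c • tmulAlg M m a = tmulAlg M (c • m) a := rfl

theorem op_smul_tmulAlg (M : SuperBimodule.{u, v, s, v} S A) (c : A.carrier) (m : M.carrier)
    (a : A.carrier) : MulOpposite.op c • tmulAlg M m a = tmulAlg M m (a * c) := rfl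

/-- `M ⊗_R A → M' ⊗_R A'`, `x ⊗ a ↦ u x ⊗ g a`. -/
def tensorAlgMap {S' : SuperAlgebra.{u, s} R} {A' : SuperAlgebra.{u, v} R}
    {f : SuperAlgebraHom S S'} {g : SuperAlgebraHom A A'}
    {M : SuperBimodule.{u, v, s, v} S A} {M' : SuperBimodule.{u, v, s, v} S' A'}
    (h : Hom f g M M') : Hom f g (tensorAlg M) (tensorAlg M') :=
  tensorMap (restrictRightMap h) (restrictLeftMap (regularMap g))

theorem tensorAlgMap_tmulAlg {S' : SuperAlgebra.{u, s} R} {A' : SuperAlgebra.{u, v} R}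
    {f : SuperAlgebraHom S S'} {g : SuperAlgebraHom A A'}
    {M : SuperBimodule.{u, v, s, v} S A} {M' : SuperBimodule.{u, v, s, v} S' A'}
    (h : Hom f g M M') (m : M.carrier) (a : A.carrier) :
    (tensorAlgMap h).toFun (tmulAlg M m a) = tmulAlg M' (h.toFun m) (g.toFun a) := rfl

/-- `(m, a) ↦ m a`. -/
def rightActAux (M : SuperBimodule.{u, v, s, v} S A) : M.carrier →+ A.carrier →+ M.carrier where
  toFun m :=
    { toFun := fun a => MulOpposite.op a • m
      map_zero' := by simp
      map_add' := fun x y => by simp [add_smul] }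
  map_zero' := by ext; simp
  map_add' x y := by ext; simp

/-- The map `M ⊗_R A → M`, `x ⊗ a ↦ x a`. -/
def rightAct (M : SuperBimodule.{u, v, s, v} S A) :
    Hom (SuperAlgebraHom.id S) (SuperAlgebraHom.id A) (tensorAlg M) M :=
  homOfTensor (liftAlg M (rightActAux M) fun m r a => by
      change MulOpposite.op a • MulOpposite.op (A.algMap r) • m =
        MulOpposite.op (A.algMap r * a) • m
      rw [smul_smul, MulOpposite.op_mul])
    (fun hp hq => M.op_smul_mem hp hq)
    (fun c p q => (smul_comm (α := M.carrier) c (MulOpposite.op (α := A.carrier) q) p).symm)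
    (fun c p q =>
      mul_smul (β := M.carrier) (MulOpposite.op c) (MulOpposite.op (α := A.carrier) q) p)

theorem rightAct_tmulAlg (M : SuperBimodule.{u, v, s, v} S A) (m : M.carrier) (a : A.carrier) :
    (rightAct M).toFun (tmulAlg M m a) = MulOpposite.op a • m := rfl

/-- The Hochschild `n`-chains `M ⊗_R A ⊗_R ⋯ ⊗_R A` (`n` factors `A`). The outer actions
(left on `M`, right on the last factor) are recorded only to build the faces by recursion. -/
def chains (M : SuperBimodule.{u, v, s, v} S A) : ℕ → SuperBimodule.{u, v, s, v} S A
  | 0 => M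
  | n + 1 => tensorAlg (chains M n)

/-- The faces `δ_i`, `0 ≤ i ≤ n`, on `(n+1)`-chains that multiply two neighbouring factors:
`δ_n (x ⊗ a) = x a` (multiplication into the last factor of `x`) and
`δ_i (x ⊗ a) = δ_i x ⊗ a` for `i < n`. -/
def innerFace (M : SuperBimodule.{u, v, s, v} S A) : (n : ℕ) → Fin (n + 1) →
    Hom (SuperAlgebraHom.id S) (SuperAlgebraHom.id A) (chains M (n + 1)) (chains M n)
  | 0, _ => rightAct M
  | n + 1, i =>
    Fin.lastCases (motive := fun _ =>
        Hom (SuperAlgebraHom.id S) (SuperAlgebraHom.id A) (chains M (n + 2)) (chains M (n + 1)))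
      (rightAct (chains M (n + 1))) (fun j => tensorAlgMap (innerFace M n j)) i

end Chains

section Hochschild

variable {A : SuperAlgebra.{u, v} R}

/-- `(x, a) ↦ (-1)^{|a||x|} a x`, extended biadditively from homogeneous elements. -/
def cyclicAux (M : SuperBimodule.{u, v, v, v} A A) : M.carrier →+ A.carrier →+ M.carrier where
  toFun m :=
    { toFun := fun a => ∑ i, ∑ j, (-1 : ℤˣ) ^ (j * i) • (comp A.gr j a • comp M.gr i m)
      map_zero' := by simp
      map_add' := fun x y => by simp [add_smul, Finset.sum_add_distrib] }
  map_zero' := by ext; simp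
  map_add' x y := by ext; simp [Finset.sum_add_distrib]

theorem cyclicAux_homogeneous (M : SuperBimodule.{u, v, v, v} A A) {i j : ZMod 2}
    {m : M.carrier} {a : A.carrier} (hm : m ∈ M.gr i) (ha : a ∈ A.gr j) :
    cyclicAux M m a = (-1 : ℤˣ) ^ (j * i) • (a • m) := by
  change ∑ i, ∑ j, (-1 : ℤˣ) ^ (j * i) • (comp A.gr j a • comp M.gr i m) = _
  rw [Finset.sum_eq_single i, Finset.sum_eq_single j, comp_same A.gr ha, comp_same M.gr hm]
  · intro k _ hk
    rw [comp_ne A.gr ha (Ne.symm hk), zero_smul, smul_zero]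
  · simp
  · intro k _ hk
    refine Finset.sum_eq_zero fun l _ => ?_
    rw [comp_ne M.gr hm (Ne.symm hk), smul_zero, smul_zero]
  · simp

theorem cyclicAux_balanced (M : SuperBimodule.{u, v, v, v} A A) (m : M.carrier) (r : R.carrier)
    (a : A.carrier) :
    cyclicAux M (MulOpposite.op (A.algMap r) • m) a = cyclicAux M m (A.algMap r * a) := by
  induction m using DirectSum.Decomposition.inductionOn M.gr with
  | zero => simp
  | add x y hx hy => simp only [smul_add, map_add, AddMonoidHom.add_apply, hx, hy]
  | @homogeneous i m =>
  induction a using DirectSum.Decomposition.inductionOn A.gr with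
  | zero => simp
  | add x y hx hy => simp only [mul_add, map_add, hx, hy]
  | @homogeneous k a =>
  induction r using DirectSum.Decomposition.inductionOn R.gr with
  | zero => simp
  | add x y hx hy =>
    simp only [MulOpposite.op_add, add_smul, add_mul, map_add, AddMonoidHom.add_apply, hx, hy]
  | @homogeneous j r =>
  rw [cyclicAux_homogeneous M (M.op_smul_mem m.2 (A.algMap_mem r.2)) a.2,
    cyclicAux_homogeneous M m.2 (SetLike.mul_mem_graded (A.algMap_mem r.2) a.2), mul_smul,
    M.base_comm r.2 (M.smul_mem a.2 m.2), smul_smul, smul_comm (a : A.carrier), ← uzpow_add]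
  have key : ∀ i j k : ZMod 2, k * (i + j) = (j + k) * i + j * (k + i) := by decide
  rw [key]

/-- The last face `M ⊗_R A → M`, `x ⊗ a ↦ (-1)^{|a||x|} a x`. -/
def cyclicFace (M : SuperBimodule.{u, v, v, v} A A) : (tensorAlg M).carrier →+ M.carrier :=
  liftAlg M (cyclicAux M) (cyclicAux_balanced M)

theorem cyclicFace_tmulAlg (M : SuperBimodule.{u, v, v, v} A A) {i j : ZMod 2}
    {m : M.carrier} {a : A.carrier} (hm : m ∈ M.gr i) (ha : a ∈ A.gr j) :
    cyclicFace M (tmulAlg M m a) = (-1 : ℤˣ) ^ (j * i) • (a • m) :=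
  cyclicAux_homogeneous M hm ha

/-- The faces `δ_0, …, δ_{n+1}` from `(n+1)`-chains to `n`-chains; the last one is
`m ⊗ a_1 ⊗ ⋯ ⊗ a_{n+1} ↦ (-1)^{|a_{n+1}|(|m| + |a_1| + ⋯ + |a_n|)} a_{n+1} m ⊗ a_1 ⊗ ⋯ ⊗ a_n`. -/
def face (M : SuperBimodule.{u, v, v, v} A A) (n : ℕ) (i : Fin (n + 2)) :
    (chains M (n + 1)).carrier →+ (chains M n).carrier :=
  Fin.lastCases (motive := fun _ => (chains M (n + 1)).carrier →+ (chains M n).carrier)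
    (cyclicFace (chains M n)) (fun j => (innerFace M n j).toFun) i

/-- The Hochschild differential `∑ (-1)^i δ_i`. -/
def diff (M : SuperBimodule.{u, v, v, v} A A) (n : ℕ) :
    (chains M (n + 1)).carrier →+ (chains M n).carrier :=
  ∑ i : Fin (n + 2), (-1 : ℤ) ^ (i : ℕ) • face M n i

/-! ### The Hochschild complex -/

theorem face_last (M : SuperBimodule.{u, v, v, v} A A) (n : ℕ) :
    face M n (Fin.last (n + 1)) = cyclicFace (chains M n) := Fin.lastCases_last

theorem face_castSucc (M : SuperBimodule.{u, v, v, v} A A) (n : ℕ) (i : Fin (n + 1)) :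
    face M n i.castSucc = (innerFace M n i).toFun := Fin.lastCases_castSucc i

theorem innerFace_last (M : SuperBimodule.{u, v, v, v} A A) (n : ℕ) :
    innerFace M (n + 1) (Fin.last (n + 1)) = rightAct (chains M (n + 1)) := Fin.lastCases_last

theorem innerFace_castSucc (M : SuperBimodule.{u, v, v, v} A A) (n : ℕ) (i : Fin (n + 1)) :
    innerFace M (n + 1) i.castSucc = tensorAlgMap (innerFace M n i) := Fin.lastCases_castSucc i

/-- The alternating sum of the inner faces. -/
def barDiff (M : SuperBimodule.{u, v, v, v} A A) (n : ℕ) :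
    (chains M (n + 1)).carrier →+ (chains M n).carrier :=
  ∑ i : Fin (n + 1), (-1 : ℤ) ^ (i : ℕ) • (innerFace M n i).toFun

theorem barDiff_apply (M : SuperBimodule.{u, v, v, v} A A) (n : ℕ)
    (x : (chains M (n + 1)).carrier) :
    barDiff M n x = ∑ i : Fin (n + 1), (-1 : ℤ) ^ (i : ℕ) • (innerFace M n i).toFun x := by
  simp [barDiff]

theorem barDiff_mem (M : SuperBimodule.{u, v, v, v} A A) (n : ℕ) {k : ZMod 2}
    {x : (chains M (n + 1)).carrier} (hx : x ∈ (chains M (n + 1)).gr k) :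
    barDiff M n x ∈ (chains M n).gr k := by
  rw [barDiff_apply]
  exact sum_mem fun i _ => zsmul_mem ((innerFace M n i).map_mem hx) _

theorem barDiff_smul (M : SuperBimodule.{u, v, v, v} A A) (n : ℕ) (a : A.carrier)
    (x : (chains M (n + 1)).carrier) : barDiff M n (a • x) = a • barDiff M n x := by
  rw [barDiff_apply, barDiff_apply, Finset.smul_sum]
  refine Finset.sum_congr rfl fun i _ => ?_
  rw [(innerFace M n i).map_smul, smul_comm]
  rfl

theorem barDiff_op_smul (M : SuperBimodule.{u, v, v, v} A A) (n : ℕ) (a : A.carrier)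
    (x : (chains M (n + 1)).carrier) :
    barDiff M n (MulOpposite.op a • x) = MulOpposite.op a • barDiff M n x := by
  rw [barDiff_apply, barDiff_apply, Finset.smul_sum]
  refine Finset.sum_congr rfl fun i _ => ?_
  rw [(innerFace M n i).map_op_smul, smul_comm]
  rfl

/-- The element `x ⊗ a` of `C_{n+1}`, for `x` in `C_n`. -/
def tmulC (M : SuperBimodule.{u, v, v, v} A A) (n : ℕ) :
    (chains M n).carrier →+ A.carrier →+ (chains M (n + 1)).carrier :=
  tmulAlg (chains M n)

/-- The last face `C_{n+1} → C_n`. -/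
def cyclicC (M : SuperBimodule.{u, v, v, v} A A) (n : ℕ) :
    (chains M (n + 1)).carrier →+ (chains M n).carrier :=
  cyclicFace (chains M n)

theorem chains_hom_ext {X : Type w} [AddCommGroup X] (M : SuperBimodule.{u, v, v, v} A A) (n : ℕ)
    {f g : (chains M (n + 1)).carrier →+ X}
    (h : ∀ i j, ∀ m ∈ (chains M n).gr i, ∀ a ∈ A.gr j, f (tmulC M n m a) = g (tmulC M n m a)) :
    f = g :=
  tensorAlg_hom_ext (chains M n) h

theorem tmulC_mem (M : SuperBimodule.{u, v, v, v} A A) (n : ℕ) {i j : ZMod 2}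
    {x : (chains M n).carrier} {a : A.carrier} (hx : x ∈ (chains M n).gr i) (ha : a ∈ A.gr j) :
    tmulC M n x a ∈ (chains M (n + 1)).gr (i + j) :=
  tmulAlg_mem (chains M n) hx ha

theorem smul_tmulC (M : SuperBimodule.{u, v, v, v} A A) (n : ℕ) (c : A.carrier)
    (x : (chains M n).carrier) (a : A.carrier) :
    c • tmulC M n x a = tmulC M n (c • x) a := rfl

theorem op_smul_tmulC (M : SuperBimodule.{u, v, v, v} A A) (n : ℕ) (c : A.carrier)
    (x : (chains M n).carrier) (a : A.carrier) :
    MulOpposite.op c • tmulC M n x a = tmulC M n x (a * c) := rfl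

theorem cyclicC_tmulC (M : SuperBimodule.{u, v, v, v} A A) (n : ℕ) {i j : ZMod 2}
    {x : (chains M n).carrier} {a : A.carrier} (hx : x ∈ (chains M n).gr i) (ha : a ∈ A.gr j) :
    cyclicC M n (tmulC M n x a) = (-1 : ℤˣ) ^ (j * i) • (a • x) :=
  cyclicFace_tmulAlg (chains M n) hx ha

theorem barDiff_zero (M : SuperBimodule.{u, v, v, v} A A) (x : (chains M 0).carrier)
    (a : A.carrier) : barDiff M 0 (tmulC M 0 x a) = MulOpposite.op a • x := by
  rw [barDiff_apply]
  simp only [Nat.reduceAdd, Finset.univ_unique, Finset.sum_singleton]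
  change (-1 : ℤ) ^ 0 • (MulOpposite.op a • x) = _
  rw [pow_zero, one_smul]

theorem barDiff_succ (M : SuperBimodule.{u, v, v, v} A A) (n : ℕ)
    (x : (chains M (n + 1)).carrier) (a : A.carrier) :
    barDiff M (n + 1) (tmulC M (n + 1) x a) =
      tmulC M n (barDiff M n x) a + (-1 : ℤ) ^ (n + 1) • (MulOpposite.op a • x) := by
  rw [barDiff_apply, Fin.sum_univ_castSucc, innerFace_last]
  congr 1
  rw [barDiff_apply, map_sum, AddMonoidHom.finsetSum_apply]
  refine Finset.sum_congr rfl fun i _ => ?_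
  rw [innerFace_castSucc, map_zsmul]
  rfl

theorem diff_eq (M : SuperBimodule.{u, v, v, v} A A) (n : ℕ) (x : (chains M (n + 1)).carrier) :
    diff M n x = barDiff M n x + (-1 : ℤ) ^ (n + 1) • cyclicC M n x := by
  rw [diff, Fin.sum_univ_castSucc, face_last, barDiff]
  simp only [face_castSucc]
  rfl

theorem barDiff_barDiff (M : SuperBimodule.{u, v, v, v} A A) (n : ℕ) :
    (barDiff M n).comp (barDiff M (n + 1)) = 0 := by
  induction n with
  | zero =>
    refine chains_hom_ext M 1 fun i j x hx a ha => ?_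
    change barDiff M 0 (barDiff M 1 (tmulC M 1 x a)) = 0
    have h : barDiff M 1 (tmulC M 1 x a) =
      tmulC M 0 (barDiff M 0 x) a + (-1 : ℤ) ^ 1 • (MulOpposite.op a • x) := barDiff_succ M 0 x a
    rw [h, map_add, map_zsmul, barDiff_op_smul, barDiff_zero, pow_one, neg_one_smul,
      add_neg_cancel]
  | succ n ih =>
    refine chains_hom_ext M (n + 2) fun i j x hx a ha => ?_
    change barDiff M (n + 1) (barDiff M (n + 2) (tmulC M (n + 2) x a)) = 0
    have h0 : barDiff M n (barDiff M (n + 1) x) = 0 := DFunLike.congr_fun ih x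
    rw [barDiff_succ, map_add, map_zsmul, barDiff_op_smul, barDiff_succ, h0, map_zero,
      AddMonoidHom.zero_apply, zero_add, ← add_smul, pow_succ (-1 : ℤ) (n + 1), mul_neg_one,
      add_neg_cancel, zero_smul]

theorem cyclicC_cyclicC (M : SuperBimodule.{u, v, v, v} A A) (n : ℕ) {j : ZMod 2}
    {a : A.carrier} (ha : a ∈ A.gr j) :
    ((cyclicC M n).comp (cyclicC M (n + 1))).comp ((tmulC M (n + 1)).flip a) =
      (cyclicC M n).comp
        (DistribSMul.toAddMonoidHom (chains M (n + 1)).carrier (MulOpposite.op a)) := by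
  refine chains_hom_ext M n fun i k x hx c hc => ?_
  change cyclicC M n (cyclicC M (n + 1) (tmulC M (n + 1) (tmulC M n x c) a)) =
    cyclicC M n (MulOpposite.op a • tmulC M n x c)
  rw [cyclicC_tmulC M (n + 1) (tmulC_mem M n hx hc) ha, map_units, smul_tmulC,
    cyclicC_tmulC M n ((chains M n).smul_mem ha hx) hc, op_smul_tmulC,
    cyclicC_tmulC M n hx (SetLike.mul_mem_graded hc ha), smul_smul, ← uzpow_add, mul_smul]
  have key : ∀ i j k : ZMod 2, j * (i + k) + k * (j + i) = (k + j) * i := by decide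
  rw [key]

theorem diff_diff (M : SuperBimodule.{u, v, v, v} A A) (n : ℕ) :
    (diff M n).comp (diff M (n + 1)) = 0 := by
  refine chains_hom_ext M (n + 1) fun i j x hx a ha => ?_
  change diff M n (diff M (n + 1) (tmulC M (n + 1) x a)) = 0
  have hbb : barDiff M n (barDiff M (n + 1) (tmulC M (n + 1) x a)) = 0 :=
    DFunLike.congr_fun (barDiff_barDiff M n) _
  have h1 : barDiff M n (cyclicC M (n + 1) (tmulC M (n + 1) x a)) =
      cyclicC M n (tmulC M n (barDiff M n x) a) := by
    rw [cyclicC_tmulC M (n + 1) hx ha, map_units, barDiff_smul,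
      cyclicC_tmulC M n (barDiff_mem M n hx) ha]
  have h2 : cyclicC M n (cyclicC M (n + 1) (tmulC M (n + 1) x a)) =
      cyclicC M n (MulOpposite.op a • x) := DFunLike.congr_fun (cyclicC_cyclicC M n ha) x
  rw [diff_eq, diff_eq, map_add, map_add, map_zsmul, map_zsmul, hbb, h1, h2, barDiff_succ,
    map_add, map_zsmul, pow_succ (-1 : ℤ) (n + 1)]
  generalize (-1 : ℤ) ^ (n + 1) = e
  module

/-- The differential commutes with the action of the ground superring. -/
theorem diff_base_smul (M : SuperBimodule.{u, v, v, v} A A) (n : ℕ) (r : R.carrier)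
    (x : (chains M (n + 1)).carrier) :
    diff M n (A.algMap r • x) = A.algMap r • diff M n x := by
  have h : cyclicC M n (A.algMap r • x) = A.algMap r • cyclicC M n x := by
    induction r using DirectSum.Decomposition.inductionOn R.gr with
    | zero => simp
    | add r r' hr hr' => simp only [map_add, add_smul, hr, hr']
    | @homogeneous k r =>
    have : (cyclicC M n).comp
          (DistribSMul.toAddMonoidHom (chains M (n + 1)).carrier (A.algMap r)) =
        (DistribSMul.toAddMonoidHom (chains M n).carrier (A.algMap r)).comp (cyclicC M n) := by
      refine chains_hom_ext M n fun i j x hx a ha => ?_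
      change cyclicC M n (A.algMap r • tmulC M n x a) =
        A.algMap r • cyclicC M n (tmulC M n x a)
      rw [smul_tmulC, cyclicC_tmulC M n ((chains M n).smul_mem (A.algMap_mem r.2) hx) ha,
        cyclicC_tmulC M n hx ha, smul_comm (A.algMap r), ← mul_smul (A.algMap (r : R.carrier)),
        A.comm r.2 ha, smul_assoc, ← mul_smul a]
      have key : ∀ i j k : ZMod 2, j * (k + i) = j * i + k * j := by decide
      rw [key, uzpow_add, mul_smul]
    exact DFunLike.congr_fun this x
  rw [diff_eq, diff_eq, barDiff_smul, h, smul_add, smul_comm (A.algMap r)]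

/-- A superbimodule as a left module over the ground superring. -/
def toModule {S : SuperAlgebra.{u, s} R} {B : SuperAlgebra.{u, t} R} (M : SuperBimodule.{u, v, s, t} S B) :
    ModuleCat.{v} R.carrier :=
  letI : Module R.carrier M.carrier := Module.compHom M.carrier S.algMap
  ModuleCat.of R.carrier M.carrier

/-- An additive map commuting with the ground superring as a morphism of modules. -/
def toModuleHom {S : SuperAlgebra.{u, s} R} {S' : SuperAlgebra.{u, s'} R}
    {B : SuperAlgebra.{u, t} R} {B' : SuperAlgebra.{u, w} R}
    {M : SuperBimodule.{u, v, s, t} S B} {M' : SuperBimodule.{u, v, s', w} S' B'}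
    (φ : M.carrier →+ M'.carrier) (h : ∀ r x, φ (S.algMap r • x) = S'.algMap r • φ x) :
    M.toModule ⟶ M'.toModule :=
  letI : Module R.carrier M.carrier := Module.compHom M.carrier S.algMap
  letI : Module R.carrier M'.carrier := Module.compHom M'.carrier S'.algMap
  ModuleCat.ofHom { φ with map_smul' := h }

/-- The Hochschild complex `C_•(A, M)`. -/
def hochschildComplex (M : SuperBimodule.{u, v, v, v} A A) :
    ChainComplex (ModuleCat.{v} R.carrier) ℕ :=
  ChainComplex.of (fun n => (chains M n).toModule)
    (fun n => toModuleHom (diff M n) (diff_base_smul M n))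
    (fun n => by
      ext x
      exact DFunLike.congr_fun (diff_diff M n) x)

theorem hochschildComplex_d (M : SuperBimodule.{u, v, v, v} A A) (n : ℕ) :
    (hochschildComplex M).d (n + 1) n = toModuleHom (diff M n) (diff_base_smul M n) :=
  ChainComplex.of_d (fun n => (chains M n).toModule)
    (fun n => toModuleHom (diff M n) (diff_base_smul M n)) n

/-- The Hochschild homology `H_n(A, M)`. -/
noncomputable def HH (M : SuperBimodule.{u, v, v, v} A A) (n : ℕ) : ModuleCat.{v} R.carrier :=
  (hochschildComplex M).homology n

/-- The part of parity `k` of `H_n(A, M)`: the classes of the cycles of parity `k`. -/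
noncomputable def HHgr (M : SuperBimodule.{u, v, v, v} A A) (n : ℕ) (k : ZMod 2) : AddSubgroup (HH M n) :=
  ((((chains M n).gr k : AddSubgroup ((hochschildComplex M).X n)).comap
    ((hochschildComplex M).iCycles n).hom.toAddMonoidHom)).map
    ((hochschildComplex M).homologyπ n).hom.toAddMonoidHom

/-! ### Functoriality -/

variable {A' : SuperAlgebra.{u, v} R} {f : SuperAlgebraHom A A'}
  {M : SuperBimodule.{u, v, v, v} A A} {M' : SuperBimodule.{u, v, v, v} A' A'}

/-- `m ⊗ a_1 ⊗ ⋯ ⊗ a_n ↦ h m ⊗ f a_1 ⊗ ⋯ ⊗ f a_n`. -/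
def chainsMap (h : Hom f f M M') : (n : ℕ) → Hom f f (chains M n) (chains M' n)
  | 0 => h
  | n + 1 => tensorAlgMap (chainsMap h n)

theorem chainsMap_tmulC (h : Hom f f M M') (n : ℕ) (x : (chains M n).carrier) (a : A.carrier) :
    (chainsMap h (n + 1)).toFun (tmulC M n x a) =
      tmulC M' n ((chainsMap h n).toFun x) (f.toFun a) := rfl

theorem chainsMap_barDiff (h : Hom f f M M') (n : ℕ) :
    (barDiff M' n).comp (chainsMap h (n + 1)).toFun =
      (chainsMap h n).toFun.comp (barDiff M n) := by
  induction n with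
  | zero =>
    refine chains_hom_ext M 0 fun i j x hx a ha => ?_
    change barDiff M' 0 ((chainsMap h 1).toFun (tmulC M 0 x a)) =
      (chainsMap h 0).toFun (barDiff M 0 (tmulC M 0 x a))
    have h1 : (chainsMap h 1).toFun (tmulC M 0 x a) =
      tmulC M' 0 ((chainsMap h 0).toFun x) (f.toFun a) := rfl
    rw [h1, barDiff_zero, barDiff_zero, (chainsMap h 0).map_op_smul]
  | succ n ih =>
    refine chains_hom_ext M (n + 1) fun i j x hx a ha => ?_
    change barDiff M' (n + 1) ((chainsMap h (n + 2)).toFun (tmulC M (n + 1) x a)) =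
      (chainsMap h (n + 1)).toFun (barDiff M (n + 1) (tmulC M (n + 1) x a))
    have ih' : barDiff M' n ((chainsMap h (n + 1)).toFun x) =
      (chainsMap h n).toFun (barDiff M n x) := DFunLike.congr_fun ih x
    rw [chainsMap_tmulC, barDiff_succ, barDiff_succ, map_add, map_zsmul, chainsMap_tmulC, ih',
      (chainsMap h (n + 1)).map_op_smul]

theorem chainsMap_cyclicC (h : Hom f f M M') (n : ℕ) :
    (cyclicC M' n).comp (chainsMap h (n + 1)).toFun =
      (chainsMap h n).toFun.comp (cyclicC M n) := by
  refine chains_hom_ext M n fun i j x hx a ha => ?_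
  change cyclicC M' n ((chainsMap h (n + 1)).toFun (tmulC M n x a)) =
    (chainsMap h n).toFun (cyclicC M n (tmulC M n x a))
  rw [chainsMap_tmulC, cyclicC_tmulC M' n ((chainsMap h n).map_mem hx) (f.map_mem ha),
    cyclicC_tmulC M n hx ha, map_units, (chainsMap h n).map_smul]

theorem chainsMap_diff (h : Hom f f M M') (n : ℕ) (x : (chains M (n + 1)).carrier) :
    diff M' n ((chainsMap h (n + 1)).toFun x) = (chainsMap h n).toFun (diff M n x) := by
  have h1 : barDiff M' n ((chainsMap h (n + 1)).toFun x) =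
    (chainsMap h n).toFun (barDiff M n x) := DFunLike.congr_fun (chainsMap_barDiff h n) x
  have h2 : cyclicC M' n ((chainsMap h (n + 1)).toFun x) =
    (chainsMap h n).toFun (cyclicC M n x) := DFunLike.congr_fun (chainsMap_cyclicC h n) x
  rw [diff_eq, diff_eq, h1, h2, map_add, map_zsmul]

/-- The morphism of Hochschild complexes induced by `f : A → A'` and `h : M → M'`. -/
def hochschildMap (h : Hom f f M M') : hochschildComplex M ⟶ hochschildComplex M' :=
  ChainComplex.ofHom
    (fun n => toModuleHom (chainsMap h n).toFun fun r x => by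
      rw [(chainsMap h n).map_smul, f.map_algMap])
    (fun n => by
      rw [hochschildComplex_d, hochschildComplex_d]
      ext x
      exact chainsMap_diff h n x)

/-- The induced map `H_n(A, M) → H_n(A', M')`. -/
noncomputable def HHmap (h : Hom f f M M') (n : ℕ) : HH M n ⟶ HH M' n :=
  HomologicalComplex.homologyMap (hochschildMap h) n

end Hochschild

end SuperBimodule

end SuperHochschild

namespace SuperHochschild

namespace SuperBimodule

variable {R : CommSuperring.{u}}

/-! ### Functoriality of chains -/

section Functoriality

variable {A A' A'' A''' : SuperAlgebra.{u, v} R}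
  {M : SuperBimodule.{u, v, v, v} A A} {M' : SuperBimodule.{u, v, v, v} A' A'}
  {M'' : SuperBimodule.{u, v, v, v} A'' A''} {M''' : SuperBimodule.{u, v, v, v} A''' A'''}

/-! The proof is a dimension shift in `Q`, with no double complex. In degree zero, `H_0(A, M)` is
`M` modulo supercommutators, and the signed swap `p ⊗ q ↦ (-1)^{|p||q|} q ⊗ p` gives the isomorphism
(`swapZeroIso`): balancing over one algebra on one side corresponds to the trace relation on the
other.

For the step from `n` to `n + 1`, let `K` be the kernel of the right action `Q ⊗_R A → Q`. The
sequence `K → Q ⊗_R A → Q` is split by `q ↦ q ⊗ 1`, which is linear for the left action of `B` and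
the right action of `R`. Hence `P ⊗_B -` keeps it split over `R` (`splittingLeft`). For `- ⊗_A P`
the splitting is not `A`-linear, but left projectivity of `P` gives an even section `p ↦ ∑ a_i ⊗
p_i` of `A ⊗_R P → P`, and `x ⊗ p ↦ ∑ φ (x a_i) ⊗ p_i` turns an `R`-linear `φ` into a map of tensor
products (`twist`, `splittingRight`). Splitting over `R` is what the chains `M ⊗ A ⊗ ⋯ ⊗ A` need in
order to stay exact, so both sides have long exact sequences.

The middle terms have no homology in positive degrees. On the left, `P ⊗_B (Q ⊗_R A)` is a retract
of the induced bimodule `(P ⊗_B Q) ⊗_R A`, whose complex is contracted in positive degrees by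
inserting a unit. On the right, `(Q ⊗_R A) ⊗_A P` is a retract of `Q ⊗_R P`, and right projectivity
of `P` makes the latter a retract of `(Q ⊗_R P) ⊗_R B`. So both groups in degree `n + 1` embed by
connecting maps into degree `n`, as the kernels of the maps induced by `K → Q ⊗_R A`. The
isomorphisms of degree `n` for `(P, K)` and `(P, Q ⊗_R A)`, being natural, match these kernels
(`TraceIso.exists_succ`). Nothing is assumed of `Q`, so the induction may replace it by `K`.

The new isomorphism is determined by a commutative square with injective connecting maps.
Functoriality and parity therefore follow from those of the connecting maps, whatever sections were
chosen. -/

theorem chainsMap_square {f₁ : SuperAlgebraHom A A'} {f₂ : SuperAlgebraHom A' A'''}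
    {g₁ : SuperAlgebraHom A A''} {g₂ : SuperAlgebraHom A'' A'''}
    (h₁ : Hom f₁ f₁ M M') (h₂ : Hom f₂ f₂ M' M''') (k₁ : Hom g₁ g₁ M M'') (k₂ : Hom g₂ g₂ M'' M''')
    (hfg : ∀ a, f₂.toFun (f₁.toFun a) = g₂.toFun (g₁.toFun a))
    (hhk : ∀ m, h₂.toFun (h₁.toFun m) = k₂.toFun (k₁.toFun m)) (n : ℕ)
    (x : (chains M n).carrier) :
    (chainsMap h₂ n).toFun ((chainsMap h₁ n).toFun x) =
      (chainsMap k₂ n).toFun ((chainsMap k₁ n).toFun x) := by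
  induction n with
  | zero => exact hhk x
  | succ n ih =>
    have : (chainsMap h₂ (n + 1)).toFun.comp (chainsMap h₁ (n + 1)).toFun =
        (chainsMap k₂ (n + 1)).toFun.comp (chainsMap k₁ (n + 1)).toFun := by
      refine chains_hom_ext M n fun i j x _ a _ => ?_
      change (chainsMap h₂ (n + 1)).toFun ((chainsMap h₁ (n + 1)).toFun (tmulC M n x a)) =
        (chainsMap k₂ (n + 1)).toFun ((chainsMap k₁ (n + 1)).toFun (tmulC M n x a))
      rw [chainsMap_tmulC, chainsMap_tmulC, chainsMap_tmulC, chainsMap_tmulC, ih, hfg]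
    exact DFunLike.congr_fun this x

theorem chainsMap_eq_self {f : SuperAlgebraHom A A} (h : Hom f f M M)
    (hf : ∀ a, f.toFun a = a) (hh : ∀ m, h.toFun m = m) (n : ℕ) (x : (chains M n).carrier) :
    (chainsMap h n).toFun x = x := by
  induction n with
  | zero => exact hh x
  | succ n ih =>
    have : (chainsMap h (n + 1)).toFun = AddMonoidHom.id _ := by
      refine chains_hom_ext M n fun i j x _ a _ => ?_
      rw [chainsMap_tmulC, ih, hf]
      rfl
    exact DFunLike.congr_fun this x

end Functoriality

/-! ### Maps that are linear over the ground superring only -/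

section BaseHom

variable {S : SuperAlgebra.{u, s} R} {S' : SuperAlgebra.{u, s'} R} {S'' : SuperAlgebra.{u, w} R}
  {A A' : SuperAlgebra.{u, v} R}

/-- An additive map that is linear for the right actions of the ground superring. -/
structure BaseHom (M : SuperBimodule.{u, v, s, v} S A)
    (M' : SuperBimodule.{u, v, s', v} S' A') where
  toFun : M.carrier →+ M'.carrier
  map_base : ∀ r m, toFun (MulOpposite.op (A.algMap r) • m) =
    MulOpposite.op (A'.algMap r) • toFun m

/-- The Koszul sign is its own inverse, so the compatibility of the two actions can be read
backwards. -/
theorem op_algMap_smul {M : SuperBimodule.{u, v, s, v} S A} {i j : ZMod 2} {r : R.carrier}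
    {m : M.carrier} (hr : r ∈ R.gr i) (hm : m ∈ M.gr j) :
    MulOpposite.op (A.algMap r) • m = (-1 : ℤˣ) ^ (i * j) • (S.algMap r • m) := by
  rw [M.base_comm hr hm, smul_smul, ← uzpow_add, CharTwo.add_self_eq_zero, uzpow_zero, one_smul]

/-- An even additive map that is linear for the left actions of the ground superring is also
linear for the right actions. -/
def BaseHom.ofLeft {M : SuperBimodule.{u, v, s, v} S A} {M' : SuperBimodule.{u, v, s', v} S' A'}
    (φ : M.carrier →+ M'.carrier) (hgr : ∀ {i : ZMod 2} {m : M.carrier}, m ∈ M.gr i → φ m ∈ M'.gr i)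
    (h : ∀ r m, φ (S.algMap r • m) = S'.algMap r • φ m) : BaseHom M M' where
  toFun := φ
  map_base r m := by
    induction m using DirectSum.Decomposition.inductionOn M.gr with
    | zero => simp
    | add x y hx hy => simp only [smul_add, map_add, hx, hy]
    | @homogeneous i m =>
    induction r using DirectSum.Decomposition.inductionOn R.gr with
    | zero => simp
    | add x y hx hy => simp only [MulOpposite.op_add, map_add, add_smul, hx, hy]
    | @homogeneous j r =>
    -- Because `φ` is even, the signs on the two sides are the same.
    rw [op_algMap_smul r.2 m.2, op_algMap_smul r.2 (hgr m.2), map_units, h]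

variable {M : SuperBimodule.{u, v, s, v} S A} {M' : SuperBimodule.{u, v, s', v} S' A}

theorem tmulAlg_balanced (N : SuperBimodule.{u, v, s, v} S A) (m : N.carrier) (r : R.carrier)
    (a : A.carrier) :
    tmulAlg N (MulOpposite.op (A.algMap r) • m) a = tmulAlg N m (A.algMap r * a) :=
  BalTensor.op_smul_tmul (S := (base R).carrier) (M := N.restrictRight.carrier)
    (N := (regular A).restrictLeft.carrier) m r a

/-- `M ⊗_R A → M' ⊗_R A`, `x ⊗ a ↦ φ x ⊗ a`. -/
def tensorAlgBaseMap (φ : BaseHom M M') : BaseHom (tensorAlg M) (tensorAlg M') :=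
  let ψ : (tensorAlg M).carrier →+ (tensorAlg M').carrier :=
    liftAlg M ((tmulAlg M').comp φ.toFun) fun m r a => by
      change tmulAlg M' (φ.toFun _) a = tmulAlg M' (φ.toFun m) _
      rw [φ.map_base, tmulAlg_balanced]
  { toFun := ψ
    map_base := fun r x => DFunLike.congr_fun
      (f := ψ.comp (DistribSMul.toAddMonoidHom _ (MulOpposite.op (A.algMap r))))
      (g := (DistribSMul.toAddMonoidHom _ (MulOpposite.op (A.algMap r))).comp ψ)
      (tensorAlg_hom_ext M fun _ _ _ _ _ _ => rfl) x }

/-- The map on chains `m ⊗ a_1 ⊗ ⋯ ⊗ a_n ↦ φ m ⊗ a_1 ⊗ ⋯ ⊗ a_n`, for `φ` linear over the ground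
superring. -/
def chainsBaseMap (φ : BaseHom M M') : (n : ℕ) → BaseHom (chains M n) (chains M' n)
  | 0 => φ
  | n + 1 => tensorAlgBaseMap (chainsBaseMap φ n)

/-- The composite is a separate `χ` constrained only by its values, so identities such as `r ∘ i =
id` pass to chains without equating bundled maps. -/
theorem chainsBaseMap_comp {M'' : SuperBimodule.{u, v, w, v} S'' A} (φ : BaseHom M M')
    (ψ : BaseHom M' M'') (χ : BaseHom M M'') (h : ∀ m, ψ.toFun (φ.toFun m) = χ.toFun m) (n : ℕ)
    (x : (chains M n).carrier) :
    (chainsBaseMap ψ n).toFun ((chainsBaseMap φ n).toFun x) = (chainsBaseMap χ n).toFun x := by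
  induction n with
  | zero => exact h x
  | succ n ih =>
    refine DFunLike.congr_fun (f := (chainsBaseMap ψ (n + 1)).toFun.comp
      (chainsBaseMap φ (n + 1)).toFun) (tensorAlg_hom_ext (chains M n) fun i j x _ a _ => ?_) x
    exact congrArg (fun y => tmulAlg (chains M'' n) y a) (ih x)

theorem chainsBaseMap_add (φ ψ χ : BaseHom M M')
    (h : ∀ m, φ.toFun m + ψ.toFun m = χ.toFun m) (n : ℕ) (x : (chains M n).carrier) :
    (chainsBaseMap φ n).toFun x + (chainsBaseMap ψ n).toFun x = (chainsBaseMap χ n).toFun x := by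
  induction n with
  | zero => exact h x
  | succ n ih =>
    refine DFunLike.congr_fun (f := (chainsBaseMap φ (n + 1)).toFun +
      (chainsBaseMap ψ (n + 1)).toFun) (tensorAlg_hom_ext (chains M n) fun i j x _ a _ => ?_) x
    change tmulAlg (chains M' n) _ a + tmulAlg (chains M' n) _ a = tmulAlg (chains M' n) _ a
    rw [← ih, map_add]
    rfl

theorem chainsBaseMap_eq_self (φ : BaseHom M M) (h : ∀ m, φ.toFun m = m) (n : ℕ)
    (x : (chains M n).carrier) : (chainsBaseMap φ n).toFun x = x := by
  induction n with
  | zero => exact h x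
  | succ n ih =>
    refine DFunLike.congr_fun (g := AddMonoidHom.id _)
      (tensorAlg_hom_ext (chains M n) fun i j x _ a _ => ?_) x
    exact congrArg (fun y => tmulAlg (chains M n) y a) (ih x)

/-- A morphism of bimodules over the identity of `A`, as a map linear over the ground superring. -/
def Hom.toBaseHom {T T' : SuperAlgebra.{u, s} R} {N : SuperBimodule.{u, v, s, v} T A}
    {N' : SuperBimodule.{u, v, s, v} T' A} {f : SuperAlgebraHom T T'}
    (h : Hom f (SuperAlgebraHom.id A) N N') : BaseHom N N' where
  toFun := h.toFun
  map_base _ m := h.map_op_smul _ m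

end BaseHom

/-! ### Sequences of bimodules split over the ground superring -/

section Split

variable {A : SuperAlgebra.{u, v} R} {M M' M'' : SuperBimodule.{u, v, v, v} A A}

/-- The bridge that lets bimodule morphisms be composed on chains with the merely `R`-linear maps of
a splitting. -/
theorem chainsBaseMap_toBaseHom (h : Hom (SuperAlgebraHom.id A) (SuperAlgebraHom.id A) M M')
    (n : ℕ) (x : (chains M n).carrier) :
    (chainsBaseMap h.toBaseHom n).toFun x = (chainsMap h n).toFun x := by
  induction n with
  | zero => rfl
  | succ n ih =>
    refine DFunLike.congr_fun (tensorAlg_hom_ext (chains M n) fun i j x _ a _ => ?_) x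
    exact congrArg (fun y => tmulAlg (chains M' n) y a) (ih x)

/-- A short exact sequence `M → M' → M''` of bimodules with a splitting that is linear over the
ground superring. -/
structure BaseSplitting (i : Hom (SuperAlgebraHom.id A) (SuperAlgebraHom.id A) M M')
    (g : Hom (SuperAlgebraHom.id A) (SuperAlgebraHom.id A) M' M'') where
  r : BaseHom M' M
  s : BaseHom M'' M'
  r_i : ∀ x, r.toFun (i.toFun x) = x
  g_s : ∀ x, g.toFun (s.toFun x) = x
  split : ∀ x, i.toFun (r.toFun x) + s.toFun (g.toFun x) = x

namespace BaseSplitting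

variable {i : Hom (SuperAlgebraHom.id A) (SuperAlgebraHom.id A) M M'}
  {g : Hom (SuperAlgebraHom.id A) (SuperAlgebraHom.id A) M' M''}

/-- The splitting induced on chains. -/
theorem chains_split (σ : BaseSplitting i g) (n : ℕ) (x : (chains M' n).carrier) :
    (chainsMap i n).toFun ((chainsBaseMap σ.r n).toFun x) +
      (chainsBaseMap σ.s n).toFun ((chainsMap g n).toFun x) = x := by
  rw [← chainsBaseMap_toBaseHom, ← chainsBaseMap_toBaseHom,
    chainsBaseMap_comp σ.r i.toBaseHom ⟨i.toFun.comp σ.r.toFun, fun r m => by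
      simp only [AddMonoidHom.comp_apply, σ.r.map_base]
      exact i.toBaseHom.map_base r _⟩ fun _ => rfl,
    chainsBaseMap_comp g.toBaseHom σ.s ⟨σ.s.toFun.comp g.toFun, fun r m =>
      (congrArg σ.s.toFun (g.toBaseHom.map_base r m)).trans (σ.s.map_base r _)⟩ fun _ => rfl,
    chainsBaseMap_add _ _ (Hom.id M').toBaseHom σ.split,
    chainsBaseMap_eq_self _ fun _ => rfl]

theorem chains_r_i (σ : BaseSplitting i g) (n : ℕ) (x : (chains M n).carrier) :
    (chainsBaseMap σ.r n).toFun ((chainsMap i n).toFun x) = x := by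
  rw [← chainsBaseMap_toBaseHom,
    chainsBaseMap_comp i.toBaseHom σ.r (Hom.id M).toBaseHom σ.r_i,
    chainsBaseMap_eq_self _ fun _ => rfl]

theorem chains_g_s (σ : BaseSplitting i g) (n : ℕ) (x : (chains M'' n).carrier) :
    (chainsMap g n).toFun ((chainsBaseMap σ.s n).toFun x) = x := by
  rw [← chainsBaseMap_toBaseHom,
    chainsBaseMap_comp σ.s g.toBaseHom (Hom.id M'').toBaseHom σ.g_s,
    chainsBaseMap_eq_self _ fun _ => rfl]

/-- That the composite vanishes is a consequence of the splitting: the decomposition of `i x`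
together with `r i = 1` forces `s (g (i x)) = 0`, and `s` is injective. -/
theorem chains_g_i (σ : BaseSplitting i g) (n : ℕ) (x : (chains M n).carrier) :
    (chainsMap g n).toFun ((chainsMap i n).toFun x) = 0 := by
  have h := σ.chains_split n ((chainsMap i n).toFun x)
  rw [σ.chains_r_i, add_eq_left] at h
  rw [← σ.chains_g_s n ((chainsMap g n).toFun ((chainsMap i n).toFun x)), h, map_zero]

end BaseSplitting

end Split

/-! ### Contractibility of the complex of an induced bimodule -/

section Contraction

variable {A : SuperAlgebra.{u, v} R} (M : SuperBimodule.{u, v, v, v} A A)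

/-- `m ⊗ a ↦ m ⊗ 1 ⊗ a`. -/
def insertOne : Hom (SuperAlgebraHom.id A) (SuperAlgebraHom.id A)
    (tensorAlg M) (tensorAlg (tensorAlg M)) :=
  homOfTensor (liftAlg M ((tmulAlg (tensorAlg M)).comp ((tmulAlg M).flip 1)) fun m r a => by
      change tmulAlg (tensorAlg M) (tmulAlg M (MulOpposite.op (A.algMap r) • m) 1) a =
        tmulAlg (tensorAlg M) (tmulAlg M m 1) (A.algMap r * a)
      rw [tmulAlg_balanced, mul_one, ← tmulAlg_balanced, op_smul_tmulAlg, one_mul])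
    (fun {i j p q} hp hq => by
      have h := tmulAlg_mem M (m := p) (a := 1) hp SetLike.GradedOne.one_mem
      rw [add_zero] at h
      exact tmulAlg_mem (tensorAlg M) h hq)
    (fun _ _ _ => rfl) (fun _ _ _ => rfl)

/-- The contracting homotopy `m ⊗ a_0 ⊗ ⋯ ⊗ a_n ↦ m ⊗ 1 ⊗ a_0 ⊗ ⋯ ⊗ a_n`. -/
def contraction : (n : ℕ) → Hom (SuperAlgebraHom.id A) (SuperAlgebraHom.id A)
    (chains (tensorAlg M) n) (chains (tensorAlg M) (n + 1))
  | 0 => insertOne M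
  | n + 1 => tensorAlgMap (contraction n)

theorem contraction_tmulC (n : ℕ) (x : (chains (tensorAlg M) n).carrier) (a : A.carrier) :
    (contraction M (n + 1)).toFun (tmulC (tensorAlg M) n x a) =
      tmulC (tensorAlg M) (n + 1) ((contraction M n).toFun x) a := rfl

theorem barDiff_zero_contraction (x : (chains (tensorAlg M) 0).carrier) :
    barDiff (tensorAlg M) 0 ((contraction M 0).toFun x) = x := by
  refine DFunLike.congr_fun (f := (barDiff (tensorAlg M) 0).comp (contraction M 0).toFun)
    (g := AddMonoidHom.id _) (tensorAlg_hom_ext M fun i j m _ a _ => ?_) x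
  exact (barDiff_zero (tensorAlg M) (tmulAlg M m 1) a).trans
    (congrArg (tmulAlg M m) (one_mul a))

/-- The first face after inserting the unit multiplies it by `a_0` and gives back `x`; every other
inner face is an inner face of `x` with its index, hence its sign, shifted by one. The induction
peels off the last tensor factor. -/
theorem barDiff_contraction (n : ℕ) (x : (chains (tensorAlg M) (n + 1)).carrier) :
    barDiff (tensorAlg M) (n + 1) ((contraction M (n + 1)).toFun x) =
      x - (contraction M n).toFun (barDiff (tensorAlg M) n x) := by
  induction n with
  | zero =>
    refine DFunLike.congr_fun
      (f := (barDiff (tensorAlg M) 1).comp (contraction M 1).toFun)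
      (g := AddMonoidHom.id _ - (contraction M 0).toFun.comp (barDiff (tensorAlg M) 0))
      (chains_hom_ext (tensorAlg M) 0 fun i j x _ a _ => ?_) x
    refine (barDiff_succ (tensorAlg M) 0 ((contraction M 0).toFun x) a).trans ?_
    change _ = tmulC (tensorAlg M) 0 x a -
      (contraction M 0).toFun (barDiff (tensorAlg M) 0 (tmulC (tensorAlg M) 0 x a))
    have h : (-1 : ℤ) ^ (0 + 1) = -1 := by norm_num
    rw [barDiff_zero, (contraction M 0).map_op_smul, h, neg_one_smul, ← sub_eq_add_neg]
    congr 1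
    exact congrArg (fun y => tmulC (tensorAlg M) 0 y a) (barDiff_zero_contraction M x)
  | succ n ih =>
    refine DFunLike.congr_fun
      (f := (barDiff (tensorAlg M) (n + 2)).comp (contraction M (n + 2)).toFun)
      (g := AddMonoidHom.id _ -
        (contraction M (n + 1)).toFun.comp (barDiff (tensorAlg M) (n + 1)))
      (chains_hom_ext (tensorAlg M) (n + 1) fun i j x _ a _ => ?_) x
    change barDiff (tensorAlg M) (n + 1 + 1)
        (tmulC (tensorAlg M) (n + 1 + 1) ((contraction M (n + 1)).toFun x) a) =
      tmulC (tensorAlg M) (n + 1) x a - (contraction M (n + 1)).toFun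
        (barDiff (tensorAlg M) (n + 1) (tmulC (tensorAlg M) (n + 1) x a))
    rw [barDiff_succ, ih, barDiff_succ, map_add, map_zsmul, (contraction M (n + 1)).map_op_smul,
      contraction_tmulC, map_sub, AddMonoidHom.sub_apply, pow_succ (-1 : ℤ) (n + 1), mul_neg_one,
      neg_smul]
    change _ - _ + -((-1 : ℤ) ^ (n + 1) • (MulOpposite.op a • _)) =
      _ - (_ + (-1 : ℤ) ^ (n + 1) • (MulOpposite.op a • _))
    abel

/-- The last face multiplies `m` on the left, away from the inserted unit, and the unit is even, so
the Koszul sign is unchanged. This needs a last factor other than `a_0`, hence positive degree. -/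
theorem cyclicC_contraction (n : ℕ) (x : (chains (tensorAlg M) (n + 1)).carrier) :
    cyclicC (tensorAlg M) (n + 1) ((contraction M (n + 1)).toFun x) =
      (contraction M n).toFun (cyclicC (tensorAlg M) n x) := by
  refine DFunLike.congr_fun
    (f := (cyclicC (tensorAlg M) (n + 1)).comp (contraction M (n + 1)).toFun)
    (g := (contraction M n).toFun.comp (cyclicC (tensorAlg M) n))
    (chains_hom_ext (tensorAlg M) n fun i j x hx a ha => ?_) x
  change cyclicC (tensorAlg M) (n + 1) ((contraction M (n + 1)).toFun (tmulC (tensorAlg M) n x a)) =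
    (contraction M n).toFun (cyclicC (tensorAlg M) n (tmulC (tensorAlg M) n x a))
  rw [contraction_tmulC, cyclicC_tmulC _ _ ((contraction M n).map_mem hx) ha,
    cyclicC_tmulC _ _ hx ha, map_units, (contraction M n).map_smul]
  rfl

/-- The cyclic face has opposite signs in consecutive degrees, so it fits the same identity as the
inner faces. -/
theorem diff_contraction (n : ℕ) (x : (chains (tensorAlg M) (n + 1)).carrier) :
    diff (tensorAlg M) (n + 1) ((contraction M (n + 1)).toFun x) =
      x - (contraction M n).toFun (diff (tensorAlg M) n x) := by
  rw [diff_eq, diff_eq, barDiff_contraction, cyclicC_contraction, map_add, map_zsmul,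
    pow_succ (-1 : ℤ) (n + 1), mul_neg_one, neg_smul]
  abel

end Contraction

/-! ### Homology classes -/

section Classes

variable {A A' : SuperAlgebra.{u, v} R} (M : SuperBimodule.{u, v, v, v} A A)
  {M' : SuperBimodule.{u, v, v, v} A' A'}

/-- The Hochschild cycles, as chains. -/
def IsCycle (n : ℕ) (x : (chains M n).carrier) : Prop :=
  ((hochschildComplex M).d n ((ComplexShape.down ℕ).next n)).hom x = 0

/-- In degree zero `next` returns a default index that is not related to `0`, so the differential
vanishes by `shape`. -/
theorem isCycle_zero (x : (chains M 0).carrier) : IsCycle M 0 x := by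
  have h : (hochschildComplex M).d 0 ((ComplexShape.down ℕ).next 0) = 0 :=
    (hochschildComplex M).shape _ _ (by simp)
  rw [IsCycle, h]
  rfl

theorem isCycle_succ {n : ℕ} {x : (chains M (n + 1)).carrier} :
    IsCycle M (n + 1) x ↔ diff M n x = 0 := by
  have h : (ComplexShape.down ℕ).next (n + 1) = n := ChainComplex.next_nat_succ n
  rw [IsCycle, h, hochschildComplex_d]
  rfl

variable {M}

theorem exists_cycles {n : ℕ} {x : (chains M n).carrier} (hx : IsCycle M n x) :
    ∃ c, ((hochschildComplex M).iCycles n).hom c = x :=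
  ⟨(hochschildComplex M).cyclesMk x _ rfl hx, (hochschildComplex M).i_cyclesMk x _ rfl hx⟩

/-- The homology class of a cycle. -/
noncomputable def cls {n : ℕ} (x : (chains M n).carrier) (hx : IsCycle M n x) : HH M n :=
  ((hochschildComplex M).homologyπ n).hom (exists_cycles hx).choose

theorem iCycles_injective (n : ℕ) :
    Function.Injective ((hochschildComplex M).iCycles n).hom :=
  (ModuleCat.mono_iff_injective _).1 inferInstance

theorem isCycle_iCycles (n : ℕ) (c : (hochschildComplex M).cycles n) :
    IsCycle M n (((hochschildComplex M).iCycles n).hom c) := by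
  change ((hochschildComplex M).iCycles n ≫ (hochschildComplex M).d n _).hom c = 0
  rw [HomologicalComplex.iCycles_d]
  rfl

/-- The lift to abstract cycles chosen in `cls` is unique because the inclusion of cycles is a
monomorphism. -/
theorem cls_eq {n : ℕ} {x : (chains M n).carrier} (hx : IsCycle M n x)
    (c : (hochschildComplex M).cycles n) (hc : ((hochschildComplex M).iCycles n).hom c = x) :
    cls x hx = ((hochschildComplex M).homologyπ n).hom c :=
  congrArg _ (iCycles_injective n ((exists_cycles hx).choose_spec.trans hc.symm))

theorem exists_cls {n : ℕ} (ξ : HH M n) : ∃ x hx, cls (M := M) (n := n) x hx = ξ := by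
  obtain ⟨c, rfl⟩ := (ModuleCat.epi_iff_surjective ((hochschildComplex M).homologyπ n)).1
    inferInstance ξ
  exact ⟨_, isCycle_iCycles n c, cls_eq _ c rfl⟩

theorem cls_congr {n : ℕ} {x y : (chains M n).carrier} (h : x = y) (hx : IsCycle M n x)
    (hy : IsCycle M n y) : cls x hx = cls y hy := by
  subst h; rfl

theorem IsCycle.add {n : ℕ} {x y : (chains M n).carrier} (hx : IsCycle M n x)
    (hy : IsCycle M n y) : IsCycle M n (x + y) := by
  have h := map_add ((hochschildComplex M).d n ((ComplexShape.down ℕ).next n)).hom x y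
  exact h.trans ((congrArg₂ (· + ·) hx hy).trans (add_zero _))

theorem cls_add {n : ℕ} {x y : (chains M n).carrier} (hx : IsCycle M n x)
    (hy : IsCycle M n y) : cls (x + y) (hx.add hy) = cls x hx + cls y hy := by
  obtain ⟨c, hc⟩ := exists_cycles hx
  obtain ⟨d, hd⟩ := exists_cycles hy
  rw [cls_eq hx c hc, cls_eq hy d hd]
  exact (cls_eq _ (c + d) ((map_add _ c d).trans (congrArg₂ (· + ·) hc hd))).trans (map_add _ c d)

theorem IsCycle.smul {n : ℕ} (r : R.carrier) {x : (chains M n).carrier} (hx : IsCycle M n x) :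
    IsCycle M n (A.algMap r • x) := by
  have h := ((hochschildComplex M).d n ((ComplexShape.down ℕ).next n)).hom.map_smul r x
  exact h.trans ((congrArg (r • ·) hx).trans (smul_zero r))

theorem cls_smul {n : ℕ} (r : R.carrier) {x : (chains M n).carrier} (hx : IsCycle M n x) :
    cls (A.algMap r • x) (hx.smul r) = r • cls x hx := by
  obtain ⟨c, hc⟩ := exists_cycles hx
  rw [cls_eq hx c hc]
  exact (cls_eq _ (r • c) ((((hochschildComplex M).iCycles n).hom.map_smul r c).trans
    (congrArg (r • ·) hc))).trans (((hochschildComplex M).homologyπ n).hom.map_smul r c)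

/-- Homology is the cokernel of the map from chains to cycles, which gives exactness at the cycles.
-/
theorem cls_eq_zero_iff {n : ℕ} {x : (chains M n).carrier} (hx : IsCycle M n x) :
    cls x hx = 0 ↔ ∃ y, diff M n y = x := by
  have hrel : (ComplexShape.down ℕ).prev n = n + 1 := ChainComplex.prev ℕ n
  have hex : (ShortComplex.mk ((hochschildComplex M).toCycles (n + 1) n)
      ((hochschildComplex M).homologyπ n) (by simp)).Exact :=
    ShortComplex.exact_of_g_is_cokernel _ ((hochschildComplex M).homologyIsCokernel _ _ hrel)
  have hd (y : (chains M (n + 1)).carrier) : ((hochschildComplex M).iCycles n).hom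
      (((hochschildComplex M).toCycles (n + 1) n).hom y) = diff M n y := by
    change ((hochschildComplex M).toCycles (n + 1) n ≫ (hochschildComplex M).iCycles n).hom y = _
    rw [HomologicalComplex.toCycles_i, hochschildComplex_d]
    rfl
  obtain ⟨c, rfl⟩ := exists_cycles hx
  rw [cls_eq hx c rfl]
  constructor
  · intro h
    obtain ⟨y, hy⟩ := (ShortComplex.moduleCat_exact_iff _).1 hex c h
    exact ⟨y, (hd y).symm.trans (congrArg _ hy)⟩
  · rintro ⟨y, hy⟩
    rw [← iCycles_injective n ((hd y).trans hy)]
    change ((hochschildComplex M).toCycles (n + 1) n ≫ (hochschildComplex M).homologyπ n).hom y = 0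
    rw [HomologicalComplex.toCycles_comp_homologyπ]
    rfl

variable {f : SuperAlgebraHom A A'}

theorem IsCycle.map (h : Hom f f M M') {n : ℕ} {x : (chains M n).carrier} (hx : IsCycle M n x) :
    IsCycle M' n ((chainsMap h n).toFun x) := by
  cases n with
  | zero => exact isCycle_zero M' _
  | succ n => rw [isCycle_succ] at hx ⊢; rw [chainsMap_diff, hx, map_zero]

theorem HHmap_cls (h : Hom f f M M') {n : ℕ} {x : (chains M n).carrier} (hx : IsCycle M n x) :
    (HHmap h n).hom (cls x hx) = cls ((chainsMap h n).toFun x) (hx.map h) := by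
  obtain ⟨c, rfl⟩ := exists_cycles hx
  rw [cls_eq hx c rfl, cls_eq _ ((HomologicalComplex.cyclesMap (hochschildMap h) n).hom c)]
  · change ((hochschildComplex M).homologyπ n ≫
      HomologicalComplex.homologyMap (hochschildMap h) n).hom c = _
    rw [HomologicalComplex.homologyπ_naturality]
    rfl
  · change (HomologicalComplex.cyclesMap (hochschildMap h) n ≫
      (hochschildComplex M').iCycles n).hom c = _
    rw [HomologicalComplex.cyclesMap_i]
    rfl

theorem mem_HHgr_iff {n : ℕ} {k : ZMod 2} {ξ : HH M n} :
    ξ ∈ HHgr M n k ↔ ∃ x ∈ (chains M n).gr k, ∃ hx : IsCycle M n x, cls x hx = ξ := by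
  constructor
  · rintro ⟨c, hc, rfl⟩
    exact ⟨_, hc, isCycle_iCycles n c, cls_eq _ c rfl⟩
  · rintro ⟨x, hk, hx, rfl⟩
    obtain ⟨c, rfl⟩ := exists_cycles hx
    exact ⟨c, hk, (cls_eq hx c rfl).symm⟩

theorem cls_mem_HHgr {n : ℕ} {k : ZMod 2} {x : (chains M n).carrier} (hx : IsCycle M n x)
    (hk : x ∈ (chains M n).gr k) : cls x hx ∈ HHgr M n k :=
  mem_HHgr_iff.2 ⟨x, hk, hx, rfl⟩

end Classes

/-! ### The grading of the homology -/

section Parity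

variable {A : SuperAlgebra.{u, v} R} {M : SuperBimodule.{u, v, v, v} A A}

theorem cyclicC_mem (n : ℕ) {k : ZMod 2} {x : (chains M (n + 1)).carrier}
    (hx : x ∈ (chains M (n + 1)).gr k) : cyclicC M n x ∈ (chains M n).gr k := by
  have h : (chains M (n + 1)).gr k ≤ ((chains M n).gr k).comap (cyclicC M n) := by
    refine (AddSubgroup.closure_le _).2 ?_
    rintro _ ⟨i, j, rfl, p, hp, a, ha, rfl⟩
    change cyclicC M n (tmulC M n p a) ∈ (chains M n).gr (i + j)
    rw [cyclicC_tmulC M n hp ha, Units.smul_def, add_comm]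
    exact zsmul_mem ((chains M n).smul_mem ha hp) _
  exact h hx

theorem diff_mem (n : ℕ) {k : ZMod 2} {x : (chains M (n + 1)).carrier}
    (hx : x ∈ (chains M (n + 1)).gr k) : diff M n x ∈ (chains M n).gr k := by
  rw [diff_eq]
  exact add_mem (barDiff_mem M n hx) (zsmul_mem (cyclicC_mem n hx) _)

end Parity

/-- An additive map that shifts the parity by `j` commutes with the homogeneous components. -/
theorem comp_map {X : Type v} {Y : Type w} [AddCommGroup X] [AddCommGroup Y]
    (gX : ZMod 2 → AddSubgroup X) (gY : ZMod 2 → AddSubgroup Y) [DirectSum.Decomposition gX]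
    [DirectSum.Decomposition gY] (φ : X →+ Y) (j : ZMod 2)
    (hφ : ∀ i, ∀ x ∈ gX i, φ x ∈ gY (i + j)) (k : ZMod 2) (x : X) :
    comp gY (k + j) (φ x) = φ (comp gX k x) := by
  refine DFunLike.congr_fun (f := (comp gY (k + j)).comp φ) (g := φ.comp (comp gX k))
    (hom_ext_homogeneous gX fun i y hy => ?_) x
  change comp gY (k + j) (φ y) = φ (comp gX k y)
  by_cases h : i = k
  · subst h
    rw [comp_same gY (hφ i y hy), comp_same gX hy]
  · rw [comp_ne gY (hφ i y hy) (fun h' => h (add_right_cancel h')), comp_ne gX hy h, map_zero]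

theorem comp_map_even {X : Type v} {Y : Type w} [AddCommGroup X] [AddCommGroup Y]
    (gX : ZMod 2 → AddSubgroup X) (gY : ZMod 2 → AddSubgroup Y) [DirectSum.Decomposition gX]
    [DirectSum.Decomposition gY] (φ : X →+ Y) (hφ : ∀ {i x}, x ∈ gX i → φ x ∈ gY i) (k : ZMod 2)
    (x : X) : comp gY k (φ x) = φ (comp gX k x) := by
  have h := comp_map gX gY φ 0 (fun i x hx => by rw [add_zero]; exact hφ hx) k x
  rwa [add_zero] at h

theorem comp_zero_add_comp_one {X : Type v} [AddCommGroup X]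
    (gX : ZMod 2 → AddSubgroup X) [DirectSum.Decomposition gX] (x : X) :
    comp gX 0 x + comp gX 1 x = x := by
  have h : comp gX 0 + comp gX 1 = AddMonoidHom.id X := by
    refine hom_ext_homogeneous gX fun i y hy => ?_
    change comp gX 0 y + comp gX 1 y = y
    have hi : i = 0 ∨ i = 1 := by clear hy; revert i; decide
    rcases hi with rfl | rfl
    · rw [comp_same gX hy, comp_ne gX hy (by decide), add_zero]
    · rw [comp_same gX hy, comp_ne gX hy (by decide), zero_add]
  exact DFunLike.congr_fun h x

section Parity

variable {A A' : SuperAlgebra.{u, v} R} {M : SuperBimodule.{u, v, v, v} A A}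
  {M' : SuperBimodule.{u, v, v, v} A' A'}

theorem IsCycle.comp {n : ℕ} {x : (chains M n).carrier} (hx : IsCycle M n x) (k : ZMod 2) :
    IsCycle M n (comp (chains M n).gr k x) := by
  cases n with
  | zero => exact isCycle_zero M _
  | succ n =>
    rw [isCycle_succ] at hx ⊢
    rw [← comp_map_even _ (chains M n).gr (diff M n) (diff_mem n), hx, map_zero]

/-- The differential is even, so the homogeneous components of a cycle are cycles. -/
theorem exists_add_mem_HHgr {n : ℕ} (ξ : HH M n) :
    ∃ ξ₀ ∈ HHgr M n 0, ∃ ξ₁ ∈ HHgr M n 1, ξ₀ + ξ₁ = ξ := by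
  obtain ⟨x, hx, rfl⟩ := exists_cls ξ
  refine ⟨_, cls_mem_HHgr (hx.comp 0) (comp_mem _ 0 x), _,
    cls_mem_HHgr (hx.comp 1) (comp_mem _ 1 x), ?_⟩
  rw [← cls_add]
  exact cls_congr (comp_zero_add_comp_one _ x) _ _

/-- If `x` of parity `j` represents the class and `y` of parity `k` represents its negative, then `x
+ y` is a boundary `d z`; its component of parity `j` exhibits `x` as the boundary of the
corresponding component of `z`. -/
theorem eq_zero_of_mem_HHgr {n : ℕ} {j k : ZMod 2} (hjk : j ≠ k) {ξ : HH M n}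
    (hj : ξ ∈ HHgr M n j) (hk : ξ ∈ HHgr M n k) : ξ = 0 := by
  obtain ⟨x, hxj, hx, rfl⟩ := mem_HHgr_iff.1 hj
  obtain ⟨y, hyk, hy, h⟩ := mem_HHgr_iff.1 ((HHgr M n k).neg_mem hk)
  have h0 : cls (x + y) (hx.add hy) = 0 := by rw [cls_add hx hy, h, add_neg_cancel]
  obtain ⟨z, hz⟩ := (cls_eq_zero_iff _).1 h0
  refine (cls_eq_zero_iff _).2 ⟨comp (chains M (n + 1)).gr j z, ?_⟩
  rw [← comp_map_even _ (chains M n).gr (diff M n) (diff_mem n), hz, map_add,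
    comp_same _ hxj, comp_ne _ hyk hjk.symm, add_zero]

/-- An injective even map between homology groups reflects the parity. -/
theorem mem_HHgr_of_map_mem {n m : ℕ} (φ : HH M n →+ HH M' m) (hφ : Function.Injective φ)
    (hgr : ∀ k, ∀ ξ ∈ HHgr M n k, φ ξ ∈ HHgr M' m k) {k : ZMod 2} {ξ : HH M n}
    (h : φ ξ ∈ HHgr M' m k) : ξ ∈ HHgr M n k := by
  obtain ⟨ξ₀, h₀, ξ₁, h₁, rfl⟩ := exists_add_mem_HHgr ξ
  rw [map_add] at h
  have hk : k = 0 ∨ k = 1 := by clear h; revert k; decide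
  rcases hk with rfl | rfl
  -- The image of the odd summand lies in both parities, hence is zero, and injectivity removes the
  -- summand.
  · have : φ ξ₁ ∈ HHgr M' m 0 := by
      simpa using sub_mem h (hgr 0 ξ₀ h₀)
    have h' := hφ ((eq_zero_of_mem_HHgr (by decide) (hgr 1 ξ₁ h₁) this).trans (map_zero φ).symm)
    rwa [h', add_zero]
  · have : φ ξ₀ ∈ HHgr M' m 1 := by
      simpa using sub_mem h (hgr 1 ξ₁ h₁)
    have h' := hφ ((eq_zero_of_mem_HHgr (by decide) (hgr 0 ξ₀ h₀) this).trans (map_zero φ).symm)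
    rwa [h', zero_add]

/-- Evenness of the forward map is enough: an injective even map reflects parity, so its inverse is
even as well. -/
theorem HHgr_map_iso {n m : ℕ} (e : HH M n ≅ HH M' m)
    (hgr : ∀ k, ∀ ξ ∈ HHgr M n k, e.hom.hom ξ ∈ HHgr M' m k) (k : ZMod 2) :
    (HHgr M n k).map e.hom.hom.toAddMonoidHom = HHgr M' m k := by
  refine le_antisymm ?_ fun ξ hξ => ?_
  · rintro _ ⟨ξ, hξ, rfl⟩
    exact hgr k ξ hξ
  · have h : e.hom.hom (e.inv.hom ξ) = ξ := by
      change (e.inv ≫ e.hom).hom ξ = ξ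
      rw [e.inv_hom_id]
      rfl
    refine ⟨e.inv.hom ξ, mem_HHgr_of_map_mem e.hom.hom.toAddMonoidHom ?_ hgr ?_, h⟩
    · exact (ModuleCat.mono_iff_injective e.hom).1 inferInstance
    · exact (congrArg (· ∈ HHgr M' m k) h).mpr hξ

end Parity

/-! ### The long exact sequence -/

section Sequence

variable {A : SuperAlgebra.{u, v} R} {M M' M'' : SuperBimodule.{u, v, v, v} A A}
  {i : Hom (SuperAlgebraHom.id A) (SuperAlgebraHom.id A) M M'}
  {g : Hom (SuperAlgebraHom.id A) (SuperAlgebraHom.id A) M' M''}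

namespace BaseSplitting

/-- The short complex of Hochschild complexes of a split sequence of bimodules. -/
noncomputable def shortComplex (σ : BaseSplitting i g) :
    ShortComplex (ChainComplex (ModuleCat.{v} R.carrier) ℕ) :=
  ShortComplex.mk (hochschildMap i) (hochschildMap g) (by
    ext n x
    exact σ.chains_g_i n x)

/-- The splitting is not a chain map, but extended to chains it splits the sequence in each degree,
and degreewise exactness is all that is required. -/
theorem shortExact (σ : BaseSplitting i g) : σ.shortComplex.ShortExact := by
  refine HomologicalComplex.shortExact_of_degreewise_shortExact _ fun n => ?_
  refine ModuleCat.shortComplex_shortExact _ (fun y => ⟨fun hy => ?_, ?_⟩) ?_ ?_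
  · refine ⟨(chainsBaseMap σ.r n).toFun y, ?_⟩
    have h := σ.chains_split n y
    have hy' : (chainsMap g n).toFun y = 0 := hy
    rw [hy', map_zero, add_zero] at h
    exact h
  · rintro ⟨x, rfl⟩
    exact σ.chains_g_i n x
  · exact Function.LeftInverse.injective (g := (chainsBaseMap σ.r n).toFun) (σ.chains_r_i n)
  · exact Function.RightInverse.surjective (g := (chainsBaseMap σ.s n).toFun) (σ.chains_g_s n)

/-- The connecting map `H_{n+1}(A, M'') → H_n(A, M)`. -/
noncomputable def connecting (σ : BaseSplitting i g) (n : ℕ) : HH M'' (n + 1) ⟶ HH M n :=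
  σ.shortExact.δ (n + 1) n rfl

/-- The snake recipe on chains (lift, differentiate, pull back), valid for every choice of lift.
This freedom of choice is used below for parity and naturality. -/
theorem connecting_cls (σ : BaseSplitting i g) (n : ℕ) {z : (chains M'' (n + 1)).carrier}
    (hz : IsCycle M'' (n + 1) z) (y : (chains M' (n + 1)).carrier)
    (hy : (chainsMap g (n + 1)).toFun y = z) {x : (chains M n).carrier} (hx : IsCycle M n x)
    (hxy : (chainsMap i n).toFun x = diff M' n y) :
    (σ.connecting n).hom (cls z hz) = cls x hx := by
  have hz' : ((hochschildComplex M'').d (n + 1) n).hom z = 0 := by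
    rw [hochschildComplex_d]
    exact (isCycle_succ M'').1 hz
  have hxy' : ((hochschildMap i).f n).hom x = ((hochschildComplex M').d (n + 1) n).hom y := by
    rw [hochschildComplex_d]
    exact hxy
  have h := σ.shortExact.δ_apply (n + 1) n rfl z hz' y hy x hxy' _ rfl
  refine Eq.trans (congrArg (σ.connecting n).hom (cls_eq hz _ ?_)) (h.trans (cls_eq hx _ ?_).symm)
  · exact (hochschildComplex M'').i_cyclesMk (i := n + 1) z n (ChainComplex.next_nat_succ n) hz'
  · exact (hochschildComplex M).i_cyclesMk x _ rfl _

/-- The differential of the lift is killed by `g`, so the splitting writes it as `i (r (d y))`. That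
`r (d y)` is a cycle follows from `d d = 0` after cancelling `i` with `r`. -/
theorem exists_lift (σ : BaseSplitting i g) (n : ℕ) {z : (chains M'' (n + 1)).carrier}
    (hz : IsCycle M'' (n + 1) z) (y : (chains M' (n + 1)).carrier)
    (hy : (chainsMap g (n + 1)).toFun y = z) :
    ∃ x, IsCycle M n x ∧ (chainsMap i n).toFun x = diff M' n y := by
  have hgd : (chainsMap g n).toFun (diff M' n y) = 0 := by
    rw [← chainsMap_diff, hy]
    exact (isCycle_succ M'').1 hz
  have hs := σ.chains_split n (diff M' n y)
  rw [hgd, map_zero, add_zero] at hs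
  refine ⟨_, ?_, hs⟩
  cases n with
  | zero => exact isCycle_zero M _
  | succ n =>
    rw [isCycle_succ]
    refine (σ.chains_r_i n _).symm.trans ?_
    rw [← chainsMap_diff, hs]
    have := DFunLike.congr_fun (diff_diff M' n) y
    exact (congrArg (chainsBaseMap σ.r n).toFun this).trans (map_zero _)

/-- The splitting is not required to be even, so the lift and its pullback are replaced by their
components of parity `k`; these remain valid choices since all other maps involved are even. -/
theorem connecting_mem (σ : BaseSplitting i g) (n : ℕ) {k : ZMod 2} {ξ : HH M'' (n + 1)}
    (hξ : ξ ∈ HHgr M'' (n + 1) k) : (σ.connecting n).hom ξ ∈ HHgr M n k := by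
  obtain ⟨z, hzk, hz, rfl⟩ := mem_HHgr_iff.1 hξ
  have hy : (chainsMap g (n + 1)).toFun
      (comp (chains M' (n + 1)).gr k ((chainsBaseMap σ.s (n + 1)).toFun z)) = z := by
    rw [← comp_map_even _ (chains M'' (n + 1)).gr _ (chainsMap g (n + 1)).map_mem, σ.chains_g_s,
      comp_same _ hzk]
  obtain ⟨x, hx, hxy⟩ := σ.exists_lift n hz _ hy
  have hxy' : (chainsMap i n).toFun (comp (chains M n).gr k x) = diff M' n
      (comp (chains M' (n + 1)).gr k ((chainsBaseMap σ.s (n + 1)).toFun z)) := by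
    rw [← comp_map_even _ (chains M' n).gr _ (chainsMap i n).map_mem, hxy,
      comp_map_even _ (chains M' n).gr _ (diff_mem n), comp_same _ (comp_mem _ _ _)]
  rw [σ.connecting_cls n hz _ hy (hx.comp k) hxy']
  exact cls_mem_HHgr _ (comp_mem _ _ _)

/-- Exactness at `H_{n+1}(A, M'')`: the kernel is the image of the vanishing group `H_{n+1}(A, M')`.
-/
theorem connecting_injective (σ : BaseSplitting i g) (n : ℕ)
    (h : ∀ ξ : HH M' (n + 1), ξ = 0) : Function.Injective (σ.connecting n).hom := by
  rw [injective_iff_map_eq_zero]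
  intro ξ hξ
  obtain ⟨η, rfl⟩ := (ShortComplex.moduleCat_exact_iff _).1
    (σ.shortExact.homology_exact₃ (n + 1) n rfl) ξ hξ
  exact (congrArg _ (h η)).trans (map_zero _)

theorem range_connecting (σ : BaseSplitting i g) (n : ℕ) (ξ : HH M n) :
    (∃ η, (σ.connecting n).hom η = ξ) ↔ (HHmap i n).hom ξ = 0 := by
  constructor
  · rintro ⟨η, rfl⟩
    exact congrArg (fun φ => φ.hom η) (σ.shortExact.δ_comp (n + 1) n rfl)
  · exact (ShortComplex.moduleCat_exact_iff _).1 (σ.shortExact.homology_exact₁ (n + 1) n rfl) ξ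

variable {A' : SuperAlgebra.{u, v} R} {N N' N'' : SuperBimodule.{u, v, v, v} A' A'}
  {i' : Hom (SuperAlgebraHom.id A') (SuperAlgebraHom.id A') N N'}
  {g' : Hom (SuperAlgebraHom.id A') (SuperAlgebraHom.id A') N' N''}

/-- The vertical maps need not respect the splittings: `φ'` carries a lift to a lift, and any lift
computes the connecting map. This makes the later choice of sections harmless for functoriality. -/
theorem connecting_naturality (σ : BaseSplitting i g) (σ' : BaseSplitting i' g')
    {f : SuperAlgebraHom A A'} (φ : Hom f f M N) (φ' : Hom f f M' N') (φ'' : Hom f f M'' N'')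
    (h₁ : ∀ x, φ'.toFun (i.toFun x) = i'.toFun (φ.toFun x))
    (h₂ : ∀ x, φ''.toFun (g.toFun x) = g'.toFun (φ'.toFun x)) (n : ℕ) (ξ : HH M'' (n + 1)) :
    (σ'.connecting n).hom ((HHmap φ'' (n + 1)).hom ξ) =
      (HHmap φ n).hom ((σ.connecting n).hom ξ) := by
  obtain ⟨z, hz, rfl⟩ := exists_cls ξ
  obtain ⟨x, hx, hxy⟩ := σ.exists_lift n hz _ (σ.chains_g_s (n + 1) z)
  rw [σ.connecting_cls n hz _ (σ.chains_g_s (n + 1) z) hx hxy, HHmap_cls, HHmap_cls]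
  refine σ'.connecting_cls n _
    ((chainsMap φ' (n + 1)).toFun ((chainsBaseMap σ.s (n + 1)).toFun z)) ?_ _ ?_
  · rw [← chainsMap_square g φ'' φ' g' (fun _ => rfl) h₂, σ.chains_g_s]
  · rw [← chainsMap_square i φ' φ i' (fun _ => rfl) h₁, hxy, chainsMap_diff]

end BaseSplitting

end Sequence

/-! ### Vanishing -/

section Vanishing

variable {A : SuperAlgebra.{u, v} R}

theorem HH_tensorAlg_eq_zero (M : SuperBimodule.{u, v, v, v} A A) (n : ℕ)
    (ξ : HH (tensorAlg M) (n + 1)) : ξ = 0 := by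
  obtain ⟨x, hx, rfl⟩ := exists_cls ξ
  refine (cls_eq_zero_iff hx).2 ⟨(contraction M (n + 1)).toFun x, ?_⟩
  rw [diff_contraction, (isCycle_succ _).1 hx, map_zero, sub_zero]

/-- By functoriality a class of `M` is the image under `r` of a class of `N`, which is zero. -/
theorem HH_eq_zero_of_retract {M N : SuperBimodule.{u, v, v, v} A A}
    (i : Hom (SuperAlgebraHom.id A) (SuperAlgebraHom.id A) M N)
    (r : Hom (SuperAlgebraHom.id A) (SuperAlgebraHom.id A) N M)
    (h : ∀ x, r.toFun (i.toFun x) = x) (n : ℕ) (hN : ∀ ξ : HH N n, ξ = 0) (ξ : HH M n) :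
    ξ = 0 := by
  obtain ⟨x, hx, rfl⟩ := exists_cls ξ
  have h1 := (HHmap_cls r (hx.map i)).symm
  rw [← HHmap_cls i hx, hN ((HHmap i n).hom (cls x hx)), map_zero] at h1
  refine Eq.trans (cls_congr ?_ _ _) h1
  rw [chainsMap_square i r (Hom.id M) (Hom.id M) (fun _ => rfl) h,
    chainsMap_eq_self _ (fun _ => rfl) (fun _ => rfl),
    chainsMap_eq_self _ (fun _ => rfl) (fun _ => rfl)]

end Vanishing

/-! ### Kernels of morphisms of bimodules -/

section Kernel

variable {B A : SuperAlgebra.{u, v} R} {M M' : SuperBimodule.{u, v, v, v} B A}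

/-- The kernel of a morphism of bimodules. -/
def kernel (h : Hom (SuperAlgebraHom.id B) (SuperAlgebraHom.id A) M M') :
    SuperBimodule.{u, v, v, v} B A :=
  letI : SMul B.carrier h.toFun.ker :=
    ⟨fun b x => ⟨b • x.1, (h.map_smul b x.1).trans ((congrArg _ x.2).trans (smul_zero _))⟩⟩
  letI : SMul A.carrierᵐᵒᵖ h.toFun.ker :=
    ⟨fun a x => ⟨a • x.1,
      (h.map_op_smul a.unop x.1).trans ((congrArg _ x.2).trans (smul_zero _))⟩⟩
  letI : Module B.carrier h.toFun.ker :=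
    Function.Injective.module B.carrier h.toFun.ker.subtype Subtype.coe_injective fun _ _ => rfl
  letI : Module A.carrierᵐᵒᵖ h.toFun.ker :=
    Function.Injective.module A.carrierᵐᵒᵖ h.toFun.ker.subtype Subtype.coe_injective
      fun _ _ => rfl
  -- An even map commutes with homogeneous components, so these restrict to the kernel.
  letI : DirectSum.Decomposition fun k => (M.gr k).comap h.toFun.ker.subtype :=
    decompositionOfProj _
      (fun k => ((comp M.gr k).comp h.toFun.ker.subtype).codRestrict h.toFun.ker fun x =>
        (comp_map_even M.gr M'.gr h.toFun h.map_mem k x.1).symm.trans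
          ((congrArg (comp M'.gr k) x.2).trans (map_zero _)))
      (fun k x => comp_mem M.gr k x.1)
      (fun k x hx => Subtype.ext (comp_same M.gr hx))
      (fun k j hkj x hx => Subtype.ext (comp_ne M.gr hx hkj))
      (fun x => Subtype.ext (by
        rw [AddSubgroup.val_finsetSum]
        exact (Fin.sum_univ_two _).trans (comp_zero_add_comp_one M.gr x.1)))
  { carrier := h.toFun.ker
    smulComm := ⟨fun b a x => Subtype.ext (smul_comm b a x.1)⟩
    gr := fun k => (M.gr k).comap h.toFun.ker.subtype
    smul_mem := fun hb hx => M.smul_mem hb hx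
    op_smul_mem := fun hx ha => M.op_smul_mem hx ha
    base_comm := fun hr hx => Subtype.ext (M.base_comm hr hx) }

/-- The inclusion of the kernel. -/
def kernelι (h : Hom (SuperAlgebraHom.id B) (SuperAlgebraHom.id A) M M') :
    Hom (SuperAlgebraHom.id B) (SuperAlgebraHom.id A) (kernel h) M where
  toFun := h.toFun.ker.subtype
  map_mem hx := hx
  map_smul _ _ := rfl
  map_op_smul _ _ := rfl

theorem kernel_ext {h : Hom (SuperAlgebraHom.id B) (SuperAlgebraHom.id A) M M'}
    {x y : (kernel h).carrier} (hxy : (kernelι h).toFun x = (kernelι h).toFun y) : x = y :=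
  Subtype.ext hxy

variable {B' A' : SuperAlgebra.{u, v} R} {N N' : SuperBimodule.{u, v, v, v} B' A'}

/-- The map induced on kernels. -/
def kernelMap {g : SuperAlgebraHom B B'} {f : SuperAlgebraHom A A'}
    (h : Hom (SuperAlgebraHom.id B) (SuperAlgebraHom.id A) M M')
    (h' : Hom (SuperAlgebraHom.id B') (SuperAlgebraHom.id A') N N')
    (φ : Hom g f M N) (φ' : Hom g f M' N')
    (hφ : ∀ x, h'.toFun (φ.toFun x) = φ'.toFun (h.toFun x)) : Hom g f (kernel h) (kernel h') where
  toFun := (φ.toFun.comp h.toFun.ker.subtype).codRestrict h'.toFun.ker fun x =>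
    (hφ x.1).trans ((congrArg _ x.2).trans (map_zero _))
  map_mem hx := φ.map_mem hx
  map_smul b x := Subtype.ext (φ.map_smul b x.1)
  map_op_smul a x := Subtype.ext (φ.map_op_smul a x.1)

end Kernel

/-! ### The relative syzygy of a bimodule -/

section Syzygy

variable {B A : SuperAlgebra.{u, v} R} (Q : SuperBimodule.{u, v, v, v} B A)

/-- The kernel of the right action `Q ⊗_R A → Q`. -/
def syzygy : SuperBimodule.{u, v, v, v} B A := kernel (rightAct Q)

/-- The inclusion of the syzygy in `Q ⊗_R A`. -/
def syzygyι : Hom (SuperAlgebraHom.id B) (SuperAlgebraHom.id A) (syzygy Q) (tensorAlg Q) :=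
  kernelι (rightAct Q)

/-- The section `q ↦ q ⊗ 1` of the right action. -/
def unitSection : BaseHom Q (tensorAlg Q) where
  toFun := (tmulAlg Q).flip 1
  map_base r q := by
    change tmulAlg Q _ 1 = tmulAlg Q q (1 * A.algMap r)
    rw [tmulAlg_balanced, mul_one, one_mul]

theorem rightAct_unitSection (q : Q.carrier) :
    (rightAct Q).toFun ((unitSection Q).toFun q) = q := one_smul _ q

/-- Left `B`-linearity is what allows this section to be tensored with `P` over `B`. -/
theorem unitSection_smul (b : B.carrier) (q : Q.carrier) :
    (unitSection Q).toFun (b • q) = b • (unitSection Q).toFun q := rfl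

/-- The retraction `x ↦ x - μ x ⊗ 1` of `Q ⊗_R A` onto the syzygy. -/
def syzygyRetraction : BaseHom (tensorAlg Q) (syzygy Q) where
  toFun := (AddMonoidHom.id _ - (unitSection Q).toFun.comp (rightAct Q).toFun).codRestrict
    (rightAct Q).toFun.ker fun x => by
      change (rightAct Q).toFun (x - (unitSection Q).toFun ((rightAct Q).toFun x)) = 0
      rw [map_sub, rightAct_unitSection, sub_self]
  map_base r x := Subtype.ext (by
    change MulOpposite.op (A.algMap r) • x - (unitSection Q).toFun ((rightAct Q).toFun _) =
      MulOpposite.op (A.algMap r) • (x - (unitSection Q).toFun ((rightAct Q).toFun x))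
    rw [(rightAct Q).map_op_smul, smul_sub, ← (unitSection Q).map_base]
    rfl)

theorem ι_syzygyRetraction (x : (tensorAlg Q).carrier) :
    (syzygyι Q).toFun ((syzygyRetraction Q).toFun x) =
      x - (unitSection Q).toFun ((rightAct Q).toFun x) := rfl

theorem rightAct_ι (x : (syzygy Q).carrier) : (rightAct Q).toFun ((syzygyι Q).toFun x) = 0 := x.2

theorem syzygyRetraction_ι (x : (syzygy Q).carrier) :
    (syzygyRetraction Q).toFun ((syzygyι Q).toFun x) = x := by
  refine kernel_ext ?_
  change (syzygyι Q).toFun _ = (syzygyι Q).toFun x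
  rw [ι_syzygyRetraction, rightAct_ι, map_zero, sub_zero]

theorem syzygyRetraction_smul (b : B.carrier) (x : (tensorAlg Q).carrier) :
    (syzygyRetraction Q).toFun (b • x) = b • (syzygyRetraction Q).toFun x := by
  refine kernel_ext ?_
  change (syzygyι Q).toFun _ = (syzygyι Q).toFun _
  rw [(syzygyι Q).map_smul, ι_syzygyRetraction, ι_syzygyRetraction, (rightAct Q).map_smul]
  exact (smul_sub b x ((unitSection Q).toFun ((rightAct Q).toFun x))).symm

theorem syzygy_split (x : (tensorAlg Q).carrier) :
    (syzygyι Q).toFun ((syzygyRetraction Q).toFun x) +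
      (unitSection Q).toFun ((rightAct Q).toFun x) = x := by
  rw [ι_syzygyRetraction, sub_add_cancel]

variable {B' A' : SuperAlgebra.{u, v} R} {Q} {Q' : SuperBimodule.{u, v, v, v} B' A'}

theorem rightAct_tensorAlgMap {g : SuperAlgebraHom B B'} {f : SuperAlgebraHom A A'}
    (q : Hom g f Q Q') (x : (tensorAlg Q).carrier) :
    (rightAct Q').toFun ((tensorAlgMap q).toFun x) = q.toFun ((rightAct Q).toFun x) :=
  DFunLike.congr_fun (f := (rightAct Q').toFun.comp (tensorAlgMap q).toFun)
    (g := q.toFun.comp (rightAct Q).toFun)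
    (tensorAlg_hom_ext Q fun _ _ m _ a _ => (q.map_op_smul a m).symm) x

/-- The map induced on syzygies. -/
def syzygyMap {g : SuperAlgebraHom B B'} {f : SuperAlgebraHom A A'} (q : Hom g f Q Q') :
    Hom g f (syzygy Q) (syzygy Q') :=
  kernelMap (rightAct Q) (rightAct Q') (tensorAlgMap q) q (rightAct_tensorAlgMap q)

end Syzygy

/-! ### Tensoring the syzygy sequence from the left -/

section TensorLeft

variable {A : SuperAlgebra.{u, s} R} {B : SuperAlgebra.{u, t} R} {C : SuperAlgebra.{u, v} R}
  (P : SuperBimodule.{u, v, s, t} A B) {Q Q' : SuperBimodule.{u, v, t, v} B C}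

theorem tensor_hom_ext {X : Type w} [AddCommGroup X] {P : SuperBimodule.{u, v, s, t} A B}
    {φ ψ : (tensor P Q).carrier →+ X} (h : ∀ p q, φ (tmulB P Q p q) = ψ (tmulB P Q p q)) : φ = ψ :=
  BalTensor.hom_ext h

/-- `P ⊗_B Q → P ⊗_B Q'`, `p ⊗ q ↦ p ⊗ φ q`. -/
def tensorBaseMap (φ : BaseHom Q Q') (hφ : ∀ (b : B.carrier) q, φ.toFun (b • q) = b • φ.toFun q) :
    BaseHom (tensor P Q) (tensor P Q') :=
  let ψ : (tensor P Q).carrier →+ (tensor P Q').carrier :=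
    liftB P Q ((tmulB P Q').compl₂ φ.toFun) fun p b q => by
      change tmulB P Q' _ (φ.toFun q) = tmulB P Q' p (φ.toFun _)
      rw [hφ, tmulB_balanced]
  { toFun := ψ
    map_base := fun r x => DFunLike.congr_fun
      (f := ψ.comp (DistribSMul.toAddMonoidHom _ (MulOpposite.op (C.algMap r))))
      (g := (DistribSMul.toAddMonoidHom _ (MulOpposite.op (C.algMap r))).comp ψ)
      (tensor_hom_ext fun p q => congrArg (tmulB P Q' p) (φ.map_base r q)) x }

end TensorLeft

section SyzygyLeft

variable {A B : SuperAlgebra.{u, v} R} (P : SuperBimodule.{u, v, v, v} A B)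
  (Q : SuperBimodule.{u, v, v, v} B A)

/-- The splitting of `P ⊗_B K → P ⊗_B (Q ⊗_R A) → P ⊗_B Q`. -/
def splittingLeft : BaseSplitting (tensorMap (Hom.id P) (syzygyι Q))
    (tensorMap (Hom.id P) (rightAct Q)) where
  r := tensorBaseMap P (syzygyRetraction Q) (syzygyRetraction_smul Q)
  s := tensorBaseMap P (unitSection Q) (unitSection_smul Q)
  r_i x := DFunLike.congr_fun
    (f := (tensorBaseMap P (syzygyRetraction Q) (syzygyRetraction_smul Q)).toFun.comp
      (tensorMap (Hom.id P) (syzygyι Q)).toFun)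
    (g := AddMonoidHom.id _)
    (tensor_hom_ext fun p q => congrArg (tmulB P _ p) (syzygyRetraction_ι Q q)) x
  g_s x := DFunLike.congr_fun
    (f := (tensorMap (Hom.id P) (rightAct Q)).toFun.comp
      (tensorBaseMap P (unitSection Q) (unitSection_smul Q)).toFun)
    (g := AddMonoidHom.id _)
    (tensor_hom_ext fun p q => congrArg (tmulB P _ p) (rightAct_unitSection Q q)) x
  split x := DFunLike.congr_fun
    (f := (tensorMap (Hom.id P) (syzygyι Q)).toFun.comp
      (tensorBaseMap P (syzygyRetraction Q) (syzygyRetraction_smul Q)).toFun +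
      (tensorBaseMap P (unitSection Q) (unitSection_smul Q)).toFun.comp
        (tensorMap (Hom.id P) (rightAct Q)).toFun)
    (g := AddMonoidHom.id _)
    (tensor_hom_ext fun p q => (map_add (tmulB P _ p) _ _).symm.trans
      (congrArg (tmulB P _ p) (syzygy_split Q q))) x

end SyzygyLeft

/-! ### Even equivariant sections -/

section EvenPart

variable {X : Type v} {Y : Type w} [AddCommGroup X] [AddCommGroup Y]
  (gX : ZMod 2 → AddSubgroup X) (gY : ZMod 2 → AddSubgroup Y) [DirectSum.Decomposition gX]
  [DirectSum.Decomposition gY]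

/-- The even part of an additive map between graded groups. -/
def evenPart (φ : X →+ Y) : X →+ Y := ∑ k, (comp gY k).comp (φ.comp (comp gX k))

theorem evenPart_of_mem (φ : X →+ Y) {k : ZMod 2} {x : X} (hx : x ∈ gX k) :
    evenPart gX gY φ x = comp gY k (φ x) := by
  rw [evenPart, AddMonoidHom.finsetSum_apply, Finset.sum_eq_single k]
  · change comp gY k (φ (comp gX k x)) = _
    rw [comp_same gX hx]
  · intro j _ hj
    change comp gY j (φ (comp gX j x)) = 0
    rw [comp_ne gX hx hj.symm, map_zero, map_zero]
  · simp

theorem evenPart_mem (φ : X →+ Y) {k : ZMod 2} {x : X} (hx : x ∈ gX k) :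
    evenPart gX gY φ x ∈ gY k := by
  rw [evenPart_of_mem gX gY φ hx]
  exact comp_mem gY k _

/-- An operator of degree `j` shifts homogeneous components by `j`, so commuting with a pair of such
operators survives the passage to even parts. Applied to multiplication by a homogeneous scalar,
this preserves linearity. -/
theorem evenPart_comm (φ : X →+ Y) (α : X →+ X) (β : Y →+ Y) (j : ZMod 2)
    (hα : ∀ i, ∀ x ∈ gX i, α x ∈ gX (i + j)) (hβ : ∀ i, ∀ y ∈ gY i, β y ∈ gY (i + j))
    (h : ∀ x, φ (α x) = β (φ x)) (x : X) :
    evenPart gX gY φ (α x) = β (evenPart gX gY φ x) := by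
  refine DFunLike.congr_fun (f := (evenPart gX gY φ).comp α) (g := β.comp (evenPart gX gY φ))
    (hom_ext_homogeneous gX fun i x hx => ?_) x
  change evenPart gX gY φ (α x) = β (evenPart gX gY φ x)
  rw [evenPart_of_mem gX gY φ hx, evenPart_of_mem gX gY φ (hα i x hx), h,
    comp_map gY gY β j hβ]

theorem evenPart_section (φ : X →+ Y) (ψ : Y →+ X) (hψ : ∀ {i y}, y ∈ gY i → ψ y ∈ gX i)
    (h : ∀ x, ψ (φ x) = x) (x : X) : ψ (evenPart gX gY φ x) = x := by
  refine DFunLike.congr_fun (f := ψ.comp (evenPart gX gY φ)) (g := AddMonoidHom.id X)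
    (hom_ext_homogeneous gX fun i x hx => ?_) x
  change ψ (evenPart gX gY φ x) = x
  rw [evenPart_of_mem gX gY φ hx, ← comp_map_even gY gX ψ hψ, h, comp_same gX hx]

end EvenPart

/-! ### Even sections from projectivity -/

section Sections

variable {A : SuperAlgebra.{u, s} R} {B : SuperAlgebra.{u, t} R}
  {N P : SuperBimodule.{u, v, s, t} A B}

/-- An even surjection onto a bimodule that is projective on the right has an even right linear
section. -/
theorem exists_right_section (f : Hom (SuperAlgebraHom.id A) (SuperAlgebraHom.id B) N P)
    (hf : Function.Surjective f.toFun) (hP : Module.Projective B.carrierᵐᵒᵖ P.carrier) :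
    ∃ t : P.carrier →+ N.carrier, (∀ {i p}, p ∈ P.gr i → t p ∈ N.gr i) ∧
      (∀ (b : B.carrier) p, t (MulOpposite.op b • p) = MulOpposite.op b • t p) ∧
      ∀ p, f.toFun (t p) = p := by
  let F : N.carrier →ₗ[B.carrierᵐᵒᵖ] P.carrier :=
    { f.toFun with map_smul' := fun b x => f.map_op_smul b.unop x }
  -- Projectivity is ungraded, so this section may mix parities. Its even part is still a section,
  -- and its linearity is checked on homogeneous scalars.
  obtain ⟨t, ht⟩ := Module.projective_lifting_property F LinearMap.id hf
  have ht' : ∀ p, f.toFun (t.toAddMonoidHom p) = p := fun p => DFunLike.congr_fun ht p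
  refine ⟨evenPart P.gr N.gr t.toAddMonoidHom, fun hp => evenPart_mem _ _ _ hp, fun b p => ?_,
    evenPart_section _ _ _ f.toFun f.map_mem ht'⟩
  induction b using DirectSum.Decomposition.inductionOn B.gr with
  | zero => simp
  | add b b' hb hb' => simp only [MulOpposite.op_add, add_smul, map_add, hb, hb']
  | @homogeneous j b =>
  exact evenPart_comm P.gr N.gr t.toAddMonoidHom
    (DistribSMul.toAddMonoidHom _ (MulOpposite.op (b : B.carrier)))
    (DistribSMul.toAddMonoidHom _ (MulOpposite.op (b : B.carrier))) j
    (fun i x hx => P.op_smul_mem hx b.2) (fun i x hx => N.op_smul_mem hx b.2)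
    (fun x => t.map_smul _ x) p

/-- An even surjection onto a bimodule that is projective on the left has an even left linear
section. -/
theorem exists_left_section (f : Hom (SuperAlgebraHom.id A) (SuperAlgebraHom.id B) N P)
    (hf : Function.Surjective f.toFun) (hP : Module.Projective A.carrier P.carrier) :
    ∃ t : P.carrier →+ N.carrier, (∀ {i p}, p ∈ P.gr i → t p ∈ N.gr i) ∧
      (∀ (a : A.carrier) p, t (a • p) = a • t p) ∧ ∀ p, f.toFun (t p) = p := by
  let F : N.carrier →ₗ[A.carrier] P.carrier :=
    { f.toFun with map_smul' := fun a x => f.map_smul a x }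
  obtain ⟨t, ht⟩ := Module.projective_lifting_property F LinearMap.id hf
  have ht' : ∀ p, f.toFun (t.toAddMonoidHom p) = p := fun p => DFunLike.congr_fun ht p
  refine ⟨evenPart P.gr N.gr t.toAddMonoidHom, fun hp => evenPart_mem _ _ _ hp, fun a p => ?_,
    evenPart_section _ _ _ f.toFun f.map_mem ht'⟩
  induction a using DirectSum.Decomposition.inductionOn A.gr with
  | zero => simp
  | add a a' ha ha' => simp only [add_smul, map_add, ha, ha']
  | @homogeneous j a =>
  exact evenPart_comm P.gr N.gr t.toAddMonoidHom
    (DistribSMul.toAddMonoidHom _ (a : A.carrier))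
    (DistribSMul.toAddMonoidHom _ (a : A.carrier)) j
    (fun i x hx => by rw [add_comm]; exact P.smul_mem a.2 hx)
    (fun i x hx => by rw [add_comm]; exact N.smul_mem a.2 hx)
    (fun x => t.map_smul _ x) p

end Sections

/-! ### Tensoring the syzygy sequence from the right -/

section TensorRight

variable {A B : SuperAlgebra.{u, v} R} (P : SuperBimodule.{u, v, v, v} A B)

/-- The induced left module `A ⊗_R P`. -/
def leftInduced : SuperBimodule.{u, v, v, v} A B :=
  tensor (regular A).restrictRight P.restrictLeft

/-- The element `a ⊗ p` of `A ⊗_R P`. -/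
def tmulLeft : A.carrier →+ P.carrier →+ (leftInduced P).carrier :=
  tmulB (regular A).restrictRight P.restrictLeft

theorem leftInduced_hom_ext {X : Type w} [AddCommGroup X] {φ ψ : (leftInduced P).carrier →+ X}
    (h : ∀ a p, φ (tmulLeft P a p) = ψ (tmulLeft P a p)) : φ = ψ :=
  BalTensor.hom_ext h

theorem smul_tmulLeft (c a : A.carrier) (p : P.carrier) :
    c • tmulLeft P a p = tmulLeft P (c * a) p := rfl

/-- Balanced biadditive maps on `A × P` factor through `A ⊗_R P`. -/
def liftLeft {X : Type w} [AddCommGroup X] (f : A.carrier →+ P.carrier →+ X)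
    (h : ∀ a r p, f (a * A.algMap r) p = f a (A.algMap r • p)) : (leftInduced P).carrier →+ X :=
  liftB (regular A).restrictRight P.restrictLeft f h

/-- The map `A ⊗_R P → P`, `a ⊗ p ↦ a p`. -/
def leftAct : Hom (SuperAlgebraHom.id A) (SuperAlgebraHom.id B) (leftInduced P) P :=
  homOfTensor (liftLeft P (smulAddHom A.carrier P.carrier) fun a _ p => mul_smul a _ p)
    (fun ha hp => P.smul_mem ha hp)
    (fun (c : A.carrier) (a : A.carrier) (p : P.carrier) => mul_smul c a p)
    (fun b (a : A.carrier) (p : P.carrier) => smul_comm a (MulOpposite.op b) p)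

/-- A section of `A ⊗_R P → P` that is linear for the left action of `A` and for the right action
of the ground superring. -/
structure LeftSection extends BaseHom P (leftInduced P) where
  map_smul : ∀ (a : A.carrier) p, toFun (a • p) = a • toFun p
  act : ∀ p, (leftAct P).toFun (toFun p) = p

/-- `p ↦ 1 ⊗ p` shows that the action is surjective. The section must be even: only then does left
`A`-linearity give right linearity over `R` through the Koszul rule. -/
theorem nonempty_leftSection (hP : Module.Projective A.carrier P.carrier) :
    Nonempty (LeftSection P) := by
  obtain ⟨s, hs, hs', hs''⟩ := exists_left_section (leftAct P)
    (fun p => ⟨tmulLeft P 1 p, one_smul _ p⟩) hP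
  exact ⟨{ BaseHom.ofLeft s hs fun r m => hs' _ m with map_smul := hs', act := hs'' }⟩

variable {P} {N N' N'' : SuperBimodule.{u, v, v, v} B A}

/-- `(x, a ⊗ p) ↦ φ (x a) ⊗ p`. -/
def twistAux (P : SuperBimodule.{u, v, v, v} A B) (φ : BaseHom N N') :
    N.carrier →+ (leftInduced P).carrier →+ (tensor N' P).carrier :=
  AddMonoidHom.mk' (fun x =>
    liftLeft P ((tmulB N' P).comp (φ.toFun.comp (rightActAux N x))) fun a r p => by
      change tmulB N' P (φ.toFun (MulOpposite.op (a * A.algMap r) • x)) p =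
        tmulB N' P (φ.toFun (MulOpposite.op a • x)) (A.algMap r • p)
      rw [MulOpposite.op_mul, mul_smul, φ.map_base, tmulB_balanced])
    fun x y => leftInduced_hom_ext P fun a p => by
      change tmulB N' P (φ.toFun (MulOpposite.op a • (x + y))) p =
        tmulB N' P (φ.toFun (MulOpposite.op a • x)) p +
          tmulB N' P (φ.toFun (MulOpposite.op a • y)) p
      rw [smul_add, map_add, map_add]
      rfl

theorem twistAux_tmulLeft (φ : BaseHom N N') (x : N.carrier) (a : A.carrier) (p : P.carrier) :
    twistAux P φ x (tmulLeft P a p) = tmulB N' P (φ.toFun (MulOpposite.op a • x)) p := rfl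

/-- Both sides send `c ⊗ p` to `φ (x a c) ⊗ p`. No `A`-linearity of `φ` enters, because the elements
of `A` are multiplied into `x` before `φ` is applied. -/
theorem twistAux_balanced (φ : BaseHom N N') (x : N.carrier) (a : A.carrier)
    (y : (leftInduced P).carrier) :
    twistAux P φ (MulOpposite.op a • x) y = twistAux P φ x (a • y) := by
  refine DFunLike.congr_fun (f := twistAux P φ (MulOpposite.op a • x))
    (g := (twistAux P φ x).comp (DistribSMul.toAddMonoidHom _ a))
    (leftInduced_hom_ext P fun c p => ?_) y
  change twistAux P φ (MulOpposite.op a • x) (tmulLeft P c p) =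
    twistAux P φ x (a • tmulLeft P c p)
  rw [smul_tmulLeft, twistAux_tmulLeft, twistAux_tmulLeft, MulOpposite.op_mul, mul_smul]

theorem twistAux_op_smul (φ : BaseHom N N') (x : N.carrier) (b : B.carrier)
    (y : (leftInduced P).carrier) :
    twistAux P φ x (MulOpposite.op b • y) = MulOpposite.op b • twistAux P φ x y :=
  DFunLike.congr_fun (f := (twistAux P φ x).comp (DistribSMul.toAddMonoidHom _ (MulOpposite.op b)))
    (g := (DistribSMul.toAddMonoidHom _ (MulOpposite.op b)).comp (twistAux P φ x))
    (leftInduced_hom_ext P fun _ _ => rfl) y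

/-- The map `N ⊗_A P → N' ⊗_A P`, `x ⊗ p ↦ ∑ φ (x a_i) ⊗ p_i` where `s p = ∑ a_i ⊗ p_i`, for `φ`
linear over the ground superring only. -/
def twist (s : LeftSection P) (φ : BaseHom N N') : BaseHom (tensor N P) (tensor N' P) :=
  let ψ : (tensor N P).carrier →+ (tensor N' P).carrier :=
    liftB N P ((twistAux P φ).compl₂ s.toFun) fun x a p => by
      change twistAux P φ _ (s.toFun p) = twistAux P φ x (s.toFun _)
      rw [s.map_smul, twistAux_balanced]
  { toFun := ψ
    map_base := fun r x => DFunLike.congr_fun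
      (f := ψ.comp (DistribSMul.toAddMonoidHom _ (MulOpposite.op (B.algMap r))))
      (g := (DistribSMul.toAddMonoidHom _ (MulOpposite.op (B.algMap r))).comp ψ)
      (tensor_hom_ext fun p q => by
        change twistAux P φ p (s.toFun (MulOpposite.op (B.algMap r) • q)) =
          MulOpposite.op (B.algMap r) • twistAux P φ p (s.toFun q)
        rw [s.map_base, twistAux_op_smul]) x }

/-- Here `∑ x a_i ⊗ p_i = x ⊗ ∑ a_i p_i`, and the last sum is `p` since `s` is a section. -/
theorem twist_id (s : LeftSection P) (φ : BaseHom N N) (hφ : ∀ x, φ.toFun x = x)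
    (x : (tensor N P).carrier) : (twist s φ).toFun x = x := by
  refine DFunLike.congr_fun (g := AddMonoidHom.id _) (tensor_hom_ext fun n p => ?_) x
  change twistAux P φ n (s.toFun p) = tmulB N P n p
  conv_rhs => rw [← s.act p]
  refine DFunLike.congr_fun (g := (tmulB N P n).comp (leftAct P).toFun)
    (leftInduced_hom_ext P fun a p => ?_) (s.toFun p)
  change tmulB N P (φ.toFun (MulOpposite.op a • n)) p = tmulB N P n (a • p)
  rw [hφ, tmulB_balanced]

/-- Composing two twists would apply `s` twice, so compatibility with composition is proved only
when one factor is a bimodule morphism, here the inner one. Every composite in `splittingRight` has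
such a factor. -/
theorem twist_tensorMap (s : LeftSection P)
    (h : Hom (SuperAlgebraHom.id B) (SuperAlgebraHom.id A) N N') (φ : BaseHom N' N'')
    (ψ : BaseHom N N'') (hψ : ∀ x, φ.toFun (h.toFun x) = ψ.toFun x) (x : (tensor N P).carrier) :
    (twist s φ).toFun ((tensorMap h (Hom.id P)).toFun x) = (twist s ψ).toFun x := by
  refine DFunLike.congr_fun (f := (twist s φ).toFun.comp (tensorMap h (Hom.id P)).toFun)
    (tensor_hom_ext fun n p => ?_) x
  change twistAux P φ (h.toFun n) (s.toFun p) = twistAux P ψ n (s.toFun p)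
  refine DFunLike.congr_fun (leftInduced_hom_ext P fun a p => ?_) (s.toFun p)
  rw [twistAux_tmulLeft, twistAux_tmulLeft, ← hψ, h.map_op_smul]
  rfl

theorem tensorMap_twist (s : LeftSection P) (φ : BaseHom N N')
    (h : Hom (SuperAlgebraHom.id B) (SuperAlgebraHom.id A) N' N'')
    (ψ : BaseHom N N'') (hψ : ∀ x, h.toFun (φ.toFun x) = ψ.toFun x) (x : (tensor N P).carrier) :
    (tensorMap h (Hom.id P)).toFun ((twist s φ).toFun x) = (twist s ψ).toFun x := by
  refine DFunLike.congr_fun (f := (tensorMap h (Hom.id P)).toFun.comp (twist s φ).toFun)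
    (tensor_hom_ext fun n p => ?_) x
  refine DFunLike.congr_fun (f := (tensorMap h (Hom.id P)).toFun.comp (twistAux P φ n))
    (g := twistAux P ψ n) (leftInduced_hom_ext P fun a p => ?_) (s.toFun p)
  exact congrArg (fun y => tmulB N'' P y p) (hψ _)

theorem twist_add (s : LeftSection P) (φ ψ χ : BaseHom N N')
    (h : ∀ x, φ.toFun x + ψ.toFun x = χ.toFun x) (x : (tensor N P).carrier) :
    (twist s φ).toFun x + (twist s ψ).toFun x = (twist s χ).toFun x := by
  refine DFunLike.congr_fun (f := (twist s φ).toFun + (twist s ψ).toFun)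
    (tensor_hom_ext fun n p => ?_) x
  refine DFunLike.congr_fun (f := twistAux P φ n + twistAux P ψ n)
    (g := twistAux P χ n) (leftInduced_hom_ext P fun a p => ?_) (s.toFun p)
  change tmulB N' P (φ.toFun (MulOpposite.op a • n)) p +
    tmulB N' P (ψ.toFun (MulOpposite.op a • n)) p = tmulB N' P (χ.toFun (MulOpposite.op a • n)) p
  rw [← h, map_add]
  rfl

/-- The composition of a map linear over the ground superring with a morphism of bimodules. -/
def BaseHom.comp (φ : BaseHom N' N'') (ψ : BaseHom N N') : BaseHom N N'' where
  toFun := φ.toFun.comp ψ.toFun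
  map_base r x := (congrArg φ.toFun (ψ.map_base r x)).trans (φ.map_base r _)

variable (Q : SuperBimodule.{u, v, v, v} B A)

/-- The splitting of `K ⊗_A P → (Q ⊗_R A) ⊗_A P → Q ⊗_A P`. -/
def splittingRight (s : LeftSection P) : BaseSplitting (tensorMap (syzygyι Q) (Hom.id P))
    (tensorMap (rightAct Q) (Hom.id P)) where
  r := twist s (syzygyRetraction Q)
  s := twist s (unitSection Q)
  r_i x := by
    rw [twist_tensorMap s (syzygyι Q) (syzygyRetraction Q) (Hom.id _).toBaseHom
      (syzygyRetraction_ι Q), twist_id s _ fun _ => rfl]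
  g_s x := by
    rw [tensorMap_twist s (unitSection Q) (rightAct Q) (Hom.id _).toBaseHom
      (rightAct_unitSection Q), twist_id s _ fun _ => rfl]
  split x := by
    rw [tensorMap_twist s (syzygyRetraction Q) (syzygyι Q)
        ((syzygyι Q).toBaseHom.comp (syzygyRetraction Q)) fun _ => rfl,
      twist_tensorMap s (rightAct Q) (unitSection Q)
        ((unitSection Q).comp (rightAct Q).toBaseHom) fun _ => rfl,
      twist_add s _ _ (Hom.id _).toBaseHom (syzygy_split Q), twist_id s _ fun _ => rfl]

end TensorRight

/-! ### Vanishing for induced bimodules -/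

section Induced

/-! ### Reassociating `P ⊗_B (Q ⊗_R A)` -/

section Assoc

variable {S : SuperAlgebra.{u, s} R} {B : SuperAlgebra.{u, t} R} {A : SuperAlgebra.{u, v} R}
  (P : SuperBimodule.{u, v, s, t} S B) (Q : SuperBimodule.{u, v, t, v} B A)

/-- `p ⊗ (q ⊗ a) ↦ (p ⊗ q) ⊗ a`. -/
def assocInv : Hom (SuperAlgebraHom.id S) (SuperAlgebraHom.id A)
    (tensor P (tensorAlg Q)) (tensorAlg (tensor P Q)) :=
  let φ (p : P.carrier) : (tensorAlg Q).carrier →+ (tensorAlg (tensor P Q)).carrier :=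
    (tensorAlgBaseMap (M := Q) (M' := tensor P Q) ⟨tmulB P Q p, fun _ _ => rfl⟩).toFun
  let ψ : P.carrier →+ (tensorAlg Q).carrier →+ (tensorAlg (tensor P Q)).carrier :=
    AddMonoidHom.mk' φ fun p p' => tensorAlg_hom_ext Q fun _ _ q _ a _ => by
      change tmulAlg (tensor P Q) (tmulB P Q (p + p') q) a =
        tmulAlg (tensor P Q) (tmulB P Q p q) a + tmulAlg (tensor P Q) (tmulB P Q p' q) a
      rw [map_add, AddMonoidHom.add_apply, map_add]
      rfl
  homOfTensor (liftB P (tensorAlg Q) ψ fun p b x => DFunLike.congr_fun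
      (f := φ (MulOpposite.op b • p)) (g := (φ p).comp (DistribSMul.toAddMonoidHom _ b))
      (tensorAlg_hom_ext Q fun _ _ q _ a _ =>
        congrArg (fun y => tmulAlg (tensor P Q) y a) (tmulB_balanced P Q p b q)) x)
    (fun {i j p x} hp hx => by
      have h : (tensorAlg Q).gr j ≤ ((tensorAlg (tensor P Q)).gr (i + j)).comap (φ p) := by
        refine (AddSubgroup.closure_le _).2 ?_
        rintro _ ⟨k, l, rfl, q, hq, a, ha, rfl⟩
        have := tmulAlg_mem (tensor P Q) (tmulB_mem hp hq) ha
        rw [add_assoc] at this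
        exact this
      exact h hx)
    (fun c p x => DFunLike.congr_fun (f := φ (c • p))
      (g := (DistribSMul.toAddMonoidHom _ c).comp (φ p))
      (tensorAlg_hom_ext Q fun _ _ _ _ _ _ => rfl) x)
    (fun c p x => DFunLike.congr_fun
      (f := (φ p).comp (DistribSMul.toAddMonoidHom _ (MulOpposite.op c)))
      (g := (DistribSMul.toAddMonoidHom _ (MulOpposite.op c)).comp (φ p))
      (tensorAlg_hom_ext Q fun _ _ _ _ _ _ => rfl) x)

/-- `(p ⊗ q) ⊗ a ↦ p ⊗ (q ⊗ a)`. -/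
def assoc : Hom (SuperAlgebraHom.id S) (SuperAlgebraHom.id A)
    (tensorAlg (tensor P Q)) (tensor P (tensorAlg Q)) :=
  let φ (a : A.carrier) : (tensor P Q).carrier →+ (tensor P (tensorAlg Q)).carrier :=
    liftB P Q ((tmulB P (tensorAlg Q)).compl₂ ((tmulAlg Q).flip a)) fun p b q =>
      tmulB_balanced P (tensorAlg Q) p b (tmulAlg Q q a)
  let ψ : A.carrier →+ (tensor P Q).carrier →+ (tensor P (tensorAlg Q)).carrier :=
    AddMonoidHom.mk' φ fun a a' => tensor_hom_ext fun p q => by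
      change tmulB P (tensorAlg Q) p (tmulAlg Q q (a + a')) =
        tmulB P (tensorAlg Q) p (tmulAlg Q q a) + tmulB P (tensorAlg Q) p (tmulAlg Q q a')
      rw [map_add, map_add]
  homOfTensor (liftAlg (tensor P Q) ψ.flip fun x r a => DFunLike.congr_fun
      (f := (φ a).comp (DistribSMul.toAddMonoidHom _ (MulOpposite.op (A.algMap r))))
      (g := φ (A.algMap r * a))
      (tensor_hom_ext fun p q =>
        congrArg (tmulB P (tensorAlg Q) p) (tmulAlg_balanced Q q r a)) x)
    (fun {i j x a} hx ha => by
      have h : (tensor P Q).gr i ≤ ((tensor P (tensorAlg Q)).gr (i + j)).comap (φ a) := by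
        refine (AddSubgroup.closure_le _).2 ?_
        rintro _ ⟨k, l, rfl, p, hp, q, hq, rfl⟩
        have := tmulB_mem hp (tmulAlg_mem Q hq ha)
        rw [← add_assoc] at this
        exact this
      exact h hx)
    (fun c x a => DFunLike.congr_fun
      (f := (φ a).comp (DistribSMul.toAddMonoidHom _ c))
      (g := (DistribSMul.toAddMonoidHom _ c).comp (φ a))
      (tensor_hom_ext fun _ _ => rfl) x)
    (fun c x (a : A.carrier) => DFunLike.congr_fun (f := φ (a * c))
      (g := (DistribSMul.toAddMonoidHom _ (MulOpposite.op c)).comp (φ a))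
      (tensor_hom_ext fun _ _ => rfl) x)

theorem assoc_assocInv (x : (tensor P (tensorAlg Q)).carrier) :
    (assoc P Q).toFun ((assocInv P Q).toFun x) = x :=
  DFunLike.congr_fun (f := (assoc P Q).toFun.comp (assocInv P Q).toFun) (g := AddMonoidHom.id _)
    (tensor_hom_ext fun p x => DFunLike.congr_fun
      (f := ((assoc P Q).toFun.comp (assocInv P Q).toFun).comp (tmulB P (tensorAlg Q) p))
      (g := tmulB P (tensorAlg Q) p)
      (tensorAlg_hom_ext Q fun _ _ _ _ _ _ => rfl) x) x

/-- This transports a section of the action on the right-hand factor to a section of the action on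
the whole tensor product. -/
theorem rightAct_assocInv (x : (tensor P (tensorAlg Q)).carrier) :
    (rightAct (tensor P Q)).toFun ((assocInv P Q).toFun x) =
      (tensorMap (Hom.id P) (rightAct Q)).toFun x :=
  DFunLike.congr_fun (f := (rightAct (tensor P Q)).toFun.comp (assocInv P Q).toFun)
    (tensor_hom_ext fun p x => DFunLike.congr_fun
      (f := ((rightAct (tensor P Q)).toFun.comp (assocInv P Q).toFun).comp
        (tmulB P (tensorAlg Q) p))
      (g := (tensorMap (Hom.id P) (rightAct Q)).toFun.comp (tmulB P (tensorAlg Q) p))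
      (tensorAlg_hom_ext Q fun _ _ _ _ _ _ => rfl) x) x

end Assoc

variable {A B : SuperAlgebra.{u, v} R} (P : SuperBimodule.{u, v, v, v} A B)
  (Q : SuperBimodule.{u, v, v, v} B A)

theorem HH_tensor_tensorAlg_eq_zero (n : ℕ) (ξ : HH (tensor P (tensorAlg Q)) (n + 1)) : ξ = 0 :=
  HH_eq_zero_of_retract (assocInv P Q) (assoc P Q) (assoc_assocInv P Q) (n + 1)
    (HH_tensorAlg_eq_zero _ n) ξ

/-- The tensor product `Q ⊗_R P`. -/
def baseTensor : SuperBimodule.{u, v, v, v} B B := tensor Q.restrictRight P.restrictLeft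

/-- The element `q ⊗ p` of `Q ⊗_R P`. -/
def tmulBase : Q.carrier →+ P.carrier →+ (baseTensor P Q).carrier :=
  tmulB Q.restrictRight P.restrictLeft

theorem tmulBase_balanced (q : Q.carrier) (r : R.carrier) (p : P.carrier) :
    tmulBase P Q (MulOpposite.op (A.algMap r) • q) p = tmulBase P Q q (A.algMap r • p) :=
  tmulB_balanced Q.restrictRight P.restrictLeft q r p

/-- `(q ⊗ a) ⊗ p ↦ q ⊗ a p`. -/
def absorb : Hom (SuperAlgebraHom.id B) (SuperAlgebraHom.id B)
    (tensor (tensorAlg Q) P) (baseTensor P Q) :=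
  let ψ : (tensorAlg Q).carrier →+ P.carrier →+ (baseTensor P Q).carrier :=
    liftAlg Q (AddMonoidHom.mk' (fun q =>
        (AddMonoidHom.compHom (tmulBase P Q q)).comp (smulAddHom A.carrier P.carrier))
        fun q q' => by
          ext a p
          change tmulBase P Q (q + q') (a • p) =
            tmulBase P Q q (a • p) + tmulBase P Q q' (a • p)
          rw [map_add]
          rfl)
      fun q r a => by
        ext p
        change tmulBase P Q _ (a • p) = tmulBase P Q q ((A.algMap r * a) • p)
        rw [tmulBase_balanced, mul_smul]
  homOfTensor (liftB (tensorAlg Q) P ψ fun x a p => DFunLike.congr_fun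
      (f := (ψ.flip p).comp (DistribSMul.toAddMonoidHom _ (MulOpposite.op a)))
      (g := ψ.flip (a • p))
      (tensorAlg_hom_ext Q fun _ _ q _ c _ => congrArg (tmulBase P Q q) (mul_smul c a p)) x)
    (fun {i j x p} hx hp => by
      have h : (tensorAlg Q).gr i ≤ ((baseTensor P Q).gr (i + j)).comap (ψ.flip p) := by
        refine (AddSubgroup.closure_le _).2 ?_
        rintro _ ⟨k, l, rfl, q, hq, a, ha, rfl⟩
        have := tmulB_mem (P := Q.restrictRight) (Q := P.restrictLeft) hq (P.smul_mem ha hp)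
        rw [← add_assoc] at this
        exact this
      exact h hx)
    (fun b x p => DFunLike.congr_fun
      (f := (ψ.flip p).comp (DistribSMul.toAddMonoidHom _ b))
      (g := (DistribSMul.toAddMonoidHom _ b).comp (ψ.flip p))
      (tensorAlg_hom_ext Q fun _ _ _ _ _ _ => rfl) x)
    (fun b x p => DFunLike.congr_fun
      (f := ψ.flip (MulOpposite.op b • p))
      (g := (DistribSMul.toAddMonoidHom _ (MulOpposite.op b)).comp (ψ.flip p))
      (tensorAlg_hom_ext Q fun _ _ q _ a _ =>
        congrArg (tmulBase P Q q) (smul_comm a (MulOpposite.op b) p)) x)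

/-- `q ⊗ p ↦ (q ⊗ 1) ⊗ p`. -/
def expand : Hom (SuperAlgebraHom.id B) (SuperAlgebraHom.id B)
    (baseTensor P Q) (tensor (tensorAlg Q) P) :=
  homOfTensor (liftB Q.restrictRight P.restrictLeft
      ((tmulB (tensorAlg Q) P).comp (unitSection Q).toFun)
      fun (q : Q.carrier) (r : R.carrier) (p : P.carrier) => by
        change tmulB (tensorAlg Q) P ((unitSection Q).toFun (MulOpposite.op (A.algMap r) • q)) p =
          tmulB (tensorAlg Q) P ((unitSection Q).toFun q) (A.algMap r • p)
        rw [(unitSection Q).map_base, tmulB_balanced])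
    (fun {i j q p} hq hp => by
      have h := tmulAlg_mem Q (m := q) (a := 1) hq SetLike.GradedOne.one_mem
      rw [add_zero] at h
      exact tmulB_mem h hp)
    (fun _ _ _ => rfl) (fun _ _ _ => rfl)

theorem expand_absorb (x : (tensor (tensorAlg Q) P).carrier) :
    (expand P Q).toFun ((absorb P Q).toFun x) = x :=
  DFunLike.congr_fun (f := (expand P Q).toFun.comp (absorb P Q).toFun) (g := AddMonoidHom.id _)
    (tensor_hom_ext fun x p => DFunLike.congr_fun
      (f := ((expand P Q).toFun.comp (absorb P Q).toFun).comp ((tmulB (tensorAlg Q) P).flip p))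
      (g := (tmulB (tensorAlg Q) P).flip p)
      (tensorAlg_hom_ext Q fun _ _ q _ a _ => by
        change tmulB (tensorAlg Q) P (tmulAlg Q q 1) (a • p) =
          tmulB (tensorAlg Q) P (tmulAlg Q q a) p
        rw [← tmulB_balanced, op_smul_tmulAlg, one_mul]) x) x

theorem exists_section_rightAct {S : SuperAlgebra.{u, s} R} (N : SuperBimodule.{u, v, s, v} S B)
    (hN : Module.Projective B.carrierᵐᵒᵖ N.carrier) :
    ∃ t : N.carrier →+ (tensorAlg N).carrier, (∀ {i p}, p ∈ N.gr i → t p ∈ (tensorAlg N).gr i) ∧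
      (∀ (b : B.carrier) p, t (MulOpposite.op b • p) = MulOpposite.op b • t p) ∧
      ∀ p, (rightAct N).toFun (t p) = p :=
  exists_right_section (rightAct N) (fun p => ⟨tmulAlg N p 1, one_smul _ p⟩) hN

/-- For homogeneous elements the left action of `R` is the right one up to a sign, which an even map
preserves. -/
theorem algMap_smul_of_right {S S' : SuperAlgebra.{u, s} R} {N : SuperBimodule.{u, v, s, v} S B}
    {N' : SuperBimodule.{u, v, s, v} S' B} (φ : N.carrier →+ N'.carrier)
    (hgr : ∀ {i p}, p ∈ N.gr i → φ p ∈ N'.gr i)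
    (h : ∀ (b : B.carrier) p, φ (MulOpposite.op b • p) = MulOpposite.op b • φ p) (r : R.carrier)
    (p : N.carrier) : φ (S.algMap r • p) = S'.algMap r • φ p := by
  induction p using DirectSum.Decomposition.inductionOn N.gr with
  | zero => simp
  | add x y hx hy => simp only [smul_add, map_add, hx, hy]
  | @homogeneous i p =>
  induction r using DirectSum.Decomposition.inductionOn R.gr with
  | zero => simp
  | add x y hx hy => simp only [map_add, add_smul, hx, hy]
  | @homogeneous j r =>
  rw [N.base_comm r.2 p.2, N'.base_comm r.2 (hgr p.2), map_units, h]

/-- Right projectivity makes `P` a retract of `P ⊗_R B` by even maps linear over `B` and `R`.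
Tensoring with `Q` over `R` makes `Q ⊗_R P` a retract of an induced bimodule, which is acyclic in
positive degrees. -/
theorem HH_baseTensor_eq_zero (hP : Module.Projective B.carrierᵐᵒᵖ P.carrier) (n : ℕ)
    (ξ : HH (baseTensor P Q) (n + 1)) : ξ = 0 := by
  obtain ⟨t, ht, ht', ht''⟩ := exists_section_rightAct P.restrictLeft hP
  let τ : Hom (SuperAlgebraHom.id (base R)) (SuperAlgebraHom.id B)
      P.restrictLeft (tensorAlg P.restrictLeft) :=
    { toFun := t
      map_mem := ht
      map_smul := algMap_smul_of_right t ht ht'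
      map_op_smul := ht' }
  let ι : Hom (SuperAlgebraHom.id B) (SuperAlgebraHom.id B)
      (baseTensor P Q) (tensorAlg (baseTensor P Q)) :=
    { toFun := (assocInv Q.restrictRight P.restrictLeft).toFun.comp
        (tensorMap (Hom.id Q.restrictRight) τ).toFun
      map_mem := fun hx => (assocInv Q.restrictRight P.restrictLeft).map_mem
        ((tensorMap (Hom.id Q.restrictRight) τ).map_mem hx)
      map_smul := fun b x => (congrArg (assocInv Q.restrictRight P.restrictLeft).toFun
        ((tensorMap (Hom.id Q.restrictRight) τ).map_smul b x)).trans
          ((assocInv Q.restrictRight P.restrictLeft).map_smul b _)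
      map_op_smul := fun b x => (congrArg (assocInv Q.restrictRight P.restrictLeft).toFun
        ((tensorMap (Hom.id Q.restrictRight) τ).map_op_smul b x)).trans
          ((assocInv Q.restrictRight P.restrictLeft).map_op_smul b _) }
  refine HH_eq_zero_of_retract ι (rightAct (baseTensor P Q)) (fun x => ?_) (n + 1)
    (HH_tensorAlg_eq_zero _ n) ξ
  -- After reassociation the action touches only the factor `P`, where `t` is a section of it.
  refine (rightAct_assocInv Q.restrictRight P.restrictLeft _).trans ?_
  exact DFunLike.congr_fun (f := (tensorMap (Hom.id Q.restrictRight)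
      (rightAct P.restrictLeft)).toFun.comp (tensorMap (Hom.id Q.restrictRight) τ).toFun)
    (g := AddMonoidHom.id _)
    (tensor_hom_ext fun q p => congrArg (tmulB Q.restrictRight P.restrictLeft q) (ht'' p)) x

theorem HH_tensorAlg_tensor_eq_zero (hP : Module.Projective B.carrierᵐᵒᵖ P.carrier) (n : ℕ)
    (ξ : HH (tensor (tensorAlg Q) P) (n + 1)) : ξ = 0 :=
  HH_eq_zero_of_retract (absorb P Q) (expand P Q) (expand_absorb P Q) (n + 1)
    (HH_baseTensor_eq_zero P Q hP n) ξ

end Induced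

/-! ### Homology in degree zero -/

section DegreeZero

variable {A : SuperAlgebra.{u, v} R} (M : SuperBimodule.{u, v, v, v} A A)

/-- The projection `M → H_0(A, M)`. -/
noncomputable def clsZero : M.carrier →+ HH M 0 :=
  AddMonoidHom.mk' (fun x => cls (M := M) (n := 0) x (isCycle_zero M x)) fun x y =>
    cls_add (M := M) (n := 0) (isCycle_zero M x) (isCycle_zero M y)

theorem clsZero_surjective : Function.Surjective (clsZero M) := fun ξ => by
  obtain ⟨x, _, rfl⟩ := exists_cls ξ
  exact ⟨x, rfl⟩

theorem clsZero_smul (r : R.carrier) (x : M.carrier) :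
    clsZero M (A.algMap r • x) = r • clsZero M x :=
  cls_smul (M := M) (n := 0) r (isCycle_zero M x)

theorem clsZero_mem {k : ZMod 2} {x : M.carrier} (hx : x ∈ M.gr k) : clsZero M x ∈ HHgr M 0 k :=
  cls_mem_HHgr (M := M) (n := 0) (isCycle_zero M x) hx

theorem diff_zero_tmulC {i j : ZMod 2} {m : M.carrier} {a : A.carrier} (hm : m ∈ M.gr i)
    (ha : a ∈ A.gr j) : diff M 0 (tmulC M 0 m a) =
      (MulOpposite.op a • m - (-1 : ℤˣ) ^ (j * i) • (a • m) : M.carrier) := by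
  refine (diff_eq M 0 _).trans ((congrArg₂ (fun y z : M.carrier => y + (-1 : ℤ) ^ (0 + 1) • z)
    (barDiff_zero M m a) (cyclicC_tmulC M 0 (x := m) hm ha)).trans ?_)
  change MulOpposite.op a • m + (-1 : ℤ) ^ (0 + 1) • ((-1 : ℤˣ) ^ (j * i) • (a • m)) = _
  rw [zero_add, pow_one, neg_one_smul, ← sub_eq_add_neg]

theorem clsZero_op_smul {i j : ZMod 2} {m : M.carrier} {a : A.carrier} (hm : m ∈ M.gr i)
    (ha : a ∈ A.gr j) :
    clsZero M (MulOpposite.op a • m) = (-1 : ℤˣ) ^ (j * i) • clsZero M (a • m) := by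
  rw [← sub_eq_zero, ← map_units, ← map_sub]
  exact (cls_eq_zero_iff (M := M) (n := 0) (isCycle_zero M _)).2 ⟨_, diff_zero_tmulC M hm ha⟩

/-- The boundaries in degree zero are generated by the supercommutators `m a - (-1)^{|a||m|} a m`,
on which a trace vanishes. -/
theorem clsZero_ker_le {X : Type w} [AddCommGroup X] (φ : M.carrier →+ X)
    (hφ : ∀ i j, ∀ m ∈ M.gr i, ∀ a ∈ A.gr j,
      φ (MulOpposite.op a • m) = (-1 : ℤˣ) ^ (j * i) • φ (a • m)) :
    (clsZero M).ker ≤ φ.ker := by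
  intro x hx
  obtain ⟨y, rfl⟩ := (cls_eq_zero_iff (M := M) (n := 0) (isCycle_zero M x)).1 hx
  refine DFunLike.congr_fun (f := AddMonoidHom.comp (N := M.carrier) φ (diff M 0)) (g := 0)
    (chains_hom_ext M 0 fun i j m hm a ha => ?_) y
  refine (congrArg φ (diff_zero_tmulC M hm ha)).trans ?_
  rw [map_sub, map_units, hφ i j m hm a ha, sub_self]
  rfl

/-- A trace on `M` induces a map on `H_0(A, M)`. -/
noncomputable def descZero {X : Type w} [AddCommGroup X] (φ : M.carrier →+ X)
    (hφ : ∀ i j, ∀ m ∈ M.gr i, ∀ a ∈ A.gr j,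
      φ (MulOpposite.op a • m) = (-1 : ℤˣ) ^ (j * i) • φ (a • m)) : HH M 0 →+ X :=
  (clsZero M).liftOfSurjective (clsZero_surjective M) ⟨φ, clsZero_ker_le M φ hφ⟩

theorem descZero_clsZero {X : Type w} [AddCommGroup X] (φ : M.carrier →+ X)
    (hφ : ∀ i j, ∀ m ∈ M.gr i, ∀ a ∈ A.gr j,
      φ (MulOpposite.op a • m) = (-1 : ℤˣ) ^ (j * i) • φ (a • m)) (x : M.carrier) :
    descZero M φ hφ (clsZero M x) = φ x :=
  AddMonoidHom.liftOfRightInverse_comp_apply _ _ _ ⟨φ, clsZero_ker_le M φ hφ⟩ x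

variable {M} {A' : SuperAlgebra.{u, v} R} {M' : SuperBimodule.{u, v, v, v} A' A'}
  {f : SuperAlgebraHom A A'}

theorem HHmap_clsZero (h : Hom f f M M') (x : M.carrier) :
    (HHmap h 0).hom (clsZero M x) = clsZero M' (h.toFun x) :=
  HHmap_cls (n := 0) h (isCycle_zero M x)

end DegreeZero

/-! ### The signed swap in degree zero -/

section Swap

variable {A B : SuperAlgebra.{u, v} R} (P : SuperBimodule.{u, v, v, v} A B)
  (Q : SuperBimodule.{u, v, v, v} B A)

theorem clsZero_tensor_hom_ext {X : Type w} [AddCommGroup X] {φ ψ : HH (tensor P Q) 0 →+ X}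
    (h : ∀ i j, ∀ p ∈ P.gr i, ∀ q ∈ Q.gr j, φ (clsZero (tensor P Q) (tmulB P Q p q)) =
      ψ (clsZero (tensor P Q) (tmulB P Q p q))) : φ = ψ := by
  refine (AddMonoidHom.cancel_right (clsZero_surjective (tensor P Q))).1
    (tensor_hom_ext fun p q => ?_)
  refine DFunLike.congr_fun
    (f := (φ.comp (clsZero (tensor P Q))).comp ((tmulB P Q).flip q))
    (g := (ψ.comp (clsZero (tensor P Q))).comp ((tmulB P Q).flip q))
    (hom_ext_homogeneous P.gr fun i p hp => ?_) p
  exact DFunLike.congr_fun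
    (f := (φ.comp (clsZero (tensor P Q))).comp (tmulB P Q p))
    (g := (ψ.comp (clsZero (tensor P Q))).comp (tmulB P Q p))
    (hom_ext_homogeneous Q.gr fun j q hq => h i j p hp q hq) q

/-- `(p, q) ↦ (-1)^{|p||q|} q ⊗ p`. -/
def swapAux : P.carrier →+ Q.carrier →+ (tensor Q P).carrier :=
  ∑ i, ∑ j, (((-1 : ℤˣ) ^ (i * j) : ℤˣ) : ℤ) •
    ((tmulB Q P).flip.comp (comp P.gr i)).compl₂ (comp Q.gr j)

theorem swapAux_homogeneous {i j : ZMod 2} {p : P.carrier} {q : Q.carrier} (hp : p ∈ P.gr i)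
    (hq : q ∈ Q.gr j) : swapAux P Q p q = (-1 : ℤˣ) ^ (i * j) • tmulB Q P q p := by
  have h : swapAux P Q p q = ∑ i, ∑ j, (-1 : ℤˣ) ^ (i * j) •
      tmulB Q P (comp Q.gr j q) (comp P.gr i p) := by
    simp only [swapAux, AddMonoidHom.finsetSum_apply]
    rfl
  rw [h, Finset.sum_eq_single i, Finset.sum_eq_single j, comp_same P.gr hp, comp_same Q.gr hq]
  · intro k _ hk
    rw [comp_ne Q.gr hq hk.symm, map_zero, AddMonoidHom.zero_apply, smul_zero]
  · simp
  · intro k _ hk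
    refine Finset.sum_eq_zero fun l _ => ?_
    rw [comp_ne P.gr hp hk.symm, map_zero, smul_zero]
  · simp

/-- The swap is well defined on `P ⊗_B Q` only after passing to `H_0`: `q ⊗ p b` and `b q ⊗ p`
differ by moving `b` cyclically, which is the trace relation over `B`. -/
theorem clsZero_swapAux_balanced (p : P.carrier) (b : B.carrier) (q : Q.carrier) :
    clsZero (tensor Q P) (swapAux P Q (MulOpposite.op b • p) q) =
      clsZero (tensor Q P) (swapAux P Q p (b • q)) := by
  induction p using DirectSum.Decomposition.inductionOn P.gr with
  | zero => simp
  | add x y hx hy => simp only [smul_add, map_add, AddMonoidHom.add_apply, hx, hy]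
  | @homogeneous i p =>
  induction q using DirectSum.Decomposition.inductionOn Q.gr with
  | zero => simp
  | add x y hx hy => simp only [smul_add, map_add, hx, hy]
  | @homogeneous k q =>
  induction b using DirectSum.Decomposition.inductionOn B.gr with
  | zero => simp
  | add x y hx hy =>
    simp only [MulOpposite.op_add, add_smul, map_add, AddMonoidHom.add_apply, hx, hy]
  | @homogeneous j b =>
  rw [swapAux_homogeneous P Q (P.op_smul_mem p.2 b.2) q.2,
    swapAux_homogeneous P Q p.2 (Q.smul_mem b.2 q.2), map_units, map_units,
    ← op_smul_tmulB, clsZero_op_smul _ (tmulB_mem q.2 p.2) b.2, smul_smul, ← uzpow_add,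
    smul_tmulB]
  have key : ∀ i j k : ZMod 2, (i + j) * k + j * (k + i) = i * (j + k) := by decide
  rw [key]

/-- The map `P ⊗_B Q → H_0(B, Q ⊗_A P)`, `p ⊗ q ↦ (-1)^{|p||q|} [q ⊗ p]`. -/
noncomputable def swapTrace : (tensor P Q).carrier →+ HH (tensor Q P) 0 :=
  liftB P Q ((AddMonoidHom.compHom (clsZero (tensor Q P))).comp (swapAux P Q))
    (clsZero_swapAux_balanced P Q)

theorem swapTrace_tmulB {i j : ZMod 2} {p : P.carrier} {q : Q.carrier} (hp : p ∈ P.gr i)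
    (hq : q ∈ Q.gr j) : swapTrace P Q (tmulB P Q p q) =
      (-1 : ℤˣ) ^ (i * j) • clsZero (tensor Q P) (tmulB Q P q p) := by
  change clsZero (tensor Q P) (swapAux P Q p q) = _
  rw [swapAux_homogeneous P Q hp hq, map_units]

/-- The mirror image of the previous relation: the trace relation over `A` in the source becomes the
balancing `q a ⊗ p = q ⊗ a p` of `Q ⊗_A P`. -/
theorem swapTrace_op_smul {i j : ZMod 2} {m : (tensor P Q).carrier} {a : A.carrier}
    (hm : m ∈ (tensor P Q).gr i) (ha : a ∈ A.gr j) :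
    swapTrace P Q (MulOpposite.op a • m) = (-1 : ℤˣ) ^ (j * i) • swapTrace P Q (a • m) := by
  have h : (tensor P Q).gr i ≤ AddMonoidHom.eqLocus
      ((swapTrace P Q).comp (DistribSMul.toAddMonoidHom _ (MulOpposite.op a)))
      ((((-1 : ℤˣ) ^ (j * i) : ℤˣ) : ℤ) •
        (swapTrace P Q).comp (DistribSMul.toAddMonoidHom _ a)) := by
    refine (AddSubgroup.closure_le _).2 ?_
    rintro _ ⟨k, l, rfl, p, hp, q, hq, rfl⟩
    change swapTrace P Q (tmulB P Q p (MulOpposite.op a • q)) =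
      (-1 : ℤˣ) ^ (j * (k + l)) • swapTrace P Q (tmulB P Q (a • p) q)
    rw [swapTrace_tmulB P Q hp (Q.op_smul_mem hq ha), swapTrace_tmulB P Q (P.smul_mem ha hp) hq,
      tmulB_balanced, smul_smul, ← uzpow_add]
    have key : ∀ j k l : ZMod 2, k * (l + j) = j * (k + l) + (j + k) * l := by decide
    rw [key]
  exact h hm

/-- The map `H_0(A, P ⊗_B Q) → H_0(B, Q ⊗_A P)`, `[p ⊗ q] ↦ (-1)^{|p||q|} [q ⊗ p]`. -/
noncomputable def swapZero : HH (tensor P Q) 0 →+ HH (tensor Q P) 0 :=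
  descZero (tensor P Q) (swapTrace P Q) fun _ _ _ hm _ ha => swapTrace_op_smul P Q hm ha

theorem swapZero_tmulB {i j : ZMod 2} {p : P.carrier} {q : Q.carrier} (hp : p ∈ P.gr i)
    (hq : q ∈ Q.gr j) : swapZero P Q (clsZero (tensor P Q) (tmulB P Q p q)) =
      (-1 : ℤˣ) ^ (i * j) • clsZero (tensor Q P) (tmulB Q P q p) := by
  rw [swapZero, descZero_clsZero, swapTrace_tmulB P Q hp hq]

theorem swapZero_swapZero (ξ : HH (tensor P Q) 0) : swapZero Q P (swapZero P Q ξ) = ξ := by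
  refine DFunLike.congr_fun (f := (swapZero Q P).comp (swapZero P Q)) (g := AddMonoidHom.id _)
    (clsZero_tensor_hom_ext P Q fun i j p hp q hq => ?_) ξ
  change swapZero Q P (swapZero P Q _) = _
  rw [swapZero_tmulB P Q hp hq, map_units, swapZero_tmulB Q P hq hp, smul_smul, ← uzpow_add,
    mul_comm j, CharTwo.add_self_eq_zero, uzpow_zero, one_smul]
  rfl

theorem swapZero_smul (r : R.carrier) (ξ : HH (tensor P Q) 0) :
    swapZero P Q (r • ξ) = r • swapZero P Q ξ := by
  induction r using DirectSum.Decomposition.inductionOn R.gr with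
  | zero => simp
  | add r r' hr hr' => simp only [add_smul, map_add, hr, hr']
  | @homogeneous l r =>
  refine DFunLike.congr_fun
    (f := (swapZero P Q).comp (DistribSMul.toAddMonoidHom _ (r : R.carrier)))
    (g := (DistribSMul.toAddMonoidHom _ (r : R.carrier)).comp (swapZero P Q))
    (clsZero_tensor_hom_ext P Q fun i j p hp q hq => ?_) ξ
  change swapZero P Q ((r : R.carrier) • _) = (r : R.carrier) • swapZero P Q _
  rw [← clsZero_smul, smul_tmulB, swapZero_tmulB P Q (P.smul_mem (A.algMap_mem r.2) hp) hq,
    swapZero_tmulB P Q hp hq, smul_comm (r : R.carrier), ← clsZero_smul,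
    -- In the source `R` acts from the left through `p`, in the target through `q`. Moving `r` to
    -- the far right on both sides gives the same element, and only signs remain to compare.
    P.base_comm r.2 hp, (tensor Q P).base_comm r.2 (tmulB_mem hq hp), op_smul_tmulB, map_units,
    map_units, map_units, smul_smul, smul_smul, ← uzpow_add, ← uzpow_add]
  have key : ∀ i j l : ZMod 2, (l + i) * j + l * i = i * j + l * (j + i) := by decide
  rw [key]

theorem swapZero_mem {k : ZMod 2} {ξ : HH (tensor P Q) 0} (hξ : ξ ∈ HHgr (tensor P Q) 0 k) :
    swapZero P Q ξ ∈ HHgr (tensor Q P) 0 k := by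
  obtain ⟨x, hx, _, rfl⟩ := mem_HHgr_iff.1 hξ
  have h : (tensor P Q).gr k ≤ (HHgr (tensor Q P) 0 k).comap
      ((swapZero P Q).comp (clsZero (tensor P Q))) := by
    refine (AddSubgroup.closure_le _).2 ?_
    rintro _ ⟨i, j, rfl, p, hp, q, hq, rfl⟩
    change swapZero P Q (clsZero (tensor P Q) (tmulB P Q p q)) ∈ HHgr (tensor Q P) 0 (i + j)
    rw [swapZero_tmulB P Q hp hq, Units.smul_def, add_comm]
    exact zsmul_mem (clsZero_mem _ (tmulB_mem hq hp)) _
  exact h hx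

/-- The isomorphism `H_0(A, P ⊗_B Q) ≅ H_0(B, Q ⊗_A P)`. -/
noncomputable def swapZeroIso : HH (tensor P Q) 0 ≅ HH (tensor Q P) 0 :=
  LinearEquiv.toModuleIso
    { swapZero P Q with
      map_smul' := swapZero_smul P Q
      invFun := swapZero Q P
      left_inv := swapZero_swapZero P Q
      right_inv := swapZero_swapZero Q P }

variable {P Q} {A' B' : SuperAlgebra.{u, v} R} {P' : SuperBimodule.{u, v, v, v} A' B'}
  {Q' : SuperBimodule.{u, v, v, v} B' A'} {f : SuperAlgebraHom A A'} {g : SuperAlgebraHom B B'}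

theorem swapZero_naturality (p : Hom f g P P') (q : Hom g f Q Q') (ξ : HH (tensor P Q) 0) :
    (HHmap (tensorMap q p) 0).hom (swapZero P Q ξ) =
      swapZero P' Q' ((HHmap (tensorMap p q) 0).hom ξ) := by
  refine DFunLike.congr_fun
    (f := (HHmap (tensorMap q p) 0).hom.toAddMonoidHom.comp (swapZero P Q))
    (g := (swapZero P' Q').comp (HHmap (tensorMap p q) 0).hom.toAddMonoidHom)
    (clsZero_tensor_hom_ext P Q fun i j x hx y hy => ?_) ξ
  change (HHmap (tensorMap q p) 0).hom.toAddMonoidHom (swapZero P Q _) =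
    swapZero P' Q' ((HHmap (tensorMap p q) 0).hom _)
  rw [swapZero_tmulB P Q hx hy, map_units, HHmap_clsZero, tensorMap_tmulB,
    swapZero_tmulB P' Q' (p.map_mem hx) (q.map_mem hy)]
  exact congrArg _ (HHmap_clsZero (tensorMap q p) _)

end Swap

/-! ### Dimension shifting -/

/-- Injections identify their domains with their images, and `e` matches the images. The equation
kept in the conclusion determines `E`, since `g` is injective. -/
theorem exists_linearEquiv_of_range {S : Type u} [Ring S] {X X' Y Y' : Type v} [AddCommGroup X]
    [AddCommGroup X'] [AddCommGroup Y] [AddCommGroup Y'] [Module S X] [Module S X'] [Module S Y]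
    [Module S Y'] (f : X →ₗ[S] Y) (g : X' →ₗ[S] Y') (hf : Function.Injective f)
    (hg : Function.Injective g) (e : Y ≃ₗ[S] Y')
    (h : ∀ y, (∃ x, f x = y) ↔ ∃ x', g x' = e y) :
    ∃ E : X ≃ₗ[S] X', ∀ x, g (E x) = e (f x) := by
  have hr : (LinearMap.range f).map (e : Y →ₗ[S] Y') = LinearMap.range g := by
    ext y'
    constructor
    · rintro ⟨y, hy, rfl⟩
      exact (h y).1 hy
    · rintro ⟨x', rfl⟩
      obtain ⟨x, hx⟩ := (h (e.symm (g x'))).2 ⟨x', by simp⟩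
      exact ⟨f x, ⟨x, rfl⟩, by simp [hx]⟩
  refine ⟨(LinearEquiv.ofInjective f hf).trans ((e.submoduleMap (LinearMap.range f)).trans
    ((LinearEquiv.ofEq _ _ hr).trans (LinearEquiv.ofInjective g hg).symm)), fun x => ?_⟩
  exact congrArg Subtype.val ((LinearEquiv.ofInjective g hg).apply_symm_apply _)

/-- A functorial family of even isomorphisms `H_n(A, P ⊗_B Q) ≅ H_n(B, Q ⊗_A P)`. -/
structure TraceIso (R : CommSuperring.{u}) (n : ℕ) where
  iso : ∀ {A B : SuperAlgebra.{u, v} R} (P : SuperBimodule.{u, v, v, v} A B)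
    (Q : SuperBimodule.{u, v, v, v} B A), P.IsBiprojective →
      (HH (tensor P Q) n ≅ HH (tensor Q P) n)
  even : ∀ {A B : SuperAlgebra.{u, v} R} (P : SuperBimodule.{u, v, v, v} A B)
    (Q : SuperBimodule.{u, v, v, v} B A) (hP : P.IsBiprojective) (k : ZMod 2),
      ∀ ξ ∈ HHgr (tensor P Q) n k, (iso P Q hP).hom.hom ξ ∈ HHgr (tensor Q P) n k
  natural : ∀ {A B A' B' : SuperAlgebra.{u, v} R} {P : SuperBimodule.{u, v, v, v} A B}
    {Q : SuperBimodule.{u, v, v, v} B A} {P' : SuperBimodule.{u, v, v, v} A' B'}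
    {Q' : SuperBimodule.{u, v, v, v} B' A'} (hP : P.IsBiprojective) (hP' : P'.IsBiprojective)
    {f : SuperAlgebraHom A A'} {g : SuperAlgebraHom B B'} (p : Hom f g P P') (q : Hom g f Q Q')
    (ξ : HH (tensor P Q) n), (HHmap (tensorMap q p) n).hom ((iso P Q hP).hom.hom ξ) =
      (iso P' Q' hP').hom.hom ((HHmap (tensorMap p q) n).hom ξ)

namespace TraceIso

/-- The isomorphisms in degree zero. -/
noncomputable def zero : TraceIso.{u, v} R 0 where
  iso P Q _ := swapZeroIso P Q
  even P Q _ _ _ hξ := swapZero_mem P Q hξ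
  natural _ _ _ _ p q ξ := swapZero_naturality p q ξ

variable {n : ℕ} (T : TraceIso.{u, v} R n) {A B : SuperAlgebra.{u, v} R}
  (P : SuperBimodule.{u, v, v, v} A B) (Q : SuperBimodule.{u, v, v, v} B A)
  (hP : P.IsBiprojective)

theorem iso_injective : Function.Injective (T.iso P Q hP).hom.hom :=
  (ModuleCat.mono_iff_injective (T.iso P Q hP).hom).1 inferInstance

variable {P}

/-- A chosen section of `A ⊗_R P → P`. -/
noncomputable def leftSection : LeftSection P := (nonempty_leftSection P hP.1).some

/-- The connecting map `H_{n+1}(A, P ⊗_B Q) → H_n(A, P ⊗_B K)`. -/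
noncomputable def connectingLeft (P : SuperBimodule.{u, v, v, v} A B) (n : ℕ) :
    HH (tensor P Q) (n + 1) ⟶ HH (tensor P (syzygy Q)) n :=
  (splittingLeft P Q).connecting n

/-- The connecting map `H_{n+1}(B, Q ⊗_A P) → H_n(B, K ⊗_A P)`. -/
noncomputable def connectingRight (n : ℕ) :
    HH (tensor Q P) (n + 1) ⟶ HH (tensor (syzygy Q) P) n :=
  (splittingRight Q (leftSection hP)).connecting n

theorem connectingLeft_injective (n : ℕ) : Function.Injective (connectingLeft Q P n).hom :=
  (splittingLeft P Q).connecting_injective n (HH_tensor_tensorAlg_eq_zero P Q n)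

theorem connectingRight_injective (n : ℕ) : Function.Injective (connectingRight Q hP n).hom :=
  (splittingRight Q (leftSection hP)).connecting_injective n
    (HH_tensorAlg_tensor_eq_zero P Q hP.2 n)

/-- By vanishing of the middle terms both sides embed in degree `n`, with images the kernels of the
maps induced by the inclusion of the syzygy into `Q ⊗_R A`. The square in the conclusion is all that
is used about `e` afterwards. -/
theorem exists_succ : ∃ e : HH (tensor P Q) (n + 1) ≅ HH (tensor Q P) (n + 1),
    ∀ ξ, (connectingRight Q hP n).hom (e.hom.hom ξ) =
      (T.iso P (syzygy Q) hP).hom.hom ((connectingLeft Q P n).hom ξ) := by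
  obtain ⟨E, hE⟩ := exists_linearEquiv_of_range (connectingLeft Q P n).hom
    (connectingRight Q hP n).hom (connectingLeft_injective Q n) (connectingRight_injective Q hP n)
    (T.iso P (syzygy Q) hP).toLinearEquiv fun ξ => by
      refine ((splittingLeft P Q).range_connecting n ξ).trans (Iff.trans ?_
        ((splittingRight Q (leftSection hP)).range_connecting n _).symm)
      -- Naturality in degree `n` along the syzygy inclusion relates the two kernels.
      have h := T.natural hP hP (Hom.id P) (syzygyι Q) ξ
      constructor
      · intro h0
        rw [h0, map_zero] at h
        exact h
      · intro h0
        -- The reverse inclusion of kernels uses injectivity of the isomorphism for the middle term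
        -- `Q ⊗_R A`.
        refine T.iso_injective P (tensorAlg Q) hP (h.symm.trans (Eq.trans h0 ?_))
        exact (map_zero _).symm
  exact ⟨E.toModuleIso, hE⟩

/-- The isomorphisms in degree `n + 1`, from those in degree `n`. -/
noncomputable def succ : TraceIso.{u, v} R (n + 1) where
  iso P Q hP := (T.exists_succ Q hP).choose
  even P Q hP k ξ hξ := by
    -- The right connecting map is injective and even, so parity can be tested after applying it,
    -- where the defining square reduces to degree `n`.
    refine mem_HHgr_of_map_mem (connectingRight Q hP n).hom.toAddMonoidHom
      (connectingRight_injective Q hP n)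
      (fun k ξ hξ => (splittingRight Q (leftSection hP)).connecting_mem n hξ) ?_
    refine (congrArg (· ∈ HHgr (tensor (syzygy Q) P) n k)
      ((T.exists_succ Q hP).choose_spec ξ)).mpr ?_
    exact T.even P (syzygy Q) hP k _ ((splittingLeft P Q).connecting_mem n hξ)
  natural {A B A' B' P Q P' Q'} hP hP' f g p q ξ := by
    -- The isomorphisms were obtained by choice, but their composites with the connecting maps are
    -- prescribed. Comparing after the injective connecting map leaves only naturality of the two
    -- connecting maps and of `T` for the syzygies.
    refine connectingRight_injective Q' hP' n ?_
    have h1 := (splittingRight Q (leftSection hP)).connecting_naturality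
      (splittingRight Q' (leftSection hP')) (tensorMap (syzygyMap q) p)
      (tensorMap (tensorAlgMap q) p) (tensorMap q p)
      (fun x => DFunLike.congr_fun
        (f := (tensorMap (tensorAlgMap q) p).toFun.comp (tensorMap (syzygyι Q) (Hom.id P)).toFun)
        (g := (tensorMap (syzygyι Q') (Hom.id P')).toFun.comp (tensorMap (syzygyMap q) p).toFun)
        (tensor_hom_ext fun _ _ => rfl) x)
      (fun x => DFunLike.congr_fun
        (f := (tensorMap q p).toFun.comp (tensorMap (rightAct Q) (Hom.id P)).toFun)
        (g := (tensorMap (rightAct Q') (Hom.id P')).toFun.comp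
          (tensorMap (tensorAlgMap q) p).toFun)
        (tensor_hom_ext fun y z => congrArg (fun w => tmulB Q' P' w (p.toFun z))
          (rightAct_tensorAlgMap q y).symm) x) n
      ((T.exists_succ Q hP).choose.hom.hom ξ)
    have h2 := (splittingLeft P Q).connecting_naturality
      (splittingLeft P' Q') (tensorMap p (syzygyMap q))
      (tensorMap p (tensorAlgMap q)) (tensorMap p q)
      (fun x => DFunLike.congr_fun
        (f := (tensorMap p (tensorAlgMap q)).toFun.comp (tensorMap (Hom.id P) (syzygyι Q)).toFun)
        (g := (tensorMap (Hom.id P') (syzygyι Q')).toFun.comp (tensorMap p (syzygyMap q)).toFun)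
        (tensor_hom_ext fun _ _ => rfl) x)
      (fun x => DFunLike.congr_fun
        (f := (tensorMap p q).toFun.comp (tensorMap (Hom.id P) (rightAct Q)).toFun)
        (g := (tensorMap (Hom.id P') (rightAct Q')).toFun.comp
          (tensorMap p (tensorAlgMap q)).toFun)
        (tensor_hom_ext fun z y => congrArg (tmulB P' Q' (p.toFun z))
          (rightAct_tensorAlgMap q y).symm) x) n ξ
    refine h1.trans ?_
    refine (congrArg (HHmap (tensorMap (syzygyMap q) p) n).hom
      ((T.exists_succ Q hP).choose_spec ξ)).trans ?_
    refine (T.natural hP hP' p (syzygyMap q) _).trans ?_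
    refine (congrArg (T.iso P' (syzygy Q') hP').hom.hom h2.symm).trans ?_
    exact ((T.exists_succ Q' hP').choose_spec _).symm

end TraceIso

/-- The isomorphisms `H_n(A, P ⊗_B Q) ≅ H_n(B, Q ⊗_A P)`. -/
noncomputable def traceIso (R : CommSuperring.{u}) : (n : ℕ) → TraceIso.{u, v} R n
  | 0 => TraceIso.zero
  | n + 1 => (traceIso R n).succ

end SuperBimodule

end SuperHochschild

/-! ### The theorem -/

theorem mainTheorem1 (R : SuperHochschild.CommSuperring.{u}) :
    ∃ F : ∀ (A B : SuperHochschild.SuperAlgebra.{u, v} R)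
        (P : SuperHochschild.SuperBimodule.{u, v, v, v} A B)
        (Q : SuperHochschild.SuperBimodule.{u, v, v, v} B A),
        P.IsBiprojective → ∀ n : ℕ, (P.tensor Q).HH n ≅ (Q.tensor P).HH n,
      (∀ (A B : SuperHochschild.SuperAlgebra.{u, v} R)
        (P : SuperHochschild.SuperBimodule.{u, v, v, v} A B)
        (Q : SuperHochschild.SuperBimodule.{u, v, v, v} B A)
        (hP : P.IsBiprojective) (n : ℕ) (k : ZMod 2),
        ((P.tensor Q).HHgr n k).map (F A B P Q hP n).hom.hom.toAddMonoidHom =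
          (Q.tensor P).HHgr n k) ∧
      (∀ (A B A' B' : SuperHochschild.SuperAlgebra.{u, v} R)
        (P : SuperHochschild.SuperBimodule.{u, v, v, v} A B)
        (Q : SuperHochschild.SuperBimodule.{u, v, v, v} B A)
        (P' : SuperHochschild.SuperBimodule.{u, v, v, v} A' B')
        (Q' : SuperHochschild.SuperBimodule.{u, v, v, v} B' A')
        (hP : P.IsBiprojective) (hP' : P'.IsBiprojective)
        (f : SuperHochschild.SuperAlgebraHom A A') (g : SuperHochschild.SuperAlgebraHom B B')
        (p : SuperHochschild.SuperBimodule.Hom f g P P')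
        (q : SuperHochschild.SuperBimodule.Hom g f Q Q') (n : ℕ),
        (F A B P Q hP n).hom ≫
            SuperHochschild.SuperBimodule.HHmap (SuperHochschild.SuperBimodule.tensorMap q p) n =
          SuperHochschild.SuperBimodule.HHmap (SuperHochschild.SuperBimodule.tensorMap p q) n ≫
            (F A' B' P' Q' hP' n).hom) :=
  ⟨fun _ _ P Q hP n => (SuperHochschild.SuperBimodule.traceIso R n).iso P Q hP,
    fun _ _ P Q hP n k => SuperHochschild.SuperBimodule.HHgr_map_iso _
      ((SuperHochschild.SuperBimodule.traceIso R n).even P Q hP) k,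
    fun _ _ _ _ _ _ _ _ hP hP' _ _ p q n => by
      ext ξ
      exact (SuperHochschild.SuperBimodule.traceIso R n).natural hP hP' p q ξ⟩
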